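/- Let $k$ be a commutative ring and let $(\mathcal A,\mathbb E,\mathfrak s)$ be a $k$-linear extriangulated category (Nakaoka--Palu) that is weakly idempotent complete, i.e. every section in $\mathcal A$ has a cokernel. Let $\mathcal N\subseteq\mathcal A$ be a full additive subcategory that is closed under isomorphisms, extensions and direct summands. For objects $A,C$ put $$\mathbb E_{[\mathcal N]}(C,A)=\sum_{f\colon C\to N,\ N\in\mathcal N}\operatorname{Im}\big(f^*\colon\mathbb E(N,A)\to\mathbb E(C,A)\big),\qquad \mathbb E^{[\mathcal N]}(C,A)=\sum_{f\colon N\to A,\ N\in\mathcal N}\operatorname{Im}\big(f_*\colon\mathbb E(C,N)\to\mathbb E(C,A)\big),$$ $$\mathbb E^R_{\mathcal N}(C,A)=\{\delta\in\mathbb E(C,A)\mid a_*\delta\in\mathbb E_{[\mathcal N]}(C,N)\text{ for all }a\colon A\to N,\ N\in\mathcal N\},$$ $$\mathbb E^L_{\mathcal N}(C,A)=\{\delta\in\mathbb E(C,A)\mid c^*\delta\in\mathbb E^{[\mathcal N]}(N,A)\text{ for all }c\colon N\to C,\ N\in\mathcal N\},$$ and $\mathbb E_{\mathcal N}=\mathbb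 E^R_{\mathcal N}\cap\mathbb E^L_{\mathcal N}$. Then $\mathbb E_{\mathcal N}$ is a closed additive subbifunctor of $\mathbb E$, i.e. $\mathcal A_{\mathcal N}=(\mathcal A,\mathbb E_{\mathcal N},\mathfrak s_{\mathcal N}=\mathfrak s|_{\mathbb E_{\mathcal N}})$ is an extriangulated category, and the following hold. (0) $(\mathcal N,\mathbb E|_{\mathcal N},\mathfrak s|_{\mathcal N})=(\mathcal N,\mathbb E_{\mathcal N}|_{\mathcal N},\mathfrak s_{\mathcal N}|_{\mathcal N})$ as extriangulated categories. (1) The pair $(\mathcal A_{\mathcal N},\mathcal N)$ satisfies ($\spadesuit$): for every $\mathfrak s_{\mathcal N}$-inflation $f\colon N_1\to B$ with $N_1\in\mathcal N$ there are $N_2\in\mathcal N$ and $b\colon B\to N_2$ such that $bf$ is an $\mathfrak s_{\mathcal N}|_{\mathcal N}$-inflation; and dually for every $\mathfrak s_{\mathcal N}$-deflation $g\colon B\to N_3$ with $N_3\in\mathcal N$ there are $N_2\in\mathcal N$ and $b\colon N_2\to B$ such that $gb$ is an $\mathfrak s_{\mathcal N}|_{\mathcal N}$-deflation. Let $\mathrm{Inf}_{\mathcal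 N}$ be the class of $\mathfrak s_{\mathcal N}$-inflations with cone in $\mathcal N$, let $\mathrm{Def}_{\mathcal N}$ be the class of $\mathfrak s_{\mathcal N}$-deflations with cocone in $\mathcal N$, let $\mathrm{Inf}^{sp}_{\mathcal N}$ be the sections in $\mathrm{Inf}_{\mathcal N}$ and $\mathrm{Def}^{sp}_{\mathcal N}$ the retractions in $\mathrm{Def}_{\mathcal N}$, and let $\mathcal S_{\mathcal N}$ be the smallest class of morphisms that contains $\mathrm{Inf}_{\mathcal N}\cup\mathrm{Def}_{\mathcal N}$ and is closed under composition. (2) The pair $(\mathcal A_{\mathcal N},\mathcal N)$ is admissible. That is, $\mathcal N$ is thick in $\mathcal A_{\mathcal N}$ (closed under direct summands and isomorphisms, with 2-out-of-3 for $\mathfrak s_{\mathcal N}$-conflations); $\mathcal S_{\mathcal N}$ contains all isomorphisms and is closed under composition and finite direct sums; and, with $\mathcal N_{\mathcal S}$ the full subcategory of the objects $X$ such that $X\to0$ and $0\to X$ belong to $\mathcal S_{\mathcal N}$, with $p\colon\mathcal A\to\overline{\mathcal A}=\mathcal A/[\mathcal N_{\mathcal S}]$ the ideal quotient, $\bar f=p(f)$,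 and $\overline{\mathcal S}$ the closure of $p(\mathcal S_{\mathcal N})$ under composition with isomorphisms, one has $\overline{\mathcal S}=p(\mathcal S_{\mathcal N})$ and (MR1) $\overline{\mathcal S}$ has the 2-out-of-3 property; (MR2) $\overline{\mathcal S}$ is a multiplicative system (it has left and right calculus of fractions); (MR3) for $\mathfrak s_{\mathcal N}$-triangles $A\xrightarrow{x}B\xrightarrow{y}C\overset{\delta}{\dashrightarrow}$ and $A'\xrightarrow{x'}B'\xrightarrow{y'}C'\overset{\delta'}{\dashrightarrow}$ and morphisms $a\colon A\to A'$, $c\colon C\to C'$ with $a_*\delta=c^*\delta'$ and $\bar a,\bar c\in\overline{\mathcal S}$, there is $\bar b\colon B\to B'$ in $\overline{\mathcal S}$ with $\bar b\bar x=\bar x'\bar a$ and $\bar c\bar y=\bar y'\bar b$; (MR4) the class of the morphisms $\bar v\bar x\bar u$ with $x$ an $\mathfrak s_{\mathcal N}$-inflation and $\bar u,\bar v\in\overline{\mathcal S}$ is closed under composition, and so is the one defined with $\mathfrak s_{\mathcal N}$-deflations. Moreover the Gabriel--Zisman localization $\mathcal A_{\mathcal N}/\mathcal N=\mathcal A[\mathcal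 S_{\mathcal N}^{-1}]$ carries the structure $(\widetilde{\mathbb E_{\mathcal N}},\widetilde{\mathfrak s_{\mathcal N}})$ of a $k$-linear extriangulated category, and the localization functor $Q$ underlies an exact functor $(Q,\mu)$, such that $$(\mathcal N,\mathbb E|_{\mathcal N},\mathfrak s|_{\mathcal N})\to(\mathcal A_{\mathcal N},\mathbb E_{\mathcal N},\mathfrak s_{\mathcal N})\xrightarrow{(Q,\mu)}(\mathcal A_{\mathcal N}/\mathcal N,\widetilde{\mathbb E_{\mathcal N}},\widetilde{\mathfrak s_{\mathcal N}})$$ is an exact sequence of extriangulated categories: $\mathcal N$ is the (essential) image of the inclusion and equals $\operatorname{Ker}Q=\{X\mid QX\cong0\}$, and every exact functor $(G,\psi)$ from $\mathcal A_{\mathcal N}$ to a $k$-linear extriangulated category with $G|_{\mathcal N}=0$ factors as $(G,\psi)=(G',\psi')\circ(Q,\mu)$ for a unique exact functor $(G',\psi')$. (3) $\mathcal S_{\mathcal N}=\mathrm{Def}^{sp}_{\mathcal N}\circ\mathrm{Inf}_{\mathcal N}=\mathrm{Def}_{\mathcal N}\circ\mathrm{Inf}^{sp}_{\mathcal N}$,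 and $\mathcal S_{\mathcal N}$ is saturated: a morphism $s$ of $\mathcal A$ belongs to $\mathcal S_{\mathcal N}$ if and only if $Q(s)$ is an isomorphism. -/

import Mathlib

open CategoryTheory CategoryTheory.Limits Opposite

universe u v w u₁ v₁ w₁ u₂ v₂ w₂ t

namespace Extri

/-! ### Extriangulated categories -/

/-- The data `(𝔼, 𝔰)` of an extriangulated structure on a `k`-linear category `C`:
a bifunctor `𝔼 : Cᵒᵖ × C → Mod k`, and a correspondence `𝔰` between extensions and three-term
sequences.  `realizes x y δ` means that the sequence `A --x--> B --y--> C` belongs to the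
equivalence class `𝔰(δ)`, i.e. that `A --x--> B --y--> C --δ-->` is an `𝔰`-triangle.
No axiom is part of this structure; see `IsExtriangulated`. -/
structure ExtriData (k : Type t) [CommRing k] (C : Type u) [Category.{v} C] [Preadditive C]
    [Linear k C] where
  /-- the bifunctor of extensions, `𝔼(Z, X) = (E.obj (op Z)).obj X` -/
  E : Cᵒᵖ ⥤ C ⥤ ModuleCat.{w} k
  /-- the sequence `X ⟶ Y ⟶ Z` realizes the extension `δ ∈ 𝔼(Z, X)` -/
  realizes : ∀ {X Y Z : C}, (X ⟶ Y) → (Y ⟶ Z) → (E.obj (op Z)).obj X → Prop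

namespace ExtriData

variable {k : Type t} [CommRing k] {C : Type u} [Category.{v} C] [Preadditive C] [Linear k C]
  (D : ExtriData.{u, v, w} k C)

/-- The module of extensions `𝔼(Z, X)`. -/
abbrev Ext (Z X : C) : Type w := (D.E.obj (op Z)).obj X

/-- `a_* = 𝔼(Z, a) : 𝔼(Z, X) → 𝔼(Z, X')`. -/
def push (Z : C) {X X' : C} (a : X ⟶ X') : D.Ext Z X →ₗ[k] D.Ext Z X' :=
  ((D.E.obj (op Z)).map a).hom

/-- `c^* = 𝔼(c, X) : 𝔼(Z, X) → 𝔼(Z', X)`. -/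
def pull {Z' Z : C} (c : Z' ⟶ Z) (X : C) : D.Ext Z X →ₗ[k] D.Ext Z' X :=
  ((D.E.map c.op).app X).hom

/-- `(C, 𝔼, 𝔰)` is a (`k`-linear) extriangulated category. -/
structure IsExtriangulated : Prop where
  /-- `C` is an additive category -/
  [hasZeroObject : HasZeroObject C]
  [hasBinaryBiproducts : HasBinaryBiproducts C]
  /-- (ET1) `𝔼` is biadditive and `k`-bilinear -/
  push_add : ∀ (Z : C) {X X' : C} (a a' : X ⟶ X') (δ : D.Ext Z X),
    D.push Z (a + a') δ = D.push Z a δ + D.push Z a' δ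
  push_smul : ∀ (Z : C) {X X' : C} (r : k) (a : X ⟶ X') (δ : D.Ext Z X),
    D.push Z (r • a) δ = r • D.push Z a δ
  pull_add : ∀ {Z' Z : C} (c c' : Z' ⟶ Z) (X : C) (δ : D.Ext Z X),
    D.pull (c + c') X δ = D.pull c X δ + D.pull c' X δ
  pull_smul : ∀ {Z' Z : C} (r : k) (c : Z' ⟶ Z) (X : C) (δ : D.Ext Z X),
    D.pull (r • c) X δ = r • D.pull c X δ
  /-- `𝔰(δ)` is a nonempty class of sequences ... -/
  exists_realizes : ∀ {Z X : C} (δ : D.Ext Z X),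
    ∃ (Y : C) (x : X ⟶ Y) (y : Y ⟶ Z), D.realizes x y δ
  /-- ... namely one full equivalence class -/
  realizes_iff : ∀ {X Y Y' Z : C} {x : X ⟶ Y} {y : Y ⟶ Z} {δ : D.Ext Z X},
    D.realizes x y δ → ∀ (x' : X ⟶ Y') (y' : Y' ⟶ Z),
      (D.realizes x' y' δ ↔ ∃ b : Y ≅ Y', x ≫ b.hom = x' ∧ b.hom ≫ y' = y)
  /-- (ET2) `𝔰` is a realization: morphisms of extensions lift to morphisms of sequences -/
  exists_lift : ∀ {X Y Z X' Y' Z' : C} {x : X ⟶ Y} {y : Y ⟶ Z} {δ : D.Ext Z X}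
    {x' : X' ⟶ Y'} {y' : Y' ⟶ Z'} {δ' : D.Ext Z' X'},
    D.realizes x y δ → D.realizes x' y' δ' → ∀ (a : X ⟶ X') (c : Z ⟶ Z'),
      D.push Z a δ = D.pull c X' δ' → ∃ b : Y ⟶ Y', x ≫ b = a ≫ x' ∧ b ≫ y' = y ≫ c
  /-- (ET2) the realization is additive: zero extensions are split -/
  realizes_zero : ∀ (Z X : C),
    D.realizes (biprod.inl : X ⟶ X ⊞ Z) (biprod.snd : X ⊞ Z ⟶ Z) 0
  /-- (ET2) the realization is additive: `𝔰(δ ⊕ δ') = 𝔰(δ) ⊕ 𝔰(δ')` -/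
  realizes_sum : ∀ {X Y Z X' Y' Z' : C} {x : X ⟶ Y} {y : Y ⟶ Z} {δ : D.Ext Z X}
    {x' : X' ⟶ Y'} {y' : Y' ⟶ Z'} {δ' : D.Ext Z' X'},
    D.realizes x y δ → D.realizes x' y' δ' →
      D.realizes (biprod.map x x') (biprod.map y y')
        (D.push _ (biprod.inl : X ⟶ X ⊞ X') (D.pull (biprod.fst : Z ⊞ Z' ⟶ Z) _ δ) +
          D.push _ (biprod.inr : X' ⟶ X ⊞ X') (D.pull (biprod.snd : Z ⊞ Z' ⟶ Z') _ δ'))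
  /-- (ET3) -/
  et3 : ∀ {X Y Z X' Y' Z' : C} {x : X ⟶ Y} {y : Y ⟶ Z} {δ : D.Ext Z X}
    {x' : X' ⟶ Y'} {y' : Y' ⟶ Z'} {δ' : D.Ext Z' X'},
    D.realizes x y δ → D.realizes x' y' δ' → ∀ (a : X ⟶ X') (b : Y ⟶ Y'),
      x ≫ b = a ≫ x' → ∃ c : Z ⟶ Z', y ≫ c = b ≫ y' ∧ D.push Z a δ = D.pull c X' δ'
  /-- (ET3)ᵒᵖ -/
  et3_op : ∀ {X Y Z X' Y' Z' : C} {x : X ⟶ Y} {y : Y ⟶ Z} {δ : D.Ext Z X}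
    {x' : X' ⟶ Y'} {y' : Y' ⟶ Z'} {δ' : D.Ext Z' X'},
    D.realizes x y δ → D.realizes x' y' δ' → ∀ (b : Y ⟶ Y') (c : Z ⟶ Z'),
      y ≫ c = b ≫ y' → ∃ a : X ⟶ X', x ≫ b = a ≫ x' ∧ D.push Z a δ = D.pull c X' δ'
  /-- (ET4) -/
  et4 : ∀ {A B X₁ Y F : C} {f : A ⟶ B} {f' : B ⟶ X₁} {δ : D.Ext X₁ A}
    {g : B ⟶ Y} {g' : Y ⟶ F} {ρ : D.Ext F B},
    D.realizes f f' δ → D.realizes g g' ρ →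
      ∃ (G : C) (h' : Y ⟶ G) (d : X₁ ⟶ G) (e : G ⟶ F) (δ' : D.Ext G A),
        D.realizes (f ≫ g) h' δ' ∧ D.realizes d e (D.push F f' ρ) ∧
        g ≫ h' = f' ≫ d ∧ h' ≫ e = g' ∧
        D.pull d A δ' = δ ∧ D.push G f δ' = D.pull e B ρ
  /-- (ET4)ᵒᵖ -/
  et4_op : ∀ {A B X₁ Y F : C} {f' : X₁ ⟶ A} {f : A ⟶ B} {δ : D.Ext B X₁}
    {g' : F ⟶ B} {g : B ⟶ Y} {ρ : D.Ext Y F},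
    D.realizes f' f δ → D.realizes g' g ρ →
      ∃ (G : C) (h' : G ⟶ A) (d : X₁ ⟶ G) (e : G ⟶ F) (δ' : D.Ext Y G),
        D.realizes h' (f ≫ g) δ' ∧ D.realizes d e (D.pull g' X₁ δ) ∧
        d ≫ h' = f' ∧ h' ≫ f = e ≫ g' ∧
        D.push Y e δ' = ρ ∧ D.push B d δ = D.pull g G δ'

/-- `X ⟶ Y ⟶ Z` is an `𝔰`-conflation. -/
def IsConflation {X Y Z : C} (x : X ⟶ Y) (y : Y ⟶ Z) : Prop :=
  ∃ δ : D.Ext Z X, D.realizes x y δ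

/-- `x` is an `𝔰`-inflation. -/
def IsInflation {X Y : C} (x : X ⟶ Y) : Prop :=
  ∃ (Z : C) (y : Y ⟶ Z), D.IsConflation x y

/-- `y` is an `𝔰`-deflation. -/
def IsDeflation {Y Z : C} (y : Y ⟶ Z) : Prop :=
  ∃ (X : C) (x : X ⟶ Y), D.IsConflation x y

end ExtriData

/-- A category is weakly idempotent complete if every section has a cokernel. -/
def WeaklyIdempotentComplete (C : Type u) [Category.{v} C] [Preadditive C] : Prop :=
  ∀ ⦃X Y : C⦄ (s : X ⟶ Y), IsSplitMono s → HasCokernel s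

/-! ### Exact functors -/

/-- An exact functor `(F, φ)` between categories equipped with extriangulated structures. -/
structure ExactFunctor {k : Type t} [CommRing k]
    {C : Type u} [Category.{v} C] [Preadditive C] [Linear k C]
    {C' : Type u₁} [Category.{v₁} C'] [Preadditive C'] [Linear k C']
    (D : ExtriData.{u, v, w} k C) (D' : ExtriData.{u₁, v₁, w₁} k C') where
  /-- the underlying functor `F` -/
  toFunctor : C ⥤ C'
  additive : toFunctor.Additive
  linear : toFunctor.Linear k
  /-- `φ_{Z, X} : 𝔼(Z, X) → 𝔼'(F Z, F X)` -/
  φ : ∀ Z X : C, D.Ext Z X →ₗ[k] D'.Ext (toFunctor.obj Z) (toFunctor.obj X)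
  /-- `φ` is natural -/
  φ_push : ∀ (Z : C) {X X' : C} (a : X ⟶ X') (δ : D.Ext Z X),
    φ Z X' (D.push Z a δ) = D'.push _ (toFunctor.map a) (φ Z X δ)
  φ_pull : ∀ {Z' Z : C} (c : Z' ⟶ Z) (X : C) (δ : D.Ext Z X),
    φ Z' X (D.pull c X δ) = D'.pull (toFunctor.map c) _ (φ Z X δ)
  /-- `(F, φ)` sends `𝔰`-triangles to `𝔰'`-triangles -/
  map_realizes : ∀ {X Y Z : C} {x : X ⟶ Y} {y : Y ⟶ Z} {δ : D.Ext Z X},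
    D.realizes x y δ → D'.realizes (toFunctor.map x) (toFunctor.map y) (φ Z X δ)

/-- The composite of exact functors, `(F, φ)` followed by `(G, ψ)`. -/
def ExactFunctor.comp {k : Type t} [CommRing k]
    {C : Type u} [Category.{v} C] [Preadditive C] [Linear k C]
    {C' : Type u₁} [Category.{v₁} C'] [Preadditive C'] [Linear k C']
    {C'' : Type u₂} [Category.{v₂} C''] [Preadditive C''] [Linear k C'']
    {D : ExtriData.{u, v, w} k C} {D' : ExtriData.{u₁, v₁, w₁} k C'}
    {D'' : ExtriData.{u₂, v₂, w₂} k C''}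
    (F : ExactFunctor D D') (G : ExactFunctor D' D'') : ExactFunctor D D'' where
  toFunctor := F.toFunctor ⋙ G.toFunctor
  additive := by
    have := F.additive
    have := G.additive
    infer_instance
  linear := by
    have := F.linear
    have := G.linear
    infer_instance
  φ Z X := G.φ (F.toFunctor.obj Z) (F.toFunctor.obj X) ∘ₗ F.φ Z X
  φ_push Z X X' a δ := by
    simp only [LinearMap.comp_apply, F.φ_push, G.φ_push, Functor.comp_map]
    rfl
  φ_pull c X δ := by
    simp only [LinearMap.comp_apply, F.φ_pull, G.φ_pull, Functor.comp_map]
    rfl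
  map_realizes h := G.map_realizes (F.map_realizes h)

/-! ### Subcategories -/

namespace ExtriData

variable {k : Type t} [CommRing k] {C : Type u} [Category.{v} C] [Preadditive C] [Linear k C]
  (D : ExtriData.{u, v, w} k C) (N : ObjectProperty C)

/-- The restriction `(N, 𝔼|_N, 𝔰|_N)` to a full subcategory `N`. -/
def full : ExtriData.{u, v, w} k N.FullSubcategory where
  E := N.ι.op ⋙ D.E ⋙ (Functor.whiskeringLeft _ _ _).obj N.ι
  realizes x y δ := D.realizes x.hom y.hom δ

/-- The inclusion `(N, 𝔼|_N, 𝔰|_N) ⟶ (C, 𝔼, 𝔰)`. -/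
def inc : ExactFunctor (D.full N) D where
  toFunctor := N.ι
  additive := { }
  linear := { }
  φ _ _ := LinearMap.id
  φ_push _ _ _ _ _ := rfl
  φ_pull _ _ _ := rfl
  map_realizes h := h

/-- `N` is an extension-closed (full, additive) subcategory of `(C, 𝔼, 𝔰)`. Closure under finite
direct sums is the case of split conflations. -/
structure IsExtensionClosed : Prop where
  containsZero : N.ContainsZero
  isoClosed : N.IsClosedUnderIsomorphisms
  ext : ∀ {X Y Z : C} (x : X ⟶ Y) (y : Y ⟶ Z), D.IsConflation x y → N X → N Z → N Y

/-- `N` is closed under direct summands. -/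
def _root_.Extri.ClosedUnderSummands {C : Type u} [Category.{v} C] [Preadditive C]
    (N : ObjectProperty C) : Prop :=
  ∀ (X Y : C) [HasBinaryBiproduct X Y], N (X ⊞ Y) → N X

/-- `N` is a thick subcategory of `(C, 𝔼, 𝔰)`. -/
structure IsThick : Prop extends IsExtensionClosed D N where
  summands : ClosedUnderSummands N
  cone : ∀ {X Y Z : C} (x : X ⟶ Y) (y : Y ⟶ Z), D.IsConflation x y → N X → N Y → N Z
  cocone : ∀ {X Y Z : C} (x : X ⟶ Y) (y : Y ⟶ Z), D.IsConflation x y → N Y → N Z → N X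

/-- The condition `(♠)` for the pair `(C, N)`. -/
structure Spade : Prop where
  inflation : ∀ (N₁ : N.FullSubcategory) (B : C) (f : N₁.obj ⟶ B), D.IsInflation f →
    ∃ (N₂ : N.FullSubcategory) (b : B ⟶ N₂.obj),
      (D.full N).IsInflation (ObjectProperty.homMk (f ≫ b) : N₁ ⟶ N₂)
  deflation : ∀ (B : C) (N₃ : N.FullSubcategory) (g : B ⟶ N₃.obj), D.IsDeflation g →
    ∃ (N₂ : N.FullSubcategory) (b : N₂.obj ⟶ B),
      (D.full N).IsDeflation (ObjectProperty.homMk (b ≫ g) : N₂ ⟶ N₃)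

/-! ### Additive subbifunctors and substructures -/

/-- An additive (`k`-linear) subbifunctor of `𝔼`. -/
structure SubBifunctor where
  /-- the submodule of `𝔼(Z, X)` -/
  carrier : ∀ Z X : C, Submodule k (D.Ext Z X)
  push_mem : ∀ (Z : C) {X X' : C} (a : X ⟶ X') {δ : D.Ext Z X},
    δ ∈ carrier Z X → D.push Z a δ ∈ carrier Z X'
  pull_mem : ∀ {Z' Z : C} (c : Z' ⟶ Z) (X : C) {δ : D.Ext Z X},
    δ ∈ carrier Z X → D.pull c X δ ∈ carrier Z' X

variable {D} in
/-- The data `(𝔽, 𝔰|_𝔽)` obtained by restricting `(𝔼, 𝔰)` to a subbifunctor `𝔽` of `𝔼`. -/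
def SubBifunctor.restrict (F : D.SubBifunctor) : ExtriData.{u, v, w} k C where
  E :=
    { obj := fun Z =>
        { obj := fun X => ModuleCat.of k (F.carrier Z.unop X)
          map := fun a => ModuleCat.ofHom
            ((D.push Z.unop a).restrict fun _ h => F.push_mem Z.unop a h)
          map_id := fun X => ModuleCat.hom_ext (LinearMap.ext fun δ => Subtype.ext (by
            simp [push]))
          map_comp := fun a b => ModuleCat.hom_ext (LinearMap.ext fun δ => Subtype.ext (by
            simp [push])) }
      map := fun c =>
        { app := fun X => ModuleCat.ofHom
            ((D.pull c.unop X).restrict fun _ h => F.pull_mem c.unop X h)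
          naturality := fun X X' a => ModuleCat.hom_ext (LinearMap.ext fun δ => Subtype.ext
            (congrArg (fun f => f.hom δ.1) ((D.E.map c).naturality a))) }
      map_id := fun Z => NatTrans.ext (funext fun X => ModuleCat.hom_ext
        (LinearMap.ext fun δ => Subtype.ext (by simp [pull])))
      map_comp := fun c c' => NatTrans.ext (funext fun X => ModuleCat.hom_ext
        (LinearMap.ext fun δ => Subtype.ext (by simp [pull]))) }
  realizes x y δ := D.realizes x y δ.1

variable {D} in
/-- The subbifunctor `𝔽` of `𝔼` is closed: `(C, 𝔽, 𝔰|_𝔽)` is an extriangulated category. -/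
def SubBifunctor.IsClosed (F : D.SubBifunctor) : Prop := F.restrict.IsExtriangulated

theorem pull_push {Z' Z X X' : C} (c : Z' ⟶ Z) (a : X ⟶ X') (δ : D.Ext Z X) :
    D.pull c X' (D.push Z a δ) = D.push Z' a (D.pull c X δ) :=
  congrArg (fun f => f.hom δ) ((D.E.map c.op).naturality a)

theorem push_comp {Z X X' X'' : C} (a : X ⟶ X') (b : X' ⟶ X'') (δ : D.Ext Z X) :
    D.push Z (a ≫ b) δ = D.push Z b (D.push Z a δ) := by
  simp [push]

theorem pull_comp {Z'' Z' Z X : C} (c : Z'' ⟶ Z') (d : Z' ⟶ Z) (δ : D.Ext Z X) :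
    D.pull (c ≫ d) X δ = D.pull c X (D.pull d X δ) := by
  simp [pull]

/-- `𝔼_{[N]}(Z, X) = ∑_{f : Z ⟶ M, M ∈ N} Im (𝔼(M, X) → 𝔼(Z, X))`. -/
def lowerSub : D.SubBifunctor where
  carrier Z X := ⨆ (M : C) (_ : N M) (f : Z ⟶ M), LinearMap.range (D.pull f X)
  push_mem Z X X' a δ hδ := by
    rw [← Submodule.mem_comap]
    refine (iSup_le fun M => iSup_le fun hM => iSup_le fun f => ?_ :
      (⨆ (M : C) (_ : N M) (f : Z ⟶ M), LinearMap.range (D.pull f X)) ≤ _) hδ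
    rintro _ ⟨η, rfl⟩
    rw [Submodule.mem_comap, ← pull_push]
    exact Submodule.mem_iSup_of_mem M (Submodule.mem_iSup_of_mem hM
      (Submodule.mem_iSup_of_mem f ⟨_, rfl⟩))
  pull_mem {Z' Z} c X δ hδ := by
    rw [← Submodule.mem_comap]
    refine (iSup_le fun M => iSup_le fun hM => iSup_le fun f => ?_ :
      (⨆ (M : C) (_ : N M) (f : Z ⟶ M), LinearMap.range (D.pull f X)) ≤ _) hδ
    rintro _ ⟨η, rfl⟩
    rw [Submodule.mem_comap, ← pull_comp]
    exact Submodule.mem_iSup_of_mem M (Submodule.mem_iSup_of_mem hM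
      (Submodule.mem_iSup_of_mem (c ≫ f) ⟨_, rfl⟩))

/-- `𝔼^{[N]}(Z, X) = ∑_{f : M ⟶ X, M ∈ N} Im (𝔼(Z, M) → 𝔼(Z, X))`. -/
def upperSub : D.SubBifunctor where
  carrier Z X := ⨆ (M : C) (_ : N M) (f : M ⟶ X), LinearMap.range (D.push Z f)
  push_mem Z X X' a δ hδ := by
    rw [← Submodule.mem_comap]
    refine (iSup_le fun M => iSup_le fun hM => iSup_le fun f => ?_ :
      (⨆ (M : C) (_ : N M) (f : M ⟶ X), LinearMap.range (D.push Z f)) ≤ _) hδ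
    rintro _ ⟨η, rfl⟩
    rw [Submodule.mem_comap, ← push_comp]
    exact Submodule.mem_iSup_of_mem M (Submodule.mem_iSup_of_mem hM
      (Submodule.mem_iSup_of_mem (f ≫ a) ⟨_, rfl⟩))
  pull_mem {Z' Z} c X δ hδ := by
    rw [← Submodule.mem_comap]
    refine (iSup_le fun M => iSup_le fun hM => iSup_le fun f => ?_ :
      (⨆ (M : C) (_ : N M) (f : M ⟶ X), LinearMap.range (D.push Z f)) ≤ _) hδ
    rintro _ ⟨η, rfl⟩
    rw [Submodule.mem_comap, pull_push]
    exact Submodule.mem_iSup_of_mem M (Submodule.mem_iSup_of_mem hM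
      (Submodule.mem_iSup_of_mem f ⟨_, rfl⟩))

/-- `𝔼^R_N(Z, X)`: the `δ ∈ 𝔼(Z, X)` with `a_* δ ∈ 𝔼_{[N]}(Z, M)` for all `a : X ⟶ M`, `M ∈ N`. -/
def rightSub : D.SubBifunctor where
  carrier Z X :=
    { carrier := {δ | ∀ (M : C), N M → ∀ a : X ⟶ M, D.push Z a δ ∈ (D.lowerSub N).carrier Z M}
      add_mem' := fun h h' M hM a => by
        rw [map_add]
        exact add_mem (h M hM a) (h' M hM a)
      zero_mem' := fun M hM a => by
        rw [map_zero]
        exact zero_mem _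
      smul_mem' := fun r δ h M hM a => by
        rw [map_smul]
        exact Submodule.smul_mem _ r (h M hM a) }
  push_mem Z X X' a δ h M hM b := by
    rw [← push_comp]
    exact h M hM (a ≫ b)
  pull_mem c X δ h M hM a := by
    rw [← pull_push]
    exact (D.lowerSub N).pull_mem c M (h M hM a)

/-- `𝔼^L_N(Z, X)`: the `δ ∈ 𝔼(Z, X)` with `c^* δ ∈ 𝔼^{[N]}(M, X)` for all `c : M ⟶ Z`, `M ∈ N`. -/
def leftSub : D.SubBifunctor where
  carrier Z X :=
    { carrier := {δ | ∀ (M : C), N M → ∀ c : M ⟶ Z, D.pull c X δ ∈ (D.upperSub N).carrier M X}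
      add_mem' := fun h h' M hM a => by
        rw [map_add]
        exact add_mem (h M hM a) (h' M hM a)
      zero_mem' := fun M hM a => by
        rw [map_zero]
        exact zero_mem _
      smul_mem' := fun r δ h M hM a => by
        rw [map_smul]
        exact Submodule.smul_mem _ r (h M hM a) }
  push_mem Z X X' a δ h M hM c := by
    rw [pull_push]
    exact (D.upperSub N).push_mem M a (h M hM c)
  pull_mem c X δ h M hM d := by
    rw [← pull_comp]
    exact h M hM (d ≫ c)

/-- `𝔼_N = 𝔼^R_N ∩ 𝔼^L_N`. -/
def subN : D.SubBifunctor where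
  carrier Z X := (D.rightSub N).carrier Z X ⊓ (D.leftSub N).carrier Z X
  push_mem Z _ _ a _ h := ⟨(D.rightSub N).push_mem Z a h.1, (D.leftSub N).push_mem Z a h.2⟩
  pull_mem c X _ h := ⟨(D.rightSub N).pull_mem c X h.1, (D.leftSub N).pull_mem c X h.2⟩

/-- The substructure `C_N = (C, 𝔼_N, 𝔰_N)` determined by `N`. -/
def substructure : ExtriData.{u, v, w} k C := (D.subN N).restrict

/-! ### The classes of morphisms attached to `N` -/

/-- `Inf_N`: the `𝔰`-inflations whose cone lies in `N`. -/
def infN : MorphismProperty C := fun _ Y f =>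
  ∃ (Z : C) (y : Y ⟶ Z), D.IsConflation f y ∧ N Z

/-- `Def_N`: the `𝔰`-deflations whose cocone lies in `N`. -/
def defN : MorphismProperty C := fun Y _ g =>
  ∃ (X : C) (x : X ⟶ Y), D.IsConflation x g ∧ N X

/-- `Inf_N^sp`: the sections in `Inf_N`. -/
def infNsp : MorphismProperty C := fun _ _ f => D.infN N f ∧ IsSplitMono f

/-- `Def_N^sp`: the retractions in `Def_N`. -/
def defNsp : MorphismProperty C := fun _ _ g => D.defN N g ∧ IsSplitEpi g

/-- `S_N`: the smallest class of morphisms closed under composition that contains `Inf_N` and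
`Def_N`. -/
inductive sN : MorphismProperty C
  | inf {X Y : C} (f : X ⟶ Y) (hf : D.infN N f) : sN f
  | df {X Y : C} (f : X ⟶ Y) (hf : D.defN N f) : sN f
  | comp {X Y Z : C} (f : X ⟶ Y) (g : Y ⟶ Z) (hf : sN f) (hg : sN g) : sN (f ≫ g)

end ExtriData

section Classes

variable {C : Type u} [Category.{v} C] [Preadditive C]

/-- The class `W₂ ∘ W₁` of the composites of a morphism in `W₁` followed by one in `W₂`. -/
def compClass (W₂ W₁ : MorphismProperty C) : MorphismProperty C := fun X Z f =>
  ∃ (Y : C) (i : X ⟶ Y) (p : Y ⟶ Z), W₁ i ∧ W₂ p ∧ i ≫ p = f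

/-- (M0): `S` contains the isomorphisms and is closed under composition and finite direct sums. -/
structure M0 (S : MorphismProperty C) : Prop where
  iso : ∀ {X Y : C} (f : X ⟶ Y), IsIso f → S f
  comp : ∀ {X Y Z : C} (f : X ⟶ Y) (g : Y ⟶ Z), S f → S g → S (f ≫ g)
  sum : ∀ {X Y X' Y' : C} [HasBinaryBiproduct X X'] [HasBinaryBiproduct Y Y']
    (f : X ⟶ Y) (g : X' ⟶ Y'), S f → S g → S (biprod.map f g)

/-- `N_S`: the objects `X` such that `X ⟶ 0` and `0 ⟶ X` belong to `S`. -/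
def nullObjects (S : MorphismProperty C) : ObjectProperty C := fun X =>
  ∃ Z : C, IsZero Z ∧ S (0 : X ⟶ Z) ∧ S (0 : Z ⟶ X)

/-- Two morphisms are identified if their difference factors through an object of `N`. -/
def idealRel (N : ObjectProperty C) : HomRel C := fun X Y f g =>
  ∃ (M : C) (_ : N M) (i : X ⟶ M) (j : M ⟶ Y), i ≫ j = f - g

/-- The ideal quotient `C/[N]`. -/
abbrev IdealQuotient (N : ObjectProperty C) : Type u := Quotient (idealRel N)

/-- The projection `C ⥤ C/[N]`. -/
abbrev toIdealQuotient (N : ObjectProperty C) : C ⥤ IdealQuotient N :=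
  Quotient.functor (idealRel N)

/-- The ideal quotient `C/[N_S]`, in which the conditions on `S` are stated. -/
abbrev Bar (S : MorphismProperty C) : Type u := IdealQuotient (nullObjects S)

/-- The projection `p : C ⥤ C/[N_S]`. -/
abbrev toBar (S : MorphismProperty C) : C ⥤ Bar S := toIdealQuotient (nullObjects S)

/-- The closure of `p(S)` under composition with isomorphisms of `C/[N_S]`. -/
abbrev barS (S : MorphismProperty C) : MorphismProperty (Bar S) := S.map (toBar S)

/-- The class of the morphisms `v ∘ p(x) ∘ u` of `C/[N_S]`, with `x ∈ W` and `u, v` in the closure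
of `p(S)`. -/
def barM (S W : MorphismProperty C) : MorphismProperty (Bar S) := fun X Y f =>
  ∃ (A B : C) (u : X ⟶ (toBar S).obj A) (x : A ⟶ B) (v : (toBar S).obj B ⟶ Y),
    barS S u ∧ W x ∧ barS S v ∧ u ≫ (toBar S).map x ≫ v = f

end Classes

section Quotients

variable {k : Type t} [CommRing k] {C : Type u} [Category.{v} C] [Preadditive C] [Linear k C]
  (D : ExtriData.{u, v, w} k C)

/-- The conditions (MR1)-(MR4) on a class `S` of morphisms of `(C, 𝔼, 𝔰)`. -/
structure MR (S : MorphismProperty C) : Prop where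
  mr1 : (barS S).HasTwoOutOfThreeProperty
  mr2_left : (barS S).HasLeftCalculusOfFractions
  mr2_right : (barS S).HasRightCalculusOfFractions
  mr3 : ∀ {X Y Z X' Y' Z' : C} {x : X ⟶ Y} {y : Y ⟶ Z} {δ : D.Ext Z X}
    {x' : X' ⟶ Y'} {y' : Y' ⟶ Z'} {δ' : D.Ext Z' X'},
    D.realizes x y δ → D.realizes x' y' δ' → ∀ (a : X ⟶ X') (c : Z ⟶ Z'),
      D.push Z a δ = D.pull c X' δ' →
      barS S ((toBar S).map a) → barS S ((toBar S).map c) →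
      ∃ b : (toBar S).obj Y ⟶ (toBar S).obj Y', barS S b ∧
        (toBar S).map x ≫ b = (toBar S).map a ≫ (toBar S).map x' ∧
        (toBar S).map y ≫ (toBar S).map c = b ≫ (toBar S).map y'
  mr4_inf : (barM S (fun _ _ f => D.IsInflation f)).IsStableUnderComposition
  mr4_def : (barM S (fun _ _ f => D.IsDeflation f)).IsStableUnderComposition

/-- The pair `(C, N)` is admissible: `N` is thick, the class `S_N` satisfies (M0) and (MR1)-(MR4),
and `p(S_N)` is closed under composition with isomorphisms of `C/[N_S]`, `S = S_N`. -/
structure IsAdmissible (N : ObjectProperty C) : Prop where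
  thick : D.IsThick N
  m0 : M0 (D.sN N)
  mr : MR D (D.sN N)
  barS_eq : barS (D.sN N) = (D.sN N).strictMap (toBar (D.sN N))

/-- `(N, 𝔼|_N, 𝔰|_N) ⟶ (C, 𝔼, 𝔰) ⟶ (B, 𝔽, 𝔱)`, where the second functor is `(Q, μ)`, is an exact
sequence of extriangulated categories. -/
structure IsExactSequence (N : ObjectProperty C)
    {B : Type u₁} [Category.{v₁} B] [Preadditive B] [Linear k B]
    (D' : ExtriData.{u₁, v₁, w₁} k B) (Q : ExactFunctor D D') : Prop where
  extriangulated_mid : D.IsExtriangulated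
  extriangulated_right : D'.IsExtriangulated
  extensionClosed : D.IsExtensionClosed N
  extriangulated_left : (D.full N).IsExtriangulated
  /-- `N = Im inc` -/
  image : ∀ X : C, N X ↔ (D.inc N).toFunctor.essImage X
  /-- `N = Ker Q` -/
  kernel : ∀ X : C, N X ↔ IsZero (Q.toFunctor.obj X)
  /-- the universal property of `(Q, μ)` -/
  universal : ∀ (C' : Type u₂) [Category.{v₂} C'] [Preadditive C'] [Linear k C']
    (D'' : ExtriData.{u₂, v₂, w₂} k C'), D''.IsExtriangulated →
    ∀ G : ExactFunctor D D'',
      (∀ X : N.FullSubcategory, IsZero (((D.inc N).comp G).toFunctor.obj X)) →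
      ∃! G' : ExactFunctor D' D'', Q.comp G' = G

end Quotients

end Extri

open Extri

/-! The definition of `𝔼_N` forces exactly one property: pushing an extension into an object of `N`
gives a pullback of an extension between objects of `N`, and dually. Since `N` is closed under
finite sums, each sum of images that defines `𝔼_[N]` or `𝔼^[N]` is already the union of these images
(`mem_lowerSub_iff`, `mem_upperSub_iff`), so membership is witnessed by a single extension.
Closedness is then a matter of running the octahedral axiom in parallel, once for the given
triangles and once for the witnesses; closure of `N` under extensions keeps the new witnesses in
`N`.

Everything after that uses only the self-dual hypotheses `Adapted`. If `A ⟶ X ⟶ Y` is a conflation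
with `A` in `N`, its class is `c^* η` with `η` an extension of `P` by `A` in `N`; realizing `η` by
`A ⟶ M ⟶ P` and taking the homotopy pullback gives a conflation `X ⟶ M ⊕ Y ⟶ P`. So every deflation
with cocone in `N` is an inflation with cone in `N` followed by a projection that forgets a summand
in `N`. Thickness and the normal form of `S_N` (`exists_infN_of_sN`, `exists_defN_of_sN`) come from
this; with the extension lemma `exists_extend_infN` the normal form gives two-out-of-three and the
calculus of fractions modulo the ideal of maps factoring through `N`. Saturation (`sN_of_isIso_map`)
needs weak idempotent completeness, because a retraction that becomes invertible has to split off
its kernel, which must then lie in `N`.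

The localized bifunctor is obtained without forming colimits of extension groups. The extensions of
`A` are the off-diagonal entries of a category of triangular matrices, `Collage`. It has its own
calculus of fractions, for the morphisms with diagonal entries in `S_N`; the off-diagonal Ore
conditions are `exists_ext_ore` and its dual. Morphisms of its localization, from the first copy to
the second, are the extensions of `A_N/N`. An exact functor induces a functor of collages, so the
universal property for extensions reduces to that of localizations of categories. The axioms of an
extriangulated category for the localization are verified from the description of morphisms and
extensions by fractions, collected in `Localizes`. -/

namespace Extri

/-! ### Direct sums -/

/-- `W` is the direct sum of `X` and `Y`, with the given inclusions and projections. -/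
structure IsDirectSum {C : Type u} [Category.{v} C] [Preadditive C] {X Y W : C}
    (i₁ : X ⟶ W) (i₂ : Y ⟶ W) (p₁ : W ⟶ X) (p₂ : W ⟶ Y) : Prop where
  inl_fst : i₁ ≫ p₁ = 𝟙 X
  inr_snd : i₂ ≫ p₂ = 𝟙 Y
  inl_snd : i₁ ≫ p₂ = 0
  inr_fst : i₂ ≫ p₁ = 0
  total : p₁ ≫ i₁ + p₂ ≫ i₂ = 𝟙 W

namespace IsDirectSum

variable {C : Type u} [Category.{v} C] [Preadditive C] {X Y W : C}
  {i₁ : X ⟶ W} {i₂ : Y ⟶ W} {p₁ : W ⟶ X} {p₂ : W ⟶ Y}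

theorem inl_fst_assoc (h : IsDirectSum i₁ i₂ p₁ p₂) {V : C} (f : X ⟶ V) :
    i₁ ≫ p₁ ≫ f = f := by
  rw [reassoc_of% h.inl_fst]

theorem inr_snd_assoc (h : IsDirectSum i₁ i₂ p₁ p₂) {V : C} (f : Y ⟶ V) :
    i₂ ≫ p₂ ≫ f = f := by
  rw [reassoc_of% h.inr_snd]

theorem inl_snd_assoc (h : IsDirectSum i₁ i₂ p₁ p₂) {V : C} (f : Y ⟶ V) :
    i₁ ≫ p₂ ≫ f = 0 := by
  rw [reassoc_of% h.inl_snd, zero_comp]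

theorem inr_fst_assoc (h : IsDirectSum i₁ i₂ p₁ p₂) {V : C} (f : X ⟶ V) :
    i₂ ≫ p₁ ≫ f = 0 := by
  rw [reassoc_of% h.inr_fst, zero_comp]

theorem swap (h : IsDirectSum i₁ i₂ p₁ p₂) : IsDirectSum i₂ i₁ p₂ p₁ :=
  ⟨h.inr_snd, h.inl_fst, h.inr_fst, h.inl_snd, by rw [add_comm, h.total]⟩

theorem op (h : IsDirectSum i₁ i₂ p₁ p₂) : IsDirectSum p₁.op p₂.op i₁.op i₂.op :=
  ⟨congrArg Quiver.Hom.op h.inl_fst, congrArg Quiver.Hom.op h.inr_snd,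
    congrArg Quiver.Hom.op h.inr_fst, congrArg Quiver.Hom.op h.inl_snd,
    congrArg Quiver.Hom.op h.total⟩

theorem unop {X' Y' W' : Cᵒᵖ} {i₁ : X' ⟶ W'} {i₂ : Y' ⟶ W'} {p₁ : W' ⟶ X'} {p₂ : W' ⟶ Y'}
    (h : IsDirectSum i₁ i₂ p₁ p₂) : IsDirectSum p₁.unop p₂.unop i₁.unop i₂.unop :=
  ⟨congrArg Quiver.Hom.unop h.inl_fst, congrArg Quiver.Hom.unop h.inr_snd,
    congrArg Quiver.Hom.unop h.inr_fst, congrArg Quiver.Hom.unop h.inl_snd,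
    congrArg Quiver.Hom.unop h.total⟩

theorem map {C' : Type u₁} [Category.{v₁} C'] [Preadditive C'] (F : C ⥤ C') [F.Additive]
    (h : IsDirectSum i₁ i₂ p₁ p₂) : IsDirectSum (F.map i₁) (F.map i₂) (F.map p₁) (F.map p₂) :=
  ⟨by rw [← F.map_comp, h.inl_fst, F.map_id], by rw [← F.map_comp, h.inr_snd, F.map_id],
    by rw [← F.map_comp, h.inl_snd, F.map_zero], by rw [← F.map_comp, h.inr_fst, F.map_zero],
    by rw [← F.map_comp, ← F.map_comp, ← F.map_add, h.total, F.map_id]⟩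

theorem hom_ext_from (h : IsDirectSum i₁ i₂ p₁ p₂) {V : C} {f g : W ⟶ V}
    (h₁ : i₁ ≫ f = i₁ ≫ g) (h₂ : i₂ ≫ f = i₂ ≫ g) : f = g := by
  rw [← Category.id_comp f, ← Category.id_comp g, ← h.total]
  simp only [Preadditive.add_comp, Category.assoc, h₁, h₂]

theorem right_zero (X : C) {O : C} (hO : IsZero O) :
    IsDirectSum (𝟙 X) (0 : O ⟶ X) (𝟙 X) (0 : X ⟶ O) :=
  ⟨by simp, hO.eq_of_src _ _, by simp, hO.eq_of_src _ _, by simp⟩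

theorem left_zero (X : C) {O : C} (hO : IsZero O) :
    IsDirectSum (0 : O ⟶ X) (𝟙 X) (0 : X ⟶ O) (𝟙 X) := (right_zero X hO).swap

theorem biprod (X Y : C) [HasBinaryBiproduct X Y] :
    IsDirectSum (biprod.inl : X ⟶ X ⊞ Y) biprod.inr biprod.fst biprod.snd :=
  ⟨by simp, by simp, by simp, by simp, by simp⟩

/-- The comparison isomorphism between two direct sums of the same objects. -/
theorem exists_iso (h : IsDirectSum i₁ i₂ p₁ p₂) {W' : C} {i₁' : X ⟶ W'} {i₂' : Y ⟶ W'}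
    {p₁' : W' ⟶ X} {p₂' : W' ⟶ Y} (h' : IsDirectSum i₁' i₂' p₁' p₂') :
    ∃ e : W ≅ W', e.hom = p₁ ≫ i₁' + p₂ ≫ i₂' ∧ e.inv = p₁' ≫ i₁ + p₂' ≫ i₂ :=
  ⟨⟨p₁ ≫ i₁' + p₂ ≫ i₂', p₁' ≫ i₁ + p₂' ≫ i₂, by
      simp [h'.inl_fst_assoc, h'.inl_snd_assoc, h'.inr_fst_assoc, h'.inr_snd_assoc, h.total], by
      simp [h.inl_fst_assoc, h.inl_snd_assoc, h.inr_fst_assoc, h.inr_snd_assoc, h'.total]⟩,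
    rfl, rfl⟩

/-- Transport of a direct sum decomposition along an isomorphism of the sum. -/
theorem of_iso (h : IsDirectSum i₁ i₂ p₁ p₂) {W' : C} (e : W ≅ W') :
    IsDirectSum (i₁ ≫ e.hom) (i₂ ≫ e.hom) (e.inv ≫ p₁) (e.inv ≫ p₂) :=
  ⟨by simp [h.inl_fst], by simp [h.inr_snd], by simp [h.inl_snd], by simp [h.inr_fst], by
    have : e.inv ≫ (p₁ ≫ i₁ + p₂ ≫ i₂) ≫ e.hom = 𝟙 _ := by rw [h.total]; simp
    simpa using this⟩

/-- Replacing the first inclusion and the second projection by means of a shear. -/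
theorem shear (h : IsDirectSum i₁ i₂ p₁ p₂) (a : X ⟶ Y) :
    IsDirectSum (i₁ + a ≫ i₂) i₂ p₁ (p₂ - p₁ ≫ a) :=
  ⟨by simp [h.inl_fst, h.inr_fst], by simp [h.inr_snd, h.inr_fst_assoc],
    by simp [h.inl_snd, h.inr_snd, h.inl_fst_assoc, h.inr_fst_assoc], h.inr_fst, by
      rw [← h.total]; simp⟩

theorem isZero_right_of_isIso (h : IsDirectSum i₁ i₂ p₁ p₂) [IsIso p₁] : IsZero Y := by
  rw [IsZero.iff_id_eq_zero, ← h.inr_snd]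
  rw [(by rw [← cancel_mono p₁, h.inr_fst, zero_comp] : i₂ = 0), zero_comp]

end IsDirectSum

theorem exists_isDirectSum {C : Type u} [Category.{v} C] [Preadditive C] [HasBinaryBiproducts C]
    (X Y : C) : ∃ (W : C) (i₁ : X ⟶ W) (i₂ : Y ⟶ W) (p₁ : W ⟶ X) (p₂ : W ⟶ Y),
      IsDirectSum i₁ i₂ p₁ p₂ := ⟨_, _, _, _, _, IsDirectSum.biprod X Y⟩

/-- If `f = 1 + n` with `n² = 0`, then `1 - n = 2 - f` is inverse to `f`. All invertibility
statements for endomorphisms of triangles reduce to this. -/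
theorem isIso_of_sub_id_sq_zero {C : Type u} [Category.{v} C] [Preadditive C] {X : C} (f : X ⟶ X)
    (h : (f - 𝟙 X) ≫ (f - 𝟙 X) = 0) : IsIso f := by
  simp only [Preadditive.comp_sub, Preadditive.sub_comp, Category.comp_id, Category.id_comp] at h
  have h' : f ≫ f = f + f - 𝟙 X := by
    rw [← sub_eq_zero, ← h]; abel
  exact ⟨⟨𝟙 X + 𝟙 X - f, by simp [h'], by simp [h']⟩⟩

/-! ### Opposites -/

/-- The linear structure of the opposite category. -/
instance linearOp {k : Type t} [CommRing k] {C : Type u} [Category.{v} C] [Preadditive C]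
    [Linear k C] : Linear k Cᵒᵖ where
  homModule _ _ :=
    { smul := fun r f => (r • f.unop).op
      one_smul := fun f => congrArg Quiver.Hom.op (one_smul k f.unop)
      mul_smul := fun r s f => congrArg Quiver.Hom.op (mul_smul r s f.unop)
      smul_zero := fun r => congrArg Quiver.Hom.op (smul_zero r)
      smul_add := fun r f g => congrArg Quiver.Hom.op (smul_add r f.unop g.unop)
      add_smul := fun r s f => congrArg Quiver.Hom.op (add_smul r s f.unop)
      zero_smul := fun f => congrArg Quiver.Hom.op (zero_smul k f.unop) }
  smul_comp _ _ _ r f g := congrArg Quiver.Hom.op (Linear.comp_smul _ _ _ g.unop r f.unop)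
  comp_smul _ _ _ f r g := congrArg Quiver.Hom.op (Linear.smul_comp _ _ _ r g.unop f.unop)

namespace ExtriData

variable {k : Type t} [CommRing k] {C : Type u} [Category.{v} C] [Preadditive C] [Linear k C]

/-- The opposite of an extriangulated structure. -/
def op (D : ExtriData.{u, v, w} k C) : ExtriData.{u, v, w} k Cᵒᵖ where
  E := unopUnop C ⋙ D.E.flip
  realizes x y δ := D.realizes y.unop x.unop δ

variable {D : ExtriData.{u, v, w} k C}

@[simp]
theorem push_id (Z X : C) (δ : D.Ext Z X) : D.push Z (𝟙 X) δ = δ := by simp [push]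

@[simp]
theorem pull_id (Z X : C) (δ : D.Ext Z X) : D.pull (𝟙 Z) X δ = δ := by simp [pull]

theorem realizes.congr {X Y Z : C} {x x' : X ⟶ Y} {y y' : Y ⟶ Z} {δ δ' : D.Ext Z X}
    (r : D.realizes x y δ) (hx : x = x') (hy : y = y') (hδ : δ = δ') : D.realizes x' y' δ' := by
  rwa [← hx, ← hy, ← hδ]

namespace IsExtriangulated

theorem push_zero (h : D.IsExtriangulated) {Z X X' : C} (δ : D.Ext Z X) :
    D.push Z (0 : X ⟶ X') δ = 0 := by
  have := h.push_add Z (0 : X ⟶ X') 0 δ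
  rw [add_zero] at this
  exact left_eq_add.mp this

theorem pull_zero (h : D.IsExtriangulated) {Z Z' X : C} (δ : D.Ext Z X) :
    D.pull (0 : Z' ⟶ Z) X δ = 0 := by
  have := h.pull_add (0 : Z' ⟶ Z) 0 X δ
  rw [add_zero] at this
  exact left_eq_add.mp this

theorem pull_neg (h : D.IsExtriangulated) {Z Z' X : C} (c : Z' ⟶ Z) (δ : D.Ext Z X) :
    D.pull (-c) X δ = -D.pull c X δ := by
  rw [eq_neg_iff_add_eq_zero, ← h.pull_add, neg_add_cancel, h.pull_zero]

theorem pull_sub (h : D.IsExtriangulated) {Z Z' X : C} (c c' : Z' ⟶ Z) (δ : D.Ext Z X) :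
    D.pull (c - c') X δ = D.pull c X δ - D.pull c' X δ := by
  rw [sub_eq_add_neg, h.pull_add, h.pull_neg, sub_eq_add_neg]

theorem exists_sum (h : D.IsExtriangulated) (X Y : C) :
    ∃ (W : C) (i₁ : X ⟶ W) (i₂ : Y ⟶ W) (p₁ : W ⟶ X) (p₂ : W ⟶ Y), IsDirectSum i₁ i₂ p₁ p₂ :=
  have := h.hasBinaryBiproducts
  exists_isDirectSum X Y

theorem exists_zero (h : D.IsExtriangulated) : ∃ O : C, IsZero O :=
  have := h.hasZeroObject
  HasZeroObject.zero

theorem realizes_split (h : D.IsExtriangulated) {X Y W : C} {i₁ : X ⟶ W} {i₂ : Y ⟶ W}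
    {p₁ : W ⟶ X} {p₂ : W ⟶ Y} (hW : IsDirectSum i₁ i₂ p₁ p₂) : D.realizes i₁ p₂ 0 := by
  have := h.hasBinaryBiproducts
  obtain ⟨e, he, -⟩ := (IsDirectSum.biprod X Y).exists_iso hW
  refine (h.realizes_iff (h.realizes_zero Y X) _ _).mpr ⟨e, ?_, ?_⟩
  · simp [he]
  · simp [he, hW.inl_snd, hW.inr_snd]

theorem realizes_right_zero (h : D.IsExtriangulated) (X : C) {O : C} (hO : IsZero O) :
    D.realizes (𝟙 X) (0 : X ⟶ O) 0 := h.realizes_split (IsDirectSum.right_zero X hO)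

theorem realizes_left_zero (h : D.IsExtriangulated) (X : C) {O : C} (hO : IsZero O) :
    D.realizes (0 : O ⟶ X) (𝟙 X) 0 := h.realizes_split (IsDirectSum.left_zero X hO)

variable {X Y Z : C} {x : X ⟶ Y} {y : Y ⟶ Z} {δ : D.Ext Z X}

theorem comp_eq_zero (h : D.IsExtriangulated) (r : D.realizes x y δ) : x ≫ y = 0 := by
  obtain ⟨O, hO⟩ := h.exists_zero
  obtain ⟨c, hc, -⟩ := h.et3 (h.realizes_right_zero X hO) r (𝟙 X) x (by simp)
  rw [← hc, zero_comp]

/-- (ET3) towards the split triangle `0 ⟶ V ⟶ V`: a deflation is a weak cokernel of its inflation.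
The factorization need not be unique. -/
theorem exists_desc (h : D.IsExtriangulated) (r : D.realizes x y δ) {V : C} (f : Y ⟶ V)
    (hf : x ≫ f = 0) : ∃ g : Z ⟶ V, y ≫ g = f := by
  obtain ⟨O, hO⟩ := h.exists_zero
  obtain ⟨c, hc, -⟩ := h.et3 r (h.realizes_left_zero V hO) 0 f (by simp [hf])
  exact ⟨c, by simpa using hc⟩

/-- The difference `b - 1` factors through `y`, and `y` is killed by a further `b - 1`; hence `b` is
unipotent. -/
theorem isIso_middle (h : D.IsExtriangulated) (r : D.realizes x y δ) (b : Y ⟶ Y)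
    (h₁ : x ≫ b = x) (h₂ : b ≫ y = y) : IsIso b := by
  obtain ⟨v, hv⟩ := h.exists_desc r (b - 𝟙 Y) (by simp [h₁])
  apply isIso_of_sub_id_sq_zero
  nth_rw 2 [← hv]
  rw [← Category.assoc, Preadditive.sub_comp, h₂]
  simp

/-- The class `𝔰` is compatible with isomorphisms of the end terms. -/
theorem realizes_of_iso (h : D.IsExtriangulated) (r : D.realizes x y δ) {X' Y' Z' : C}
    {x' : X' ⟶ Y'} {y' : Y' ⟶ Z'} {δ' : D.Ext Z' X'} (a : X ≅ X') (b : Y ≅ Y') (c : Z ≅ Z')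
    (h₁ : x ≫ b.hom = a.hom ≫ x') (h₂ : y ≫ c.hom = b.hom ≫ y')
    (h₃ : D.push Z a.hom δ = D.pull c.hom X' δ') : D.realizes x' y' δ' := by
  obtain ⟨V, i, p, r'⟩ := h.exists_realizes δ'
  obtain ⟨e, he₁, he₂⟩ := h.exists_lift r r' a.hom c.hom h₃
  have h₃' : D.push Z' a.inv δ' = D.pull c.inv X δ := by
    have := congrArg (fun ε => D.pull c.inv _ (D.push _ a.inv ε)) h₃
    simp only [← push_comp, Iso.hom_inv_id, push_id] at this
    rw [this, pull_push, ← pull_comp, c.inv_hom_id, pull_id]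
  obtain ⟨f, hf₁, hf₂⟩ := h.exists_lift r' r a.inv c.inv h₃'
  -- The lifts `e` and `f` need not be mutually inverse, but both composites fix the outer terms of
  -- a triangle and so are invertible. This suffices to make `e` invertible.
  have : IsIso (e ≫ f) := h.isIso_middle r _ (by rw [reassoc_of% he₁, hf₁]; simp)
    (by rw [Category.assoc, hf₂, reassoc_of% he₂]; simp)
  have : IsIso (f ≫ e) := h.isIso_middle r' _ (by rw [reassoc_of% hf₁, he₁]; simp)
    (by rw [Category.assoc, he₂, reassoc_of% hf₂]; simp)
  have hm : IsSplitMono e := ⟨⟨f ≫ inv (e ≫ f), by rw [← Category.assoc]; simp⟩⟩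
  have he : IsSplitEpi e := ⟨⟨inv (f ≫ e) ≫ f, by rw [Category.assoc]; simp⟩⟩
  have : IsIso e := isIso_of_mono_of_isSplitEpi e
  refine (h.realizes_iff r' _ _).mpr ⟨(asIso e).symm ≪≫ b, ?_, ?_⟩
  · rw [← cancel_epi a.hom, ← h₁]
    simp [← reassoc_of% he₁]
  · simp [← h₂, ← he₂]

theorem exists_iso_of_realizes (h : D.IsExtriangulated) (r : D.realizes x y δ) {Y' : C}
    {x' : X ⟶ Y'} {y' : Y' ⟶ Z} (r' : D.realizes x' y' δ) :
    ∃ e : Y ≅ Y', x ≫ e.hom = x' ∧ e.hom ≫ y' = y := (h.realizes_iff r x' y').mp r'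

/-- Direct sums of `𝔰`-triangles. -/
theorem realizes_directSum (h : D.IsExtriangulated) (r : D.realizes x y δ) {X' Y' Z' : C}
    {x' : X' ⟶ Y'} {y' : Y' ⟶ Z'} {δ' : D.Ext Z' X'} (r' : D.realizes x' y' δ')
    {A B E : C} {iA : X ⟶ A} {jA : X' ⟶ A} {pA : A ⟶ X} {qA : A ⟶ X'}
    {iB : Y ⟶ B} {jB : Y' ⟶ B} {pB : B ⟶ Y} {qB : B ⟶ Y'}
    {iE : Z ⟶ E} {jE : Z' ⟶ E} {pE : E ⟶ Z} {qE : E ⟶ Z'}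
    (hA : IsDirectSum iA jA pA qA) (hB : IsDirectSum iB jB pB qB) (hE : IsDirectSum iE jE pE qE) :
    D.realizes (pA ≫ x ≫ iB + qA ≫ x' ≫ jB) (pB ≫ y ≫ iE + qB ≫ y' ≫ jE)
      (D.push E iA (D.pull pE X δ) + D.push E jA (D.pull qE X' δ')) := by
  have := h.hasBinaryBiproducts
  obtain ⟨a, ha, -⟩ := (IsDirectSum.biprod X X').exists_iso hA
  obtain ⟨b, hb, -⟩ := (IsDirectSum.biprod Y Y').exists_iso hB
  obtain ⟨c, hc, -⟩ := (IsDirectSum.biprod Z Z').exists_iso hE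
  refine h.realizes_of_iso (h.realizes_sum r r') a b c ?_ ?_ ?_
  · rw [ha, hb, biprod.map_eq]
    simp [hA.inl_fst_assoc, hA.inl_snd_assoc, hA.inr_fst_assoc, hA.inr_snd_assoc]
  · rw [hb, hc, biprod.map_eq]
    simp [hB.inl_fst_assoc, hB.inl_snd_assoc, hB.inr_fst_assoc, hB.inr_snd_assoc]
  · rw [hc, map_add, map_add, ← push_comp, ← push_comp, ha]
    simp only [pull_push, ← pull_comp]
    simp [hE.inl_fst, hE.inl_snd, hE.inr_fst, hE.inr_snd]

theorem hasBinaryBiproducts_op (h : D.IsExtriangulated) : HasBinaryBiproducts Cᵒᵖ := by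
  have := h.hasBinaryBiproducts
  have : HasBinaryCoproducts C := inferInstance
  exact HasBinaryBiproducts.of_hasBinaryProducts

/-- The opposite of an extriangulated category is extriangulated. -/
theorem op (h : D.IsExtriangulated) : D.op.IsExtriangulated :=
  have := h.hasBinaryBiproducts_op
  have := h.hasZeroObject
  { push_add Z _ _ a a' δ := h.pull_add a.unop a'.unop Z.unop δ
    push_smul Z _ _ r a δ := h.pull_smul r a.unop Z.unop δ
    pull_add c c' X δ := h.push_add X.unop c.unop c'.unop δ
    pull_smul r c X δ := h.push_smul X.unop r c.unop δ
    exists_realizes δ := by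
      obtain ⟨Y, x, y, r⟩ := h.exists_realizes δ
      exact ⟨Opposite.op Y, y.op, x.op, r⟩
    realizes_iff {X Y Y' Z x y δ} r x' y' := by
      refine (h.realizes_iff r y'.unop x'.unop).trans ⟨?_, ?_⟩
      · rintro ⟨b, h₁, h₂⟩
        exact ⟨b.op.symm, Quiver.Hom.unop_inj (by simp [← h₂]),
          Quiver.Hom.unop_inj (by simp [← h₁])⟩
      · rintro ⟨b, h₁, h₂⟩
        exact ⟨b.unop.symm, by simp [← h₂], by simp [← h₁]⟩
    exists_lift r r' a c hac := by
      obtain ⟨b, h₁, h₂⟩ := h.exists_lift r' r c.unop a.unop hac.symm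
      exact ⟨b.op, Quiver.Hom.unop_inj h₂, Quiver.Hom.unop_inj h₁⟩
    realizes_zero Z X := h.realizes_split (IsDirectSum.biprod X Z).unop.swap
    realizes_sum {X Y Z X' Y' Z' x y δ x' y' δ'} r r' := by
      have key := h.realizes_directSum r r' (IsDirectSum.biprod Z Z').unop
        (IsDirectSum.biprod Y Y').unop (IsDirectSum.biprod X X').unop
      refine realizes.congr key (x' := (biprod.map y y').unop) (y' := (biprod.map x x').unop)
        ?_ ?_ (congrArg₂ (· + ·) (pull_push D _ _ _) (pull_push D _ _ _)).symm
      · simp [biprod.map_eq]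
      · simp [biprod.map_eq]
    et3 r r' a b hab := by
      obtain ⟨c, h₁, h₂⟩ := h.et3_op r' r b.unop a.unop (congrArg Quiver.Hom.unop hab.symm)
      exact ⟨c.op, Quiver.Hom.unop_inj h₁.symm, h₂.symm⟩
    et3_op r r' b c hbc := by
      obtain ⟨a, h₁, h₂⟩ := h.et3 r' r c.unop b.unop (congrArg Quiver.Hom.unop hbc.symm)
      exact ⟨a.op, Quiver.Hom.unop_inj h₁.symm, h₂.symm⟩
    et4 r r' := by
      obtain ⟨G, h', d, e, δ', h₁, h₂, h₃, h₄, h₅, h₆⟩ := h.et4_op r' r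
      exact ⟨Opposite.op G, h'.op, e.op, d.op, δ', h₁, h₂, Quiver.Hom.unop_inj h₄,
        Quiver.Hom.unop_inj h₃, h₅, h₆.symm⟩
    et4_op r r' := by
      obtain ⟨G, h', d, e, δ', h₁, h₂, h₃, h₄, h₅, h₆⟩ := h.et4 r' r
      exact ⟨Opposite.op G, h'.op, e.op, d.op, δ', h₁, h₂, Quiver.Hom.unop_inj h₄,
        Quiver.Hom.unop_inj h₃, h₅, h₆.symm⟩ }

end IsExtriangulated
end ExtriData
end Extri

namespace Extri
namespace ExtriData
namespace IsExtriangulated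

variable {k : Type t} [CommRing k] {C : Type u} [Category.{v} C] [Preadditive C] [Linear k C]
  {D : ExtriData.{u, v, w} k C}
variable {X Y Z : C} {x : X ⟶ Y} {y : Y ⟶ Z} {δ : D.Ext Z X}

/-! ### Exact sequences -/

/-- (ET3) towards `Y = Y ⟶ 0`, whose class is zero. -/
theorem push_inflation (h : D.IsExtriangulated) (r : D.realizes x y δ) : D.push Z x δ = 0 := by
  obtain ⟨O, hO⟩ := h.exists_zero
  obtain ⟨c, -, hc⟩ := h.et3 r (h.realizes_right_zero Y hO) x (𝟙 Y) (by simp)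
  rw [hc, map_zero]

theorem pull_deflation (h : D.IsExtriangulated) (r : D.realizes x y δ) : D.pull y X δ = 0 :=
  h.op.push_inflation r

theorem exists_extend (h : D.IsExtriangulated) (r : D.realizes x y δ) {V : C} (a : X ⟶ V)
    (ha : D.push Z a δ = 0) : ∃ b : Y ⟶ V, x ≫ b = a := by
  obtain ⟨O, hO⟩ := h.exists_zero
  obtain ⟨b, hb, -⟩ := h.exists_lift r (h.realizes_right_zero V hO) a 0 (by rw [ha, map_zero])
  exact ⟨b, by simpa using hb⟩

theorem exists_colift (h : D.IsExtriangulated) (r : D.realizes x y δ) {V : C} (c : V ⟶ Z)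
    (hc : D.pull c X δ = 0) : ∃ b : V ⟶ Y, b ≫ y = c := by
  obtain ⟨b, hb⟩ := h.op.exists_extend r c.op hc
  exact ⟨b.unop, congrArg Quiver.Hom.unop hb⟩

/-- Exactness of `Hom(V, Z) → 𝔼(V, X) → 𝔼(V, Y)`: if `x` extends over the middle term of a
realization of `ε`, then (ET3) compares that realization with the given triangle. -/
theorem exists_pull_of_push_eq_zero (h : D.IsExtriangulated) (r : D.realizes x y δ) {V : C}
    (ε : D.Ext V X) (hε : D.push V x ε = 0) : ∃ c : V ⟶ Z, D.pull c X δ = ε := by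
  obtain ⟨U, i, p, r'⟩ := h.exists_realizes ε
  obtain ⟨b, hb⟩ := h.exists_extend r' x hε
  obtain ⟨c, -, hc⟩ := h.et3 r' r (𝟙 X) b (by simpa using hb)
  exact ⟨c, by simpa using hc.symm⟩

theorem exists_push_of_pull_eq_zero (h : D.IsExtriangulated) (r : D.realizes x y δ) {V : C}
    (ε : D.Ext Z V) (hε : D.pull y V ε = 0) : ∃ a : X ⟶ V, D.push Z a δ = ε := by
  obtain ⟨c, hc⟩ := h.op.exists_pull_of_push_eq_zero (V := Opposite.op V) r ε hε
  exact ⟨c.unop, hc⟩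

/-- Exactness of `𝔼(V, X) → 𝔼(V, Y) → 𝔼(V, Z)`. -/
theorem exists_push_preimage (h : D.IsExtriangulated) (r : D.realizes x y δ) {V : C}
    (ε : D.Ext V Y) (hε : D.push V y ε = 0) : ∃ ε' : D.Ext V X, D.push V x ε' = ε := by
  obtain ⟨U, i, p, r'⟩ := h.exists_realizes ε
  -- The octahedron contains a triangle with class `y_* ε = 0`. It splits, and pulling `δ'` back
  -- along the section gives the preimage.
  obtain ⟨G, h', d, e, δ', -, h₂, -, -, -, h₆⟩ := h.et4 r r'
  rw [hε] at h₂
  obtain ⟨s, hs⟩ := h.exists_colift h₂ (𝟙 V) (by simp)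
  exact ⟨D.pull s X δ', by rw [← pull_push, h₆, ← pull_comp, hs, pull_id]⟩

/-! ### Isomorphisms of triangles -/

theorem realizes_iso_right (h : D.IsExtriangulated) (r : D.realizes x y δ) {Z' : C}
    (c : Z ≅ Z') {δ' : D.Ext Z' X} (hδ : D.pull c.hom X δ' = δ) : D.realizes x (y ≫ c.hom) δ' :=
  h.realizes_of_iso r (Iso.refl X) (Iso.refl Y) c (by simp) (by simp) (by simp [hδ])

theorem realizes_iso_middle (h : D.IsExtriangulated) (r : D.realizes x y δ) {Y' : C}
    (b : Y ≅ Y') : D.realizes (x ≫ b.hom) (b.inv ≫ y) δ :=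
  h.realizes_of_iso r (Iso.refl X) b (Iso.refl Z) (by simp) (by simp) (by simp)

/-- The cone of an inflation is unique. -/
theorem exists_iso_cone (h : D.IsExtriangulated) (r : D.realizes x y δ) {Z' : C} {y' : Y ⟶ Z'}
    {δ' : D.Ext Z' X} (r' : D.realizes x y' δ') :
    ∃ c : Z ≅ Z', y ≫ c.hom = y' ∧ D.pull c.hom X δ' = δ := by
  have aux : ∀ {Z : C} {y : Y ⟶ Z} {δ : D.Ext Z X} (_ : D.realizes x y δ) (c : Z ⟶ Z),
      y ≫ c = y → D.pull c X δ = δ → IsIso c := by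
    intro Z y δ r c h₁ h₂
    -- Since `c` fixes the class `δ`, the difference `c - 1` lifts through `y`; since `c` fixes `y`,
    -- it then squares to zero.
    obtain ⟨v, hv⟩ := h.exists_colift r (c - 𝟙 Z) (by rw [h.pull_sub, h₂, pull_id, sub_self])
    apply isIso_of_sub_id_sq_zero
    nth_rw 1 [← hv]
    rw [Category.assoc, Preadditive.comp_sub, h₁]
    simp
  obtain ⟨c, hc, hc'⟩ := h.et3 r r' (𝟙 X) (𝟙 Y) (by simp)
  obtain ⟨d, hd, hd'⟩ := h.et3 r' r (𝟙 X) (𝟙 Y) (by simp)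
  simp only [push_id, Category.id_comp] at hc hc' hd hd'
  have : IsIso (c ≫ d) := aux r _ (by rw [reassoc_of% hc, hd]) (by rw [pull_comp, ← hd', ← hc'])
  have : IsIso (d ≫ c) := aux r' _ (by rw [reassoc_of% hd, hc]) (by rw [pull_comp, ← hc', ← hd'])
  have hm : IsSplitMono c := ⟨⟨d ≫ inv (c ≫ d), by rw [← Category.assoc]; simp⟩⟩
  have he : IsSplitEpi c := ⟨⟨inv (d ≫ c) ≫ d, by rw [Category.assoc]; simp⟩⟩
  have : IsIso c := isIso_of_mono_of_isSplitEpi c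
  exact ⟨asIso c, hc, hc'.symm⟩

/-! ### Homotopy pushouts and pullbacks -/

/-- The map `(x, a) : X ⟶ Y ⊕ X'` is the split inflation `(1, a) : X ⟶ X ⊕ X'` followed by the
inflation `x ⊕ 1`. The octahedron of these two gives the cone, because the cokernel of `(1, a)`
carries the class of `x ⊕ 1` to `a_* δ`. -/
theorem exists_pushout (h : D.IsExtriangulated) (r : D.realizes x y δ) {X' Y' : C} (a : X ⟶ X')
    {x' : X' ⟶ Y'} {y' : Y' ⟶ Z} (r' : D.realizes x' y' (D.push Z a δ))
    {W : C} {i₁ : Y ⟶ W} {i₂ : X' ⟶ W} {p₁ : W ⟶ Y} {p₂ : W ⟶ X'}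
    (hW : IsDirectSum i₁ i₂ p₁ p₂) :
    ∃ b : Y ⟶ Y', x ≫ b = a ≫ x' ∧ b ≫ y' = y ∧
      D.realizes (x ≫ i₁ + a ≫ i₂) (p₁ ≫ b - p₂ ≫ x') (D.pull y' X δ) := by
  obtain ⟨O, hO⟩ := h.exists_zero
  obtain ⟨V, j₁, j₂, q₁, q₂, hV⟩ := h.exists_sum X X'
  have hV' : IsDirectSum (j₁ + a ≫ j₂) (-j₂) q₁ (q₁ ≫ a - q₂) := by
    have := hV.shear a
    exact ⟨this.inl_fst, by simp [hV.inr_snd, hV.inr_fst_assoc],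
      by simp [hV.inl_snd, hV.inr_snd, hV.inl_fst_assoc, hV.inr_fst_assoc],
      by simp [hV.inr_fst], by rw [← this.total]; simp⟩
  have r₂ : D.realizes (q₁ ≫ x ≫ i₁ + q₂ ≫ i₂) (p₁ ≫ y) (D.push Z j₁ δ) := by
    have := h.realizes_directSum r (h.realizes_right_zero X' hO) hV hW
      (IsDirectSum.right_zero Z hO)
    simpa using this
  obtain ⟨G, h', d, e, δ', h₁, h₂, h₃, h₄, -, h₆⟩ := h.et4 (h.realizes_split hV') r₂
  have hf : j₁ ≫ (q₁ ≫ a - q₂) = a := by simp [hV.inl_fst_assoc, hV.inl_snd]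
  rw [← push_comp, hf] at h₂
  -- Applying the projection to the first summand `X` to the last identity of the octahedron
  -- isolates `δ'`.
  have hδ' : δ' = D.pull e X δ := by
    have := congrArg (D.push G q₁) h₆
    rwa [← push_comp, hV'.inl_fst, push_id, ← pull_push, ← push_comp, hV.inl_fst, push_id] at this
  obtain ⟨φ, hφ₁, hφ₂⟩ := h.exists_iso_of_realizes h₂ r'
  have k₁ : x ≫ i₁ ≫ h' = a ≫ d := by
    have := j₁ ≫= h₃
    simp only [Preadditive.add_comp, Preadditive.comp_add, Category.assoc, hV.inl_fst_assoc,
      hV.inl_snd_assoc, add_zero] at this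
    rw [this, ← Category.assoc, hf]
  have k₂ : i₂ ≫ h' = - d := by
    have := j₂ ≫= h₃
    simpa [hV.inr_fst_assoc, hV.inr_snd_assoc, hV.inr_snd] using this
  refine ⟨i₁ ≫ h' ≫ φ.hom, ?_, ?_, ?_⟩
  · rw [reassoc_of% k₁, hφ₁]
  · rw [Category.assoc, Category.assoc, hφ₂, h₄, hW.inl_fst_assoc]
  · have := h.realizes_iso_right h₁ φ (δ' := D.pull y' X δ) (by rw [← pull_comp, hφ₂, hδ'])
    convert this using 1
    · simp [hV.inl_fst_assoc, hV.inl_snd_assoc, hV.inr_fst_assoc, hV.inr_snd_assoc]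
    · refine hW.hom_ext_from ?_ ?_
      · simp [hW.inl_fst_assoc, hW.inl_snd_assoc]
      · simp [hW.inr_fst_assoc, hW.inr_snd_assoc, reassoc_of% k₂, hφ₁]

/-- The homotopy pushout is symmetric in `x` and `a`: pushing out either triangle along the other
map produces a cone of the same inflation `X ⟶ Y ⊕ X'`. Uniqueness of the cone identifies the two,
up to a sign, so that the map parallel to `a` inherits the cone of `a`. -/
theorem exists_pushout_inflation (h : D.IsExtriangulated) (r : D.realizes x y δ) {X' Y' P : C}
    {a : X ⟶ X'} {p : X' ⟶ P} {ω : D.Ext P X} (ra : D.realizes a p ω)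
    {x' : X' ⟶ Y'} {y' : Y' ⟶ Z} (r' : D.realizes x' y' (D.push Z a δ)) :
    ∃ (b : Y ⟶ Y') (q : Y' ⟶ P), x ≫ b = a ≫ x' ∧ b ≫ y' = y ∧ x' ≫ q = p ∧
      D.realizes b q (D.push P x ω) := by
  obtain ⟨W, i₁, i₂, p₁, p₂, hW⟩ := h.exists_sum Y X'
  obtain ⟨V, w₁, w₂, rV⟩ := h.exists_realizes (D.push P x ω)
  obtain ⟨b, hb₁, hb₂, s⟩ := h.exists_pushout r a r' hW
  obtain ⟨b₂, hb₃, hb₄, s'⟩ := h.exists_pushout ra x rV hW.swap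
  rw [add_comm] at s'
  obtain ⟨c, hc, -⟩ := h.exists_iso_cone s s'
  have k₁ : b ≫ c.hom = -w₁ := by
    simpa [hW.inl_fst_assoc, hW.inl_snd_assoc] using i₁ ≫= hc
  have k₂ : x' ≫ c.hom = -b₂ := by
    simpa [hW.inr_fst_assoc, hW.inr_snd_assoc, neg_eq_iff_eq_neg] using i₂ ≫= hc
  -- The two difference maps have opposite sign conventions, so the comparison that respects the
  -- inflations is the negative of `c`.
  let c' : V ≅ Y' := ⟨-c.inv, -c.hom, by simp, by simp⟩
  refine ⟨b, (-c.hom) ≫ w₂, hb₁, hb₂, by rw [Preadditive.neg_comp, Preadditive.comp_neg,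
    reassoc_of% k₂, Preadditive.neg_comp, neg_neg, hb₄], ?_⟩
  convert h.realizes_iso_middle rV c' using 1
  rw [← cancel_mono c.hom, k₁]
  simp [c']

/-- The octahedron of `m` and `x` gives a triangle starting with `m ≫ x`; its cone is an extension
of `Z` by `X'` with class `a_* δ`, hence is `Y'`. So the map parallel to `a` has the same cocone as
`a`. -/
theorem exists_pushout_deflation (h : D.IsExtriangulated) (r : D.realizes x y δ) {M X' Y' : C}
    {m : M ⟶ X} {a : X ⟶ X'} {ω : D.Ext X' M} (ra : D.realizes m a ω)
    {x' : X' ⟶ Y'} {y' : Y' ⟶ Z} (r' : D.realizes x' y' (D.push Z a δ)) :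
    ∃ (b : Y ⟶ Y') (ω' : D.Ext Y' M), x ≫ b = a ≫ x' ∧ b ≫ y' = y ∧
      D.realizes (m ≫ x) b ω' := by
  obtain ⟨G, h', d, e, δ', h₁, h₂, h₃, h₄, -, -⟩ := h.et4 ra r
  obtain ⟨φ, hφ₁, hφ₂⟩ := h.exists_iso_of_realizes h₂ r'
  exact ⟨h' ≫ φ.hom, D.pull φ.inv M δ', by rw [reassoc_of% h₃, hφ₁],
    by rw [Category.assoc, hφ₂, h₄], h.realizes_iso_right h₁ φ (by rw [← pull_comp]; simp)⟩

theorem exists_pullback (h : D.IsExtriangulated) (r : D.realizes x y δ) {Z' Y' : C} (c : Z' ⟶ Z)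
    {x' : X ⟶ Y'} {y' : Y' ⟶ Z'} (r' : D.realizes x' y' (D.pull c X δ))
    {W : C} {i₁ : Y ⟶ W} {i₂ : Z' ⟶ W} {p₁ : W ⟶ Y} {p₂ : W ⟶ Z'}
    (hW : IsDirectSum i₁ i₂ p₁ p₂) :
    ∃ b : Y' ⟶ Y, x' ≫ b = x ∧ b ≫ y = y' ≫ c ∧
      D.realizes (b ≫ i₁ - y' ≫ i₂) (p₁ ≫ y + p₂ ≫ c) (D.push Z x' δ) := by
  obtain ⟨b, h₁, h₂, h₃⟩ := h.op.exists_pushout r c.op r' hW.op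
  exact ⟨b.unop, congrArg Quiver.Hom.unop h₂, congrArg Quiver.Hom.unop h₁, h₃⟩

end IsExtriangulated
end ExtriData
end Extri

/-! ### Weak idempotent completeness, closed subbifunctors and `𝔼_N`. -/

namespace Extri

/-- Over a weakly idempotent complete category, a section is the inclusion of a direct summand. -/
theorem WeaklyIdempotentComplete.exists_isDirectSum {C : Type u} [Category.{v} C] [Preadditive C]
    (hC : WeaklyIdempotentComplete C) {X Y : C} (i : X ⟶ Y) (r : Y ⟶ X) (h : i ≫ r = 𝟙 X) :
    ∃ (K : C) (j : K ⟶ Y) (q : Y ⟶ K), IsDirectSum i j r q := by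
  have := hC i ⟨⟨r, h⟩⟩
  have hj : i ≫ (𝟙 Y - r ≫ i) = 0 := by simp [reassoc_of% h]
  refine ⟨cokernel i, cokernel.desc i _ hj, cokernel.π i, ⟨h, ?_, cokernel.condition i, ?_, ?_⟩⟩
  · rw [← cancel_epi (cokernel.π i)]
    simp [cokernel.condition]
  · rw [← cancel_epi (cokernel.π i)]
    simp [h]
  · simp

namespace ExtriData

variable {k : Type t} [CommRing k] {C : Type u} [Category.{v} C] [Preadditive C] [Linear k C]
  {D : ExtriData.{u, v, w} k C} {N : ObjectProperty C}

theorem IsExtensionClosed.sum (hN : D.IsExtensionClosed N) (h : D.IsExtriangulated)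
    {X Y W : C} {i₁ : X ⟶ W} {i₂ : Y ⟶ W} {p₁ : W ⟶ X} {p₂ : W ⟶ Y}
    (hW : IsDirectSum i₁ i₂ p₁ p₂) (hX : N X) (hY : N Y) : N W :=
  hN.ext _ _ ⟨_, h.realizes_split hW⟩ hX hY

theorem IsExtensionClosed.zero (hN : D.IsExtensionClosed N) {O : C} (hO : IsZero O) : N O := by
  obtain ⟨O', hO', h⟩ := hN.containsZero
  exact hN.isoClosed.of_iso (hO'.iso hO) h

theorem IsExtensionClosed.op (hN : D.IsExtensionClosed N) : D.op.IsExtensionClosed N.op where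
  containsZero := by
    obtain ⟨O, hO, h⟩ := hN.containsZero
    exact ⟨Opposite.op O, hO.op, h⟩
  isoClosed := ⟨fun e h => hN.isoClosed.of_iso e.symm.unop h⟩
  ext x y := fun ⟨δ, hδ⟩ hX hZ => hN.ext y.unop x.unop ⟨δ, hδ⟩ hZ hX

/-! ### Closed subbifunctors -/

/-- A subbifunctor is closed as soon as it contains the extensions that are produced by the
octahedral axioms for its own extensions. -/
theorem SubBifunctor.isClosed_of_octahedra (h : D.IsExtriangulated) (F : D.SubBifunctor)
    (h4 : ∀ {A B X₁ Y G' G : C} {f : A ⟶ B} {f' : B ⟶ X₁} {δ : D.Ext X₁ A}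
      {g : B ⟶ Y} {g' : Y ⟶ G'} {ρ : D.Ext G' B} {h' : Y ⟶ G} {e : G ⟶ G'} {δ' : D.Ext G A},
      D.realizes f f' δ → D.realizes g g' ρ → D.realizes (f ≫ g) h' δ' →
      D.push G f δ' = D.pull e B ρ → δ ∈ F.carrier _ _ → ρ ∈ F.carrier _ _ → δ' ∈ F.carrier _ _)
    (h4op : ∀ {A B X₁ Y G' G : C} {f' : X₁ ⟶ A} {f : A ⟶ B} {δ : D.Ext B X₁}
      {g' : G' ⟶ B} {g : B ⟶ Y} {ρ : D.Ext Y G'} {h' : G ⟶ A} {d : X₁ ⟶ G} {δ' : D.Ext Y G},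
      D.realizes f' f δ → D.realizes g' g ρ → D.realizes h' (f ≫ g) δ' →
      D.push B d δ = D.pull g G δ' → δ ∈ F.carrier _ _ → ρ ∈ F.carrier _ _ → δ' ∈ F.carrier _ _) :
    F.IsClosed where
  hasZeroObject := h.hasZeroObject
  hasBinaryBiproducts := h.hasBinaryBiproducts
  push_add Z _ _ a a' δ := Subtype.ext (h.push_add Z a a' δ.1)
  push_smul Z _ _ r a δ := Subtype.ext (h.push_smul Z r a δ.1)
  pull_add c c' X δ := Subtype.ext (h.pull_add c c' X δ.1)
  pull_smul r c X δ := Subtype.ext (h.pull_smul r c X δ.1)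
  exists_realizes δ := h.exists_realizes δ.1
  realizes_iff r x' y' := h.realizes_iff r x' y'
  exists_lift r r' a c hac := h.exists_lift r r' a c (congrArg Subtype.val hac)
  realizes_zero Z X := h.realizes_zero Z X
  realizes_sum r r' := h.realizes_sum r r'
  et3 r r' a b hab := by
    obtain ⟨c, h₁, h₂⟩ := h.et3 r r' a b hab
    exact ⟨c, h₁, Subtype.ext h₂⟩
  et3_op r r' b c hbc := by
    obtain ⟨a, h₁, h₂⟩ := h.et3_op r r' b c hbc
    exact ⟨a, h₁, Subtype.ext h₂⟩
  et4 {A B X₁ Y G' f f' δ g g' ρ} r r' := by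
    obtain ⟨G, h', d, e, δ', h₁, h₂, h₃, h₄, h₅, h₆⟩ := h.et4 r r'
    exact ⟨G, h', d, e, ⟨δ', h4 r r' h₁ h₆ δ.2 ρ.2⟩, h₁, h₂, h₃, h₄, Subtype.ext h₅, Subtype.ext h₆⟩
  et4_op {A B X₁ Y G' f' f δ g' g ρ} r r' := by
    obtain ⟨G, h', d, e, δ', h₁, h₂, h₃, h₄, h₅, h₆⟩ := h.et4_op r r'
    exact ⟨G, h', d, e, ⟨δ', h4op r r' h₁ h₆ δ.2 ρ.2⟩, h₁, h₂, h₃, h₄, Subtype.ext h₅,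
      Subtype.ext h₆⟩

/-! ### The subbifunctor attached to `N` -/

/-- Two extensions induced from `M` and `M'` are both induced from `M ⊕ M'`, which lies in `N`;
therefore the images already form a submodule. -/
theorem mem_lowerSub_iff (h : D.IsExtriangulated) (hN : D.IsExtensionClosed N) {Z X : C}
    {δ : D.Ext Z X} : δ ∈ (D.lowerSub N).carrier Z X ↔
      ∃ (M : C) (_ : N M) (f : Z ⟶ M) (η : D.Ext M X), D.pull f X η = δ := by
  constructor
  · let S : Submodule k (D.Ext Z X) :=
      { carrier := {δ | ∃ (M : C) (_ : N M) (f : Z ⟶ M) (η : D.Ext M X), D.pull f X η = δ}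
        add_mem' := by
          rintro _ _ ⟨M, hM, f, η, rfl⟩ ⟨M', hM', f', η', rfl⟩
          obtain ⟨W, i₁, i₂, p₁, p₂, hW⟩ := h.exists_sum M M'
          refine ⟨W, hN.sum h hW hM hM', f ≫ i₁ + f' ≫ i₂, D.pull p₁ X η + D.pull p₂ X η', ?_⟩
          rw [map_add, ← pull_comp, ← pull_comp]
          simp [hW.inl_fst, hW.inr_snd, hW.inl_snd, hW.inr_fst]
        zero_mem' := by
          obtain ⟨O, hO⟩ := h.exists_zero
          exact ⟨O, hN.zero hO, 0, 0, map_zero _⟩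
        smul_mem' := by
          rintro r _ ⟨M, hM, f, η, rfl⟩
          exact ⟨M, hM, f, r • η, map_smul _ _ _⟩ }
    refine fun hδ => (iSup_le fun M => iSup_le fun hM => iSup_le fun f => ?_ :
      (D.lowerSub N).carrier Z X ≤ S) hδ
    rintro _ ⟨η, rfl⟩
    exact ⟨M, hM, f, η, rfl⟩
  · rintro ⟨M, hM, f, η, rfl⟩
    exact Submodule.mem_iSup_of_mem M (Submodule.mem_iSup_of_mem hM
      (Submodule.mem_iSup_of_mem f ⟨η, rfl⟩))

theorem mem_upperSub_iff (h : D.IsExtriangulated) (hN : D.IsExtensionClosed N) {Z X : C}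
    {δ : D.Ext Z X} : δ ∈ (D.upperSub N).carrier Z X ↔
      ∃ (M : C) (_ : N M) (f : M ⟶ X) (η : D.Ext Z M), D.push Z f η = δ := by
  constructor
  · intro hδ
    let S : Submodule k (D.Ext Z X) :=
      (D.op.lowerSub N.op).carrier (Opposite.op X) (Opposite.op Z)
    have : δ ∈ S := by
      refine (iSup_le fun M => iSup_le fun hM => iSup_le fun f => ?_ :
        (D.upperSub N).carrier Z X ≤ S) hδ
      rintro _ ⟨η, rfl⟩
      exact (mem_lowerSub_iff h.op hN.op).mpr ⟨Opposite.op M, hM, f.op, η, rfl⟩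
    obtain ⟨M, hM, f, η, hη⟩ := (mem_lowerSub_iff h.op hN.op).mp this
    exact ⟨M.unop, hM, f.unop, η, hη⟩
  · rintro ⟨M, hM, f, η, rfl⟩
    exact Submodule.mem_iSup_of_mem M (Submodule.mem_iSup_of_mem hM
      (Submodule.mem_iSup_of_mem f ⟨η, rfl⟩))

/-- This makes the left-hand condition a case of the right-hand one, so that closure is only proved
for `𝔼^R_N`, once for each octahedral axiom. -/
theorem mem_leftSub_iff_op (h : D.IsExtriangulated) (hN : D.IsExtensionClosed N) {Z X : C}
    {δ : D.Ext Z X} : δ ∈ (D.leftSub N).carrier Z X ↔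
      (show D.op.Ext (Opposite.op X) (Opposite.op Z) from δ) ∈
        (D.op.rightSub N.op).carrier (Opposite.op X) (Opposite.op Z) := by
  constructor
  · intro hδ M hM a
    obtain ⟨M', hM', f, η, hη⟩ := (mem_upperSub_iff h hN).mp (hδ M.unop hM a.unop)
    exact (mem_lowerSub_iff h.op hN.op).mpr ⟨Opposite.op M', hM', f.op, η, hη⟩
  · intro hδ M hM c
    obtain ⟨M', hM', f, η, hη⟩ := (mem_lowerSub_iff h.op hN.op).mp (hδ (Opposite.op M) hM c.op)
    exact (mem_upperSub_iff h hN).mpr ⟨M'.unop, hM', f.unop, η, hη⟩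

/-- A witness `η` for `a_* δ` has its middle term `M₂` in `N`, so the hypothesis on `ρ` applies to
the induced map `B ⟶ M₂` and gives `ζ`. The octahedron of `η` and `ζ` is a model inside `N` of the
given one, and (ET3) maps the composite triangle to it. -/
theorem mem_rightSub_of_comp_inflation (h : D.IsExtriangulated) (hN : D.IsExtensionClosed N)
    {A B X₁ Y G' G : C} {f : A ⟶ B} {f' : B ⟶ X₁} {δ : D.Ext X₁ A}
    {g : B ⟶ Y} {g' : Y ⟶ G'} {ρ : D.Ext G' B} {h' : Y ⟶ G} {δ' : D.Ext G A}
    (r : D.realizes f f' δ) (r' : D.realizes g g' ρ) (r'' : D.realizes (f ≫ g) h' δ')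
    (hδ : δ ∈ (D.rightSub N).carrier _ _) (hρ : ρ ∈ (D.rightSub N).carrier _ _) :
    δ' ∈ (D.rightSub N).carrier _ _ := by
  intro M hM a
  obtain ⟨M₁, hM₁, c, η, hη⟩ := (mem_lowerSub_iff h hN).mp (hδ M hM a)
  obtain ⟨M₂, m, m', rη⟩ := h.exists_realizes η
  obtain ⟨b, hb, -⟩ := h.exists_lift r rη a c hη.symm
  obtain ⟨P, hP, φ, ζ, hζ⟩ := (mem_lowerSub_iff h hN).mp (hρ M₂ (hN.ext _ _ ⟨_, rη⟩ hM hM₁) b)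
  obtain ⟨Q, n, n', rζ⟩ := h.exists_realizes ζ
  obtain ⟨b', hb', -⟩ := h.exists_lift r' rζ b φ hζ.symm
  obtain ⟨K, j, d, e, ε, h₁, h₂, -⟩ := h.et4 rη rζ
  obtain ⟨c', -, hc'⟩ := h.et3 r'' h₁ a b' (by rw [Category.assoc, hb', reassoc_of% hb])
  exact (mem_lowerSub_iff h hN).mpr ⟨K, hN.ext _ _ ⟨_, h₂⟩ hM₁ hP, c', ε, hc'.symm⟩

/-- A witness for `(d ≫ a)_* δ` lives over `B` and has to be moved down to `Y`. The obstruction is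
the restriction of `c` to `G'`; it is absorbed by a second witness, for `ρ`, after which a map `t`
out of `Y` exists. It accounts for `a_* δ'` up to an extension pushed forward from `ρ`, which is
harmless by hypothesis. -/
theorem mem_rightSub_of_comp_deflation (h : D.IsExtriangulated) (hN : D.IsExtensionClosed N)
    {B X₁ Y G' G : C} {δ : D.Ext B X₁}
    {g' : G' ⟶ B} {g : B ⟶ Y} {ρ : D.Ext Y G'} {d : X₁ ⟶ G} {δ' : D.Ext Y G}
    (r' : D.realizes g' g ρ) (hd : D.push B d δ = D.pull g G δ')
    (hδ : δ ∈ (D.rightSub N).carrier _ _) (hρ : ρ ∈ (D.rightSub N).carrier _ _) :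
    δ' ∈ (D.rightSub N).carrier _ _ := by
  intro M hM a
  obtain ⟨M₁, hM₁, c, η, hη⟩ := (mem_lowerSub_iff h hN).mp (hδ M hM (d ≫ a))
  rw [push_comp, hd, ← pull_push] at hη
  obtain ⟨M₂, m, m', rη⟩ := h.exists_realizes η
  -- The class `η` pulled back to `B` comes from `Y` along `g`, so it dies on `G'`.
  obtain ⟨l, hl⟩ := h.exists_colift rη (g' ≫ c) (by
    rw [pull_comp, hη, ← pull_comp, h.comp_eq_zero r', h.pull_zero])
  obtain ⟨M₃, hM₃, s, κ, hκ⟩ := (mem_lowerSub_iff h hN).mp (hρ M₂ (hN.ext _ _ ⟨_, rη⟩ hM hM₁) l)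
  obtain ⟨M₄, n, n', rκ⟩ := h.exists_realizes κ
  obtain ⟨b, hb, -⟩ := h.exists_lift r' rκ l s hκ.symm
  obtain ⟨M₅, j, d₅, e₅, η', h₁, h₂, h₃, -, h₅, -⟩ := h.et4 rη rκ
  -- The correction by `b ≫ j` makes the map vanish on `G'`, and it does not change the pullback of
  -- `η'`, since `j^* η' = 0`.
  obtain ⟨t, ht⟩ := h.exists_desc r' (c ≫ d₅ - b ≫ j) (by
    rw [Preadditive.comp_sub, ← reassoc_of% hl, reassoc_of% hb, h₃, sub_self])
  obtain ⟨q, hq⟩ := h.exists_push_of_pull_eq_zero r' (D.push Y a δ' - D.pull t M η') (by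
    rw [map_sub, ← pull_comp, ht, h.pull_sub, pull_comp, pull_comp, h₅, h.pull_deflation h₁,
      map_zero, sub_zero, hη, sub_self])
  rw [← sub_add_cancel (D.push Y a δ') (D.pull t M η'), ← hq]
  exact add_mem (hρ M hM q)
    ((mem_lowerSub_iff h hN).mpr ⟨M₅, hN.ext _ _ ⟨_, h₂⟩ hM₁ hM₃, t, η', rfl⟩)

theorem subN_isClosed (h : D.IsExtriangulated) (hN : D.IsExtensionClosed N) :
    (D.subN N).IsClosed := by
  refine SubBifunctor.isClosed_of_octahedra h _ ?_ ?_
  · intro A B X₁ Y G' G f f' δ g g' ρ h' e δ' r r' r'' h₆ hδ hρ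
    exact ⟨mem_rightSub_of_comp_inflation h hN r r' r'' hδ.1 hρ.1,
      (mem_leftSub_iff_op h hN).mpr (mem_rightSub_of_comp_deflation h.op hN.op r h₆.symm
        ((mem_leftSub_iff_op h hN).mp hρ.2) ((mem_leftSub_iff_op h hN).mp hδ.2))⟩
  · intro A B X₁ Y G' G f' f δ g' g ρ h' d δ' r r' r'' h₆ hδ hρ
    exact ⟨mem_rightSub_of_comp_deflation h hN r' h₆ hδ.1 hρ.1,
      (mem_leftSub_iff_op h hN).mpr (mem_rightSub_of_comp_inflation h.op hN.op r' r r''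
        ((mem_leftSub_iff_op h hN).mp hρ.2) ((mem_leftSub_iff_op h hN).mp hδ.2))⟩

/-! ### Extriangulated categories whose structure is determined by `N` -/

/-- The pair `(C, N)` is *adapted* if `N` is closed under extensions and summands, sections in `C`
split off, and pushing an extension into `N`, or pulling it back to `N`, yields an extension that
is induced from an extension of objects of `N`. -/
structure Adapted (D : ExtriData.{u, v, w} k C) (N : ObjectProperty C) : Prop where
  ext : D.IsExtriangulated
  closed : D.IsExtensionClosed N
  split : ∀ {X Y : C} (i : X ⟶ Y) (r : Y ⟶ X), i ≫ r = 𝟙 X →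
    ∃ (K : C) (j : K ⟶ Y) (q : Y ⟶ K), IsDirectSum i j r q
  summand : ∀ {X Y W : C} {i₁ : X ⟶ W} {i₂ : Y ⟶ W} {p₁ : W ⟶ X} {p₂ : W ⟶ Y},
    IsDirectSum i₁ i₂ p₁ p₂ → N W → N X
  right : ∀ {Z X M : C} (δ : D.Ext Z X) (a : X ⟶ M), N M →
    ∃ (M' : C) (_ : N M') (c : Z ⟶ M') (η : D.Ext M' M), D.pull c M η = D.push Z a δ
  left : ∀ {Z X M : C} (δ : D.Ext Z X) (c : M ⟶ Z), N M →
    ∃ (M' : C) (_ : N M') (a : M' ⟶ X) (η : D.Ext M M'), D.push M a η = D.pull c X δ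

theorem Adapted.op (g : D.Adapted N) : D.op.Adapted N.op where
  ext := g.ext.op
  closed := g.closed.op
  split i r hir := by
    obtain ⟨K, j, q, hK⟩ := g.split r.unop i.unop (congrArg Quiver.Hom.unop hir)
    exact ⟨Opposite.op K, q.op, j.op, hK.op⟩
  summand hW h := g.summand hW.unop h
  right δ a hM := by
    obtain ⟨M', hM', c, η, hη⟩ := g.left δ a.unop hM
    exact ⟨Opposite.op M', hM', c.op, η, hη⟩
  left δ c hM := by
    obtain ⟨M', hM', a, η, hη⟩ := g.right δ c.unop hM
    exact ⟨Opposite.op M', hM', a.op, η, hη⟩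

theorem subN_carrier_eq_top (h : D.IsExtriangulated) (hN : D.IsExtensionClosed N) {Z X : C}
    (hZ : N Z) (hX : N X) : (D.subN N).carrier Z X = ⊤ :=
  top_le_iff.mp fun δ _ => ⟨fun _ _ a => (mem_lowerSub_iff h hN).mpr
      ⟨Z, hZ, 𝟙 Z, D.push Z a δ, pull_id _ _ _⟩,
    fun _ _ c => (mem_upperSub_iff h hN).mpr ⟨X, hX, 𝟙 X, D.pull c X δ, push_id _ _ _⟩⟩

theorem adapted_substructure (h : D.IsExtriangulated) (hC : WeaklyIdempotentComplete C)
    (hN : D.IsExtensionClosed N) (hs : ClosedUnderSummands N) : (D.substructure N).Adapted N where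
  ext := subN_isClosed h hN
  closed :=
    { containsZero := hN.containsZero
      isoClosed := hN.isoClosed
      ext := fun x y ⟨δ, r⟩ hX hZ => hN.ext x y ⟨δ.1, r⟩ hX hZ }
  split := hC.exists_isDirectSum
  summand {X Y W i₁ i₂ p₁ p₂} hW hWN := by
    have := h.hasBinaryBiproducts
    obtain ⟨e, -, -⟩ := hW.exists_iso (IsDirectSum.biprod X Y)
    exact hs X Y (hN.isoClosed.of_iso e hWN)
  right {Z X M} δ a hM := by
    obtain ⟨M', hM', c, η, hη⟩ := (mem_lowerSub_iff h hN).mp (δ.2.1 M hM a)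
    -- Extensions between objects of `N` always belong to `𝔼_N`, so a witness in `𝔼` is one for the
    -- substructure.
    exact ⟨M', hM', c, ⟨η, by rw [subN_carrier_eq_top h hN hM' hM]; trivial⟩, Subtype.ext hη⟩
  left {Z X M} δ c hM := by
    obtain ⟨M', hM', a, η, hη⟩ := (mem_upperSub_iff h hN).mp (δ.2.2 M hM c)
    exact ⟨M', hM', a, ⟨η, by rw [subN_carrier_eq_top h hN hM hM']; trivial⟩, Subtype.ext hη⟩

end ExtriData
end Extri

/-! ### Maps factoring through `N`, and duality for the classes of morphisms. -/

namespace Extri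

section Factors

variable {C : Type u} [Category.{v} C] {N : ObjectProperty C} {X Y Z : C}

/-- `f` factors through an object of `N`. -/
def Factors (N : ObjectProperty C) {X Y : C} (f : X ⟶ Y) : Prop :=
  ∃ (M : C) (_ : N M) (i : X ⟶ M) (j : M ⟶ Y), i ≫ j = f

theorem Factors.mk {M : C} (hM : N M) (i : X ⟶ M) (j : M ⟶ Y) : Factors N (i ≫ j) :=
  ⟨M, hM, i, j, rfl⟩

theorem Factors.precomp {f : Y ⟶ Z} (h : Factors N f) (g : X ⟶ Y) : Factors N (g ≫ f) := by
  obtain ⟨M, hM, i, j, rfl⟩ := h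
  exact ⟨M, hM, g ≫ i, j, by simp⟩

theorem Factors.postcomp {f : X ⟶ Y} (h : Factors N f) (g : Y ⟶ Z) : Factors N (f ≫ g) := by
  obtain ⟨M, hM, i, j, rfl⟩ := h
  exact ⟨M, hM, i, j ≫ g, by simp⟩

theorem Factors.op {f : X ⟶ Y} (h : Factors N f) : Factors N.op f.op := by
  obtain ⟨M, hM, i, j, rfl⟩ := h
  exact ⟨Opposite.op M, hM, j.op, i.op, by simp⟩

theorem Factors.unop {X Y : Cᵒᵖ} {f : X ⟶ Y} (h : Factors N.op f) : Factors N f.unop := by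
  obtain ⟨M, hM, i, j, rfl⟩ := h
  exact ⟨M.unop, hM, j.unop, i.unop, by simp⟩

variable [Preadditive C]

theorem Factors.neg {f : X ⟶ Y} (h : Factors N f) : Factors N (-f) := by
  obtain ⟨M, hM, i, j, rfl⟩ := h
  exact ⟨M, hM, -i, j, by simp⟩

theorem IsDirectSum.neg_left {W : C} {i₁ : X ⟶ W} {i₂ : Y ⟶ W} {p₁ : W ⟶ X} {p₂ : W ⟶ Y}
    (h : IsDirectSum i₁ i₂ p₁ p₂) : IsDirectSum (-i₁) i₂ (-p₁) p₂ :=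
  ⟨by simp [h.inl_fst], h.inr_snd, by simp [h.inl_snd], by simp [h.inr_fst], by simp [h.total]⟩

theorem IsDirectSum.assoc {W V U : C} {i₁ : X ⟶ W} {i₂ : Y ⟶ W} {p₁ : W ⟶ X} {p₂ : W ⟶ Y}
    {j₁ : W ⟶ V} {j₂ : Z ⟶ V} {q₁ : V ⟶ W} {q₂ : V ⟶ Z}
    {l₁ : Y ⟶ U} {l₂ : Z ⟶ U} {r₁ : U ⟶ Y} {r₂ : U ⟶ Z}
    (h : IsDirectSum i₁ i₂ p₁ p₂) (h' : IsDirectSum j₁ j₂ q₁ q₂) (h'' : IsDirectSum l₁ l₂ r₁ r₂) :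
    IsDirectSum (i₁ ≫ j₁) (r₁ ≫ i₂ ≫ j₁ + r₂ ≫ j₂) (q₁ ≫ p₁) (q₁ ≫ p₂ ≫ l₁ + q₂ ≫ l₂) where
  inl_fst := by simp [h'.inl_fst_assoc, h.inl_fst]
  inr_snd := by
    simp [h'.inl_fst_assoc, h'.inl_snd_assoc, h'.inr_snd_assoc, h'.inr_fst_assoc,
      h.inr_snd_assoc, h''.total]
  inl_snd := by simp [h'.inl_fst_assoc, h'.inl_snd_assoc, h.inl_snd_assoc]
  inr_fst := by simp [h'.inl_fst_assoc, h'.inr_fst_assoc, h.inr_fst]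
  total := by
    rw [← h'.total]
    have : q₁ ≫ p₁ ≫ i₁ ≫ j₁ + q₁ ≫ p₂ ≫ i₂ ≫ j₁ = q₁ ≫ j₁ := by
      simpa using q₁ ≫= h.total =≫ j₁
    simp [h''.inl_fst_assoc, h''.inl_snd_assoc, h''.inr_snd_assoc, h''.inr_fst_assoc, ← this,
      add_assoc]

end Factors

namespace ExtriData

variable {k : Type t} [CommRing k] {C : Type u} [Category.{v} C] [Preadditive C] [Linear k C]
  {D : ExtriData.{u, v, w} k C} {N : ObjectProperty C}

theorem infN_op {X Y : C} {f : X ⟶ Y} : D.op.infN N.op f.op ↔ D.defN N f :=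
  ⟨fun ⟨Z, y, ⟨δ, r⟩, h⟩ => ⟨Z.unop, y.unop, ⟨δ, r⟩, h⟩,
    fun ⟨Z, y, ⟨δ, r⟩, h⟩ => ⟨Opposite.op Z, y.op, ⟨δ, r⟩, h⟩⟩

theorem defN_op {X Y : C} {f : X ⟶ Y} : D.op.defN N.op f.op ↔ D.infN N f :=
  ⟨fun ⟨Z, y, ⟨δ, r⟩, h⟩ => ⟨Z.unop, y.unop, ⟨δ, r⟩, h⟩,
    fun ⟨Z, y, ⟨δ, r⟩, h⟩ => ⟨Opposite.op Z, y.op, ⟨δ, r⟩, h⟩⟩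

theorem sN_op {X Y : C} {f : X ⟶ Y} : D.op.sN N.op f.op ↔ D.sN N f := by
  constructor
  · suffices ∀ {X Y : Cᵒᵖ} (f : X ⟶ Y), D.op.sN N.op f → D.sN N f.unop from this f.op
    intro X Y f hf
    induction hf with
    | inf f hf => exact .df _ (infN_op.mp hf)
    | df f hf => exact .inf _ (defN_op.mp hf)
    | comp f g _ _ h₁ h₂ => exact .comp _ _ h₂ h₁
  · intro hf
    induction hf with
    | inf f hf => exact .df _ (defN_op.mpr hf)
    | df f hf => exact .inf _ (infN_op.mpr hf)
    | comp f g _ _ h₁ h₂ => exact .comp _ _ h₂ h₁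

namespace Adapted

variable {X Y Z : C}

theorem sum (g : D.Adapted N) {W : C} {i₁ : X ⟶ W} {i₂ : Y ⟶ W} {p₁ : W ⟶ X} {p₂ : W ⟶ Y}
    (hW : IsDirectSum i₁ i₂ p₁ p₂) (hX : N X) (hY : N Y) : N W := g.closed.sum g.ext hW hX hY

theorem zero (g : D.Adapted N) {O : C} (hO : IsZero O) : N O := g.closed.zero hO

theorem factors_add (g : D.Adapted N) {f f' : X ⟶ Y} (h : Factors N f) (h' : Factors N f') :
    Factors N (f + f') := by
  obtain ⟨M, hM, i, j, rfl⟩ := h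
  obtain ⟨M', hM', i', j', rfl⟩ := h'
  obtain ⟨W, i₁, i₂, p₁, p₂, hW⟩ := g.ext.exists_sum M M'
  refine ⟨W, g.sum hW hM hM', i ≫ i₁ + i' ≫ i₂, p₁ ≫ j + p₂ ≫ j', ?_⟩
  simp [hW.inl_fst_assoc, hW.inl_snd_assoc, hW.inr_fst_assoc, hW.inr_snd_assoc]

theorem factors_sub (g : D.Adapted N) {f f' : X ⟶ Y} (h : Factors N f) (h' : Factors N f') :
    Factors N (f - f') := by
  rw [sub_eq_add_neg]
  exact g.factors_add h h'.neg

theorem factors_zero (g : D.Adapted N) : Factors N (0 : X ⟶ Y) := by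
  obtain ⟨O, hO⟩ := g.ext.exists_zero
  exact ⟨O, g.zero hO, 0, 0, by simp⟩

/-- Such an object is a retract of an object of `N`; sections split off, so it is a direct summand.
-/
theorem mem_of_factors_id (g : D.Adapted N) (h : Factors N (𝟙 X)) : N X := by
  obtain ⟨M, hM, i, j, hij⟩ := h
  obtain ⟨K, _, _, hK⟩ := g.split i j hij
  exact g.summand hK hM

/-! ### Inflations with cone in `N` and deflations with cocone in `N` -/

theorem infN_comp (g : D.Adapted N) {f : X ⟶ Y} {f' : Y ⟶ Z} (h : D.infN N f) (h' : D.infN N f') :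
    D.infN N (f ≫ f') := by
  obtain ⟨A, y, ⟨δ, r⟩, hA⟩ := h
  obtain ⟨B, z, ⟨ρ, r'⟩, hB⟩ := h'
  obtain ⟨G, h', d, e, δ', h₁, h₂, -⟩ := g.ext.et4 r r'
  exact ⟨G, h', ⟨δ', h₁⟩, g.closed.ext d e ⟨_, h₂⟩ hA hB⟩

theorem defN_comp (g : D.Adapted N) {f : X ⟶ Y} {f' : Y ⟶ Z} (h : D.defN N f) (h' : D.defN N f') :
    D.defN N (f ≫ f') :=
  infN_op.mp (g.op.infN_comp (infN_op.mpr h') (infN_op.mpr h))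

theorem infN_inl (g : D.Adapted N) {W : C} {i₁ : X ⟶ W} {i₂ : Y ⟶ W} {p₁ : W ⟶ X} {p₂ : W ⟶ Y}
    (hW : IsDirectSum i₁ i₂ p₁ p₂) (hY : N Y) : D.infN N i₁ :=
  ⟨Y, p₂, ⟨_, g.ext.realizes_split hW⟩, hY⟩

theorem defN_fst (g : D.Adapted N) {W : C} {i₁ : X ⟶ W} {i₂ : Y ⟶ W} {p₁ : W ⟶ X} {p₂ : W ⟶ Y}
    (hW : IsDirectSum i₁ i₂ p₁ p₂) (hY : N Y) : D.defN N p₁ :=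
  ⟨Y, i₂, ⟨_, g.ext.realizes_split hW.swap⟩, hY⟩

theorem infN_of_isIso (g : D.Adapted N) (f : X ⟶ Y) [IsIso f] : D.infN N f := by
  obtain ⟨O, hO⟩ := g.ext.exists_zero
  have := (IsDirectSum.right_zero X hO).of_iso (asIso f)
  exact g.infN_inl (by simpa using this) (g.zero hO)

theorem sN_of_isIso (g : D.Adapted N) (f : X ⟶ Y) [IsIso f] : D.sN N f := .inf _ (g.infN_of_isIso f)

theorem sN_inl (g : D.Adapted N) {W : C} {i₁ : X ⟶ W} {i₂ : Y ⟶ W} {p₁ : W ⟶ X} {p₂ : W ⟶ Y}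
    (hW : IsDirectSum i₁ i₂ p₁ p₂) (hY : N Y) : D.sN N i₁ := .inf _ (g.infN_inl hW hY)

theorem sN_fst (g : D.Adapted N) {W : C} {i₁ : X ⟶ W} {i₂ : Y ⟶ W} {p₁ : W ⟶ X} {p₂ : W ⟶ Y}
    (hW : IsDirectSum i₁ i₂ p₁ p₂) (hY : N Y) : D.sN N p₁ := .df _ (g.defN_fst hW hY)

theorem infN_directSum_id (g : D.Adapted N) {f : X ⟶ Y} (hf : D.infN N f) {V A B : C}
    {i₁ : X ⟶ A} {i₂ : V ⟶ A} {p₁ : A ⟶ X} {p₂ : A ⟶ V} (hA : IsDirectSum i₁ i₂ p₁ p₂)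
    {j₁ : Y ⟶ B} {j₂ : V ⟶ B} {q₁ : B ⟶ Y} {q₂ : B ⟶ V} (hB : IsDirectSum j₁ j₂ q₁ q₂) :
    D.infN N (p₁ ≫ f ≫ j₁ + p₂ ≫ j₂) := by
  obtain ⟨P, y, ⟨δ, r⟩, hP⟩ := hf
  obtain ⟨O, hO⟩ := g.ext.exists_zero
  have := g.ext.realizes_directSum r (g.ext.realizes_right_zero V hO) hA hB
    (IsDirectSum.right_zero P hO)
  exact ⟨P, _, ⟨_, by simpa using this⟩, hP⟩

theorem defN_directSum_id (g : D.Adapted N) {f : X ⟶ Y} (hf : D.defN N f) {V A B : C}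
    {i₁ : X ⟶ A} {i₂ : V ⟶ A} {p₁ : A ⟶ X} {p₂ : A ⟶ V} (hA : IsDirectSum i₁ i₂ p₁ p₂)
    {j₁ : Y ⟶ B} {j₂ : V ⟶ B} {q₁ : B ⟶ Y} {q₂ : B ⟶ V} (hB : IsDirectSum j₁ j₂ q₁ q₂) :
    D.defN N (p₁ ≫ f ≫ j₁ + p₂ ≫ j₂) := by
  have := g.op.infN_directSum_id (infN_op.mpr hf) hB.op hA.op
  rw [← infN_op]
  simpa using this

theorem sN_directSum_id (g : D.Adapted N) {f : X ⟶ Y} (hf : D.sN N f) {V A B : C}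
    {i₁ : X ⟶ A} {i₂ : V ⟶ A} {p₁ : A ⟶ X} {p₂ : A ⟶ V} (hA : IsDirectSum i₁ i₂ p₁ p₂)
    {j₁ : Y ⟶ B} {j₂ : V ⟶ B} {q₁ : B ⟶ Y} {q₂ : B ⟶ V} (hB : IsDirectSum j₁ j₂ q₁ q₂) :
    D.sN N (p₁ ≫ f ≫ j₁ + p₂ ≫ j₂) := by
  induction hf generalizing A B with
  | inf f hf => exact .inf _ (g.infN_directSum_id hf hA hB)
  | df f hf => exact .df _ (g.defN_directSum_id hf hA hB)
  | @comp X Y Z f f' _ _ h₁ h₂ =>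
    obtain ⟨W, l₁, l₂, r₁, r₂, hW⟩ := g.ext.exists_sum Y V
    convert sN.comp _ _ (h₁ hA hW) (h₂ hW hB) using 1
    simp [hW.inl_fst_assoc, hW.inl_snd_assoc, hW.inr_fst_assoc, hW.inr_snd_assoc]

/-- Along an inflation, a morphism to an object of `N` extends after enlarging this object. -/
theorem exists_extend_infN (g : D.Adapted N) {x : X ⟶ Y} {y : Y ⟶ Z} {δ : D.Ext Z X}
    (r : D.realizes x y δ) {M : C} (hM : N M) (m : X ⟶ M) :
    ∃ (M' : C) (_ : N M') (n : M ⟶ M') (e : Y ⟶ M'), D.infN N n ∧ x ≫ e = m ≫ n := by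
  obtain ⟨P, hP, c, η, hη⟩ := g.right δ m hM
  obtain ⟨M', n, q, r'⟩ := g.ext.exists_realizes η
  obtain ⟨e, he, -⟩ := g.ext.exists_lift r r' m c hη.symm
  exact ⟨M', g.closed.ext _ _ ⟨_, r'⟩ hM hP, n, e, ⟨P, q, ⟨_, r'⟩, hP⟩, he⟩

/-- The class of the triangle is induced from an extension `X ⟶ M ⟶ P` in `N`. The homotopy pullback
is a conflation `Y ⟶ M ⊕ Z ⟶ P`, so `M ⊕ Z` lies in `N`, and so does its summand `Z`. -/
theorem mem_cone (g : D.Adapted N) {x : X ⟶ Y} {y : Y ⟶ Z} {δ : D.Ext Z X}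
    (r : D.realizes x y δ) (hX : N X) (hY : N Y) : N Z := by
  obtain ⟨P, hP, c, η, hη⟩ := g.right δ (𝟙 X) hX
  rw [push_id] at hη
  obtain ⟨M, n, q, r'⟩ := g.ext.exists_realizes η
  obtain ⟨W, i₁, i₂, p₁, p₂, hW⟩ := g.ext.exists_sum M Z
  obtain ⟨b, -, -, s⟩ := g.ext.exists_pullback r' c (hη ▸ r) hW
  exact g.summand hW.swap (g.closed.ext _ _ ⟨_, s⟩ hY hP)

theorem mem_cocone (g : D.Adapted N) {x : X ⟶ Y} {y : Y ⟶ Z} {δ : D.Ext Z X}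
    (r : D.realizes x y δ) (hY : N Y) (hZ : N Z) : N X := g.op.mem_cone r hZ hY

theorem isThick (g : D.Adapted N) : D.IsThick N where
  toIsExtensionClosed := g.closed
  summands X Y _ h := g.summand (IsDirectSum.biprod X Y) h
  cone _ _ := fun ⟨_, r⟩ => g.mem_cone r
  cocone _ _ := fun ⟨_, r⟩ => g.mem_cocone r

theorem spade (g : D.Adapted N) : D.Spade N where
  inflation := by
    rintro N₁ B f ⟨Z, y, δ, r⟩
    -- Extending the identity of `N₁` along `f` gives the required map out of `B`.
    obtain ⟨M, hM, n, e, ⟨P, q, ⟨η, r'⟩, hP⟩, he⟩ := g.exists_extend_infN r N₁.property (𝟙 _)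
    refine ⟨⟨M, hM⟩, e, ⟨P, hP⟩, ObjectProperty.homMk q, η, ?_⟩
    rw [Category.id_comp] at he
    change D.realizes (f ≫ e) q η
    exact realizes.congr r' he.symm rfl rfl
  deflation := by
    rintro B N₁ f ⟨Z, y, δ, r⟩
    obtain ⟨M, hM, n, e, ⟨P, q, ⟨η, r'⟩, hP⟩, he⟩ :=
      g.op.exists_extend_infN (x := f.op) (y := y.op) r (M := Opposite.op N₁.obj) N₁.property (𝟙 _)
    refine ⟨⟨M.unop, hM⟩, e.unop, ⟨P.unop, hP⟩, ObjectProperty.homMk q.unop, η, ?_⟩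
    rw [Category.id_comp] at he
    change D.realizes q.unop (e.unop ≫ f) η
    exact realizes.congr (D := D) r' rfl (congrArg Quiver.Hom.unop he.symm) rfl

/-! ### The class `S_N` -/

/-- The homotopy pullback of the triangle with a realization `A ⟶ M ⟶ P` in `N` is a conflation `X ⟶
M ⊕ Y ⟶ P`, whose first map has component `-f` in `Y`. The sign is moved into the chosen
decomposition of the sum. -/
theorem exists_infN_of_defN (g : D.Adapted N) {f : X ⟶ Y} (hf : D.defN N f) :
    ∃ (M W : C) (i₁ : Y ⟶ W) (i₂ : M ⟶ W) (p₁ : W ⟶ Y) (p₂ : W ⟶ M) (s : X ⟶ W),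
      IsDirectSum i₁ i₂ p₁ p₂ ∧ N M ∧ D.infN N s ∧ s ≫ p₁ = f := by
  obtain ⟨A, a, ⟨δ, r⟩, hA⟩ := hf
  obtain ⟨P, hP, c, η, hη⟩ := g.right δ (𝟙 A) hA
  rw [push_id] at hη
  obtain ⟨M, n, q, r'⟩ := g.ext.exists_realizes η
  obtain ⟨W, i₁, i₂, p₁, p₂, hW⟩ := g.ext.exists_sum M Y
  obtain ⟨b, -, -, s⟩ := g.ext.exists_pullback r' c (hη ▸ r) hW
  exact ⟨M, W, _, _, _, _, _, hW.swap.neg_left, g.closed.ext _ _ ⟨_, r'⟩ hA hP,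
    ⟨P, _, ⟨_, s⟩, hP⟩, by simp [hW.inl_snd, hW.inr_snd]⟩

/-- A morphism of `S_N` is an inflation with cone in `N` followed by a split deflation. -/
theorem exists_infN_of_sN (g : D.Adapted N) {f : X ⟶ Y} (hf : D.sN N f) :
    ∃ (M W : C) (i₁ : Y ⟶ W) (i₂ : M ⟶ W) (p₁ : W ⟶ Y) (p₂ : W ⟶ M) (s : X ⟶ W),
      IsDirectSum i₁ i₂ p₁ p₂ ∧ N M ∧ D.infN N s ∧ s ≫ p₁ = f := by
  induction hf with
  | @inf X Y f hf =>
    obtain ⟨O, hO⟩ := g.ext.exists_zero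
    exact ⟨O, Y, _, _, _, _, f, IsDirectSum.right_zero Y hO, g.zero hO, hf, by simp⟩
  | df f hf => exact g.exists_infN_of_defN hf
  | comp f f' _ _ h₁ h₂ =>
    obtain ⟨M, W, i₁, i₂, p₁, p₂, s, hW, hM, hs, rfl⟩ := h₁
    obtain ⟨M', W', i₁', i₂', p₁', p₂', s', hW', hM', hs', rfl⟩ := h₂
    -- The projection away from `M` commutes past `s'` once `s'` is replaced by `s' ⊕ 1_M`; the
    -- summands `M'` and `M` are then forgotten together.
    obtain ⟨V, j₁, j₂, q₁, q₂, hV⟩ := g.ext.exists_sum W' M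
    obtain ⟨U, l₁, l₂, r₁, r₂, hU⟩ := g.ext.exists_sum M' M
    refine ⟨U, V, _, _, _, _, _, hW'.assoc hV hU, g.sum hU hM' hM,
      g.infN_comp hs (g.infN_directSum_id hs' hW hV), ?_⟩
    simp [hV.inl_fst_assoc, hV.inr_fst_assoc]

/-- A morphism of `S_N` is a split inflation followed by a deflation with cocone in `N`. -/
theorem exists_defN_of_sN (g : D.Adapted N) {f : X ⟶ Y} (hf : D.sN N f) :
    ∃ (M W : C) (i₁ : X ⟶ W) (i₂ : M ⟶ W) (p₁ : W ⟶ X) (p₂ : W ⟶ M) (s : W ⟶ Y),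
      IsDirectSum i₁ i₂ p₁ p₂ ∧ N M ∧ D.defN N s ∧ i₁ ≫ s = f := by
  obtain ⟨M, W, i₁, i₂, p₁, p₂, s, hW, hM, hs, h⟩ := g.op.exists_infN_of_sN (sN_op.mpr hf)
  exact ⟨M.unop, W.unop, _, _, _, _, s.unop, hW.unop, hM, infN_op.mp hs,
    congrArg Quiver.Hom.unop h⟩

/-- If `f' = f + ab` with `a` and `b` through `M`, then `f'` is the composite `X ⟶ X ⊕ M ⟶ Y ⊕ M ⟶
Y` of `(1, a)`, `f ⊕ 1` and `(1, b)`. The outer two are a shear of the inclusion and of the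
projection, hence in `S_N`. So membership in `S_N` depends only on the class modulo `N`. -/
theorem sN_of_factors_sub (g : D.Adapted N) {f f' : X ⟶ Y} (hf : D.sN N f)
    (h : Factors N (f' - f)) : D.sN N f' := by
  obtain ⟨M, hM, a, b, hab⟩ := h
  obtain ⟨A, i₁, i₂, p₁, p₂, hA⟩ := g.ext.exists_sum X M
  obtain ⟨B, j₁, j₂, q₁, q₂, hB⟩ := g.ext.exists_sum Y M
  have h₁ := g.sN_inl (hA.shear a) hM
  have h₂ := g.sN_directSum_id hf hA hB
  have h₃ : D.sN N (q₁ + q₂ ≫ b) := by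
    have := g.sN_fst (hB.op.shear b.op).unop hM
    simpa using this
  convert sN.comp _ _ (sN.comp _ _ h₁ h₂) h₃ using 1
  rw [eq_add_of_sub_eq' hab.symm]
  simp [hA.inl_fst_assoc, hA.inl_snd_assoc, hA.inr_fst_assoc, hA.inr_snd_assoc,
    hB.inl_fst, hB.inl_snd_assoc, hB.inr_fst, hB.inr_snd_assoc]

end Adapted
end ExtriData
end Extri

namespace Extri
namespace ExtriData
namespace Adapted

variable {k : Type t} [CommRing k] {C : Type u} [Category.{v} C] [Preadditive C] [Linear k C]
  {D : ExtriData.{u, v, w} k C} {N : ObjectProperty C} {X Y Z : C}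

/-! ### Two out of three and isomorphisms -/

/-- The induced map of cones exhibits one triangle as a pullback of the other, and the homotopy
pullback `Y ⟶ Z ⊕ P` is an inflation with cone `R`. Its component `b` in `Z` agrees with `f` on `X`,
so `f - b` factors through the cone `P` of `s`. -/
theorem sN_of_infN_comp (g : D.Adapted N) {s : X ⟶ Y} {f : Y ⟶ Z} (hs : D.infN N s)
    (hsf : D.infN N (s ≫ f)) : D.sN N f := by
  obtain ⟨P, p, ⟨ω, r⟩, hP⟩ := hs
  obtain ⟨R, q, ⟨ρ, r'⟩, hR⟩ := hsf
  obtain ⟨c, -, hc⟩ := g.ext.et3 r r' (𝟙 X) f (by simp)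
  rw [push_id] at hc
  obtain ⟨W, i₁, i₂, p₁, p₂, hW⟩ := g.ext.exists_sum Z P
  obtain ⟨b, hb, -, r''⟩ := g.ext.exists_pullback r' c (hc ▸ r) hW
  have h₁ : D.sN N b := by
    convert sN.comp _ _ (.inf _ ⟨R, _, ⟨_, r''⟩, hR⟩) (g.sN_fst hW hP) using 1
    simp [hW.inl_fst, hW.inr_fst]
  obtain ⟨u, hu⟩ := g.ext.exists_desc r (f - b) (by simp [hb])
  exact g.sN_of_factors_sub h₁ ⟨P, hP, p, u, hu⟩

/-- By the normal form, `s` may be taken in `Inf_N`, and `s ≫ f` is the `Z`-component of an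
inflation into `Z ⊕ M`. Its `M`-component extends along `s` after enlarging `M` to `M'`. Replacing
`f` by `(f, e) : Y ⟶ Z ⊕ M'` makes the composite an element of `Inf_N`, where the special case
applies. -/
theorem sN_of_precomp (g : D.Adapted N) {s : X ⟶ Y} {f : Y ⟶ Z} (hs : D.sN N s)
    (hsf : D.sN N (s ≫ f)) : D.sN N f := by
  wlog h : D.infN N s generalizing Y
  · obtain ⟨M, W, i₁, i₂, p₁, p₂, s₀, hW, hM, hs₀, rfl⟩ := g.exists_infN_of_sN hs
    have := this (.inf _ hs₀) (f := p₁ ≫ f) (by simpa using hsf) hs₀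
    convert sN.comp _ _ (g.sN_inl hW hM) this using 1
    rw [hW.inl_fst_assoc]
  obtain ⟨M, V, i₁, i₂, p₁, p₂, s₁, hV, hM, hs₁, h₁⟩ := g.exists_infN_of_sN hsf
  obtain ⟨P, p, ⟨ω, r⟩, hP⟩ := id h
  obtain ⟨M', hM', n, e, hn, he⟩ := g.exists_extend_infN r hM (s₁ ≫ p₂)
  obtain ⟨V', j₁, j₂, q₁, q₂, hV'⟩ := g.ext.exists_sum Z M'
  have h₂ := g.infN_comp hs₁ (g.infN_directSum_id hn hV.swap hV'.swap)
  have h₃ : s₁ ≫ (p₂ ≫ n ≫ j₂ + p₁ ≫ j₁) = s ≫ (f ≫ j₁ + e ≫ j₂) := by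
    simp only [Preadditive.comp_add, reassoc_of% he, reassoc_of% h₁]
    rw [add_comm]
  rw [h₃] at h₂
  convert sN.comp _ _ (g.sN_of_infN_comp h h₂) (g.sN_fst hV' hM') using 1
  simp [hV'.inl_fst, hV'.inr_fst]

theorem sN_of_postcomp (g : D.Adapted N) {s : X ⟶ Y} {f : Y ⟶ Z} (hf : D.sN N f)
    (hsf : D.sN N (s ≫ f)) : D.sN N s :=
  sN_op.mp (g.op.sN_of_precomp (sN_op.mpr hf) (f := s.op) (sN_op.mpr hsf))

/-- From `f f' = 1 + ab` the map `(f, a) : X ⟶ Y ⊕ M` is a section, with retraction `(f', -b)`. Its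
complement lies in `N` because its identity factors through `N`, by the second hypothesis. Thus
isomorphisms of the ideal quotient come from `S_N`. -/
theorem sN_of_factors_sub_id (g : D.Adapted N) {f : X ⟶ Y} {f' : Y ⟶ X}
    (h₁ : Factors N (f ≫ f' - 𝟙 X)) (h₂ : Factors N (f' ≫ f - 𝟙 Y)) : D.sN N f := by
  obtain ⟨M, hM, a, b, hab⟩ := h₁
  obtain ⟨W, i₁, i₂, p₁, p₂, hW⟩ := g.ext.exists_sum Y M
  obtain ⟨K, j, q, hK⟩ := g.split (f ≫ i₁ + a ≫ i₂) (p₁ ≫ f' - p₂ ≫ b) (by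
    simp [hW.inl_fst_assoc, hW.inl_snd_assoc, hW.inr_fst_assoc, hW.inr_snd_assoc, hab])
  have hq : f ≫ i₁ ≫ q = -a ≫ i₂ ≫ q := by
    rw [eq_neg_iff_add_eq_zero]
    simpa using hK.inl_snd
  have hKN : N K := by
    apply g.mem_of_factors_id
    have e : 𝟙 K = j ≫ p₁ ≫ f' ≫ (-a ≫ i₂ ≫ q) - j ≫ p₁ ≫ (f' ≫ f - 𝟙 Y) ≫ i₁ ≫ q +
        j ≫ p₂ ≫ i₂ ≫ q := by
      rw [← hK.inr_snd, ← hq]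
      nth_rw 1 [← Category.id_comp q]
      rw [← hW.total]
      simp
    rw [e]
    exact g.factors_add (g.factors_sub
      (((Factors.mk hM a (i₂ ≫ q)).neg.precomp f').precomp p₁ |>.precomp j)
      (((h₂.postcomp (i₁ ≫ q)).precomp p₁).precomp j)) ((Factors.mk hM p₂ (i₂ ≫ q)).precomp j)
  convert sN.comp _ _ (g.sN_inl hK hKN) (g.sN_fst hW hM) using 1
  simp [hW.inl_fst, hW.inr_fst]

theorem nullObjects_sN (g : D.Adapted N) : nullObjects (D.sN N) = N := by
  ext X
  constructor
  · rintro ⟨O, hO, h, -⟩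
    obtain ⟨M, W, i₁, i₂, p₁, p₂, s, hW, hM, ⟨P, p, ⟨δ, r⟩, hP⟩, -⟩ := g.exists_infN_of_sN h
    exact g.mem_cocone r (g.sum hW (g.zero hO) hM) hP
  · intro hX
    obtain ⟨O, hO⟩ := g.ext.exists_zero
    exact ⟨O, hO, g.sN_fst (IsDirectSum.left_zero X hO) hX,
      g.sN_inl (IsDirectSum.left_zero X hO) hX⟩

/-! ### Calculus of fractions modulo `N` -/

/-- The inflation `s₀` of the normal form is pushed out along `f`; the cone is unchanged. The square
for `s` fails to commute only by the summand `M`. -/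
theorem exists_ore (g : D.Adapted N) {X' : C} {s : X ⟶ X'} (hs : D.sN N s) (f : X ⟶ Y) :
    ∃ (Y' : C) (t : Y ⟶ Y') (f' : X' ⟶ Y'), D.infN N t ∧ Factors N (f ≫ t - s ≫ f') := by
  obtain ⟨M, W, i₁, i₂, p₁, p₂, s₀, hW, hM, ⟨P, p, ⟨ω, r⟩, hP⟩, rfl⟩ := g.exists_infN_of_sN hs
  obtain ⟨Y', t, q, r'⟩ := g.ext.exists_realizes (D.push P f ω)
  obtain ⟨b, hb, -⟩ := g.ext.exists_lift r r' f (𝟙 P) (by simp)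
  refine ⟨Y', t, i₁ ≫ b, ⟨P, q, ⟨_, r'⟩, hP⟩, M, hM, s₀ ≫ p₂, i₂ ≫ b, ?_⟩
  rw [← hb, eq_sub_iff_add_eq']
  simpa using s₀ ≫= hW.total =≫ b

/-- With `s ≫ f = a ≫ b` through `M`, the map `a` extends along `s` to `e`, at the price of an
inflation `n` out of `M`. Pushing `n` out along `b` gives `t`. Then `f ≫ t` and `e ≫ b'` agree on
`X`, so they differ by a map through the cone of `s`. -/
theorem exists_cancel (g : D.Adapted N) {X' : C} {s : X ⟶ X'} (hs : D.sN N s) {f : X' ⟶ Y}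
    (h : Factors N (s ≫ f)) : ∃ (Y' : C) (t : Y ⟶ Y'), D.infN N t ∧ Factors N (f ≫ t) := by
  wlog hi : D.infN N s generalizing X'
  · obtain ⟨M, W, i₁, i₂, p₁, p₂, s₀, hW, hM, hs₀, rfl⟩ := g.exists_infN_of_sN hs
    obtain ⟨Y', t, ht, h'⟩ := this (.inf _ hs₀) (f := p₁ ≫ f) (by simpa using h) hs₀
    refine ⟨Y', t, ht, ?_⟩
    simpa [hW.inl_fst_assoc] using h'.precomp i₁
  obtain ⟨P, p, ⟨ω, r⟩, hP⟩ := hi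
  obtain ⟨M, hM, a, b, hab⟩ := h
  obtain ⟨M', hM', n, e, ⟨Q, q, ⟨η, rn⟩, hQ⟩, he⟩ := g.exists_extend_infN r hM a
  obtain ⟨Y', t, q', r'⟩ := g.ext.exists_realizes (D.push Q b η)
  obtain ⟨b', hb', -⟩ := g.ext.exists_lift rn r' b (𝟙 Q) (by simp)
  obtain ⟨u, hu⟩ := g.ext.exists_desc r (f ≫ t - e ≫ b') (by
    rw [Preadditive.comp_sub, ← reassoc_of% hab, reassoc_of% he, hb', sub_self])
  refine ⟨Y', t, ⟨Q, q', ⟨_, r'⟩, hQ⟩, ?_⟩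
  rw [← sub_add_cancel (f ≫ t) (e ≫ b'), ← hu]
  exact g.factors_add (.mk hP p u) (.mk hM' e b')

theorem exists_ore_op (g : D.Adapted N) {Y' : C} {s : Y' ⟶ Y} (hs : D.sN N s) (f : X ⟶ Y) :
    ∃ (X' : C) (t : X' ⟶ X) (f' : X' ⟶ Y'), D.defN N t ∧ Factors N (t ≫ f - f' ≫ s) := by
  obtain ⟨X', t, f', ht, h⟩ := g.op.exists_ore (sN_op.mpr hs) f.op
  exact ⟨X'.unop, t.unop, f'.unop, infN_op.mp ht, h.unop⟩

theorem exists_cancel_op (g : D.Adapted N) {Y' : C} {s : Y ⟶ Y'} (hs : D.sN N s) {f : X ⟶ Y}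
    (h : Factors N (f ≫ s)) : ∃ (X' : C) (t : X' ⟶ X), D.defN N t ∧ Factors N (t ≫ f) := by
  obtain ⟨X', t, ht, h⟩ := g.op.exists_cancel (sN_op.mpr hs) (f := f.op) h.op
  exact ⟨X'.unop, t.unop, infN_op.mp ht, h.unop⟩

/-! ### Morphisms of triangles -/

theorem exists_sN_of_push (g : D.Adapted N) {X' Y' : C} {a : X ⟶ X'} (ha : D.sN N a)
    {x : X ⟶ Y} {y : Y ⟶ Z} {δ : D.Ext Z X} (r : D.realizes x y δ)
    {x' : X' ⟶ Y'} {y' : Y' ⟶ Z} (r' : D.realizes x' y' (D.push Z a δ)) :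
    ∃ b : Y ⟶ Y', D.sN N b ∧ x ≫ b = a ≫ x' ∧ b ≫ y' = y := by
  induction ha generalizing Y Y' with
  | inf a ha =>
    obtain ⟨P, p, ⟨ω, ra⟩, hP⟩ := ha
    obtain ⟨b, q, h₁, h₂, -, h₄⟩ := g.ext.exists_pushout_inflation r ra r'
    exact ⟨b, .inf _ ⟨P, q, ⟨_, h₄⟩, hP⟩, h₁, h₂⟩
  | df a ha =>
    obtain ⟨P, p, ⟨ω, ra⟩, hP⟩ := ha
    obtain ⟨b, ω', h₁, h₂, h₃⟩ := g.ext.exists_pushout_deflation r ra r'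
    exact ⟨b, .df _ ⟨P, _, ⟨_, h₃⟩, hP⟩, h₁, h₂⟩
  | comp a a' _ _ h h' =>
    obtain ⟨V, i, p, r''⟩ := g.ext.exists_realizes (D.push Z a δ)
    rw [push_comp] at r'
    obtain ⟨b, hb, h₁, h₂⟩ := h r r''
    obtain ⟨b', hb', h₃, h₄⟩ := h' r'' r'
    exact ⟨b ≫ b', .comp _ _ hb hb', by rw [reassoc_of% h₁, h₃, Category.assoc],
      by rw [Category.assoc, h₄, h₂]⟩

theorem exists_sN_of_pull (g : D.Adapted N) {Z' Y' : C} {c : Z' ⟶ Z} (hc : D.sN N c)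
    {x : X ⟶ Y} {y : Y ⟶ Z} {δ : D.Ext Z X} (r : D.realizes x y δ)
    {x' : X ⟶ Y'} {y' : Y' ⟶ Z'} (r' : D.realizes x' y' (D.pull c X δ)) :
    ∃ b : Y' ⟶ Y, D.sN N b ∧ x' ≫ b = x ∧ b ≫ y = y' ≫ c := by
  obtain ⟨b, hb, h₁, h₂⟩ := g.op.exists_sN_of_push (sN_op.mpr hc) r r'
  exact ⟨b.unop, sN_op.mp hb, congrArg Quiver.Hom.unop h₂, congrArg Quiver.Hom.unop h₁⟩

/-- The morphism of triangles factors through a realization of `a_* δ = c^* δ'`, which separates the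
pushout along `a` from the pullback along `c`. -/
theorem exists_sN_middle (g : D.Adapted N) {X' Y' Z' : C} {a : X ⟶ X'} (ha : D.sN N a)
    {c : Z ⟶ Z'} (hc : D.sN N c) {x : X ⟶ Y} {y : Y ⟶ Z} {δ : D.Ext Z X} (r : D.realizes x y δ)
    {x' : X' ⟶ Y'} {y' : Y' ⟶ Z'} {δ' : D.Ext Z' X'} (r' : D.realizes x' y' δ')
    (h : D.push Z a δ = D.pull c X' δ') :
    ∃ b : Y ⟶ Y', D.sN N b ∧ x ≫ b = a ≫ x' ∧ b ≫ y' = y ≫ c := by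
  obtain ⟨V, i, p, r''⟩ := g.ext.exists_realizes (D.push Z a δ)
  obtain ⟨b, hb, h₁, h₂⟩ := g.exists_sN_of_push ha r r''
  obtain ⟨b', hb', h₃, h₄⟩ := g.exists_sN_of_pull hc r' (h ▸ r'')
  exact ⟨b ≫ b', .comp _ _ hb hb', by rw [reassoc_of% h₁, h₃],
    by rw [Category.assoc, h₄, reassoc_of% h₂]⟩

/-! ### Extensions that come from `N` -/

/-- `δ` is induced from an extension of objects of `N`. -/
def _root_.Extri.ExtriData.NullExt (D : ExtriData.{u, v, w} k C) (N : ObjectProperty C)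
    {Z X : C} (δ : D.Ext Z X) : Prop :=
  ∃ (M M' : C) (_ : N M) (_ : N M') (c : Z ⟶ M') (m : M ⟶ X) (η : D.Ext M' M),
    D.pull c X (D.push M' m η) = δ

theorem nullExt_op {δ : D.Ext Z X} :
    D.op.NullExt N.op (Z := Opposite.op X) (X := Opposite.op Z) δ ↔ D.NullExt N δ :=
  ⟨fun ⟨M, M', hM, hM', c, m, η, h⟩ => ⟨M'.unop, M.unop, hM', hM, m.unop, c.unop, η,
    (pull_push D _ _ _).trans h⟩,
  fun ⟨M, M', hM, hM', c, m, η, h⟩ => ⟨Opposite.op M', Opposite.op M, hM', hM, m.op, c.op, η,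
    (pull_push D _ _ _).symm.trans h⟩⟩

/-- Only one end has to come from `N`: the axiom `right`, applied to the identity of `M`, supplies
the other. -/
theorem nullExt_push (g : D.Adapted N) {M : C} (hM : N M) (m : M ⟶ X) (ε : D.Ext Z M) :
    D.NullExt N (D.push Z m ε) := by
  obtain ⟨M', hM', c, η, h⟩ := g.right ε (𝟙 M) hM
  exact ⟨M, M', hM, hM', c, m, η, by rw [pull_push, h, push_id]⟩

theorem nullExt_pull (g : D.Adapted N) {M : C} (hM : N M) (c : Z ⟶ M) (ε : D.Ext M X) :
    D.NullExt N (D.pull c X ε) :=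
  nullExt_op.mp (g.op.nullExt_push (M := Opposite.op M) hM c.op ε)

theorem _root_.Extri.ExtriData.NullExt.push {δ : D.Ext Z X} (h : D.NullExt N δ) {X' : C}
    (a : X ⟶ X') : D.NullExt N (D.push Z a δ) := by
  obtain ⟨M, M', hM, hM', c, m, η, rfl⟩ := h
  exact ⟨M, M', hM, hM', c, m ≫ a, η, by rw [push_comp, pull_push]⟩

theorem _root_.Extri.ExtriData.NullExt.pull {δ : D.Ext Z X} (h : D.NullExt N δ) {Z' : C}
    (c : Z' ⟶ Z) : D.NullExt N (D.pull c X δ) := by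
  obtain ⟨M, M', hM, hM', c', m, η, rfl⟩ := h
  exact ⟨M, M', hM, hM', c ≫ c', m, η, by rw [pull_comp]⟩

theorem _root_.Extri.ExtriData.NullExt.exists_push {δ : D.Ext Z X} (h : D.NullExt N δ) :
    ∃ (M : C) (_ : N M) (m : M ⟶ X) (ε : D.Ext Z M), D.push Z m ε = δ := by
  obtain ⟨M, M', hM, hM', c', m, η, rfl⟩ := h
  exact ⟨M, hM, m, D.pull c' M η, by rw [pull_push]⟩

theorem nullExt_zero (g : D.Adapted N) : D.NullExt N (0 : D.Ext Z X) := by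
  obtain ⟨O, hO⟩ := g.ext.exists_zero
  exact ⟨O, O, g.zero hO, g.zero hO, 0, 0, 0, by simp⟩

theorem nullExt_add (g : D.Adapted N) {δ δ' : D.Ext Z X} (h : D.NullExt N δ)
    (h' : D.NullExt N δ') : D.NullExt N (δ + δ') := by
  obtain ⟨M, hM, m, ε, rfl⟩ := h.exists_push
  obtain ⟨M', hM', m', ε', rfl⟩ := h'.exists_push
  obtain ⟨W, i₁, i₂, p₁, p₂, hW⟩ := g.ext.exists_sum M M'
  have : D.push Z m ε + D.push Z m' ε' =
      D.push Z (p₁ ≫ m + p₂ ≫ m') (D.push Z i₁ ε + D.push Z i₂ ε') := by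
    rw [map_add, ← push_comp, ← push_comp]
    simp [hW.inl_fst_assoc, hW.inl_snd_assoc, hW.inr_fst_assoc, hW.inr_snd_assoc]
  rw [this]
  exact g.nullExt_push (g.sum hW hM hM') _ _

theorem _root_.Extri.ExtriData.NullExt.neg {δ : D.Ext Z X} (h : D.NullExt N δ) :
    D.NullExt N (-δ) := by
  obtain ⟨M, M', hM, hM', c, m, η, rfl⟩ := h
  exact ⟨M, M', hM, hM', c, m, -η, by rw [map_neg, map_neg]⟩

/-- The deflation in a realization of `ε` kills `ε`. Together with the converse below, null
extensions are exactly those that become zero along a morphism in `Def_N`. -/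
theorem exists_pull_eq_zero (g : D.Adapted N) {δ : D.Ext Z X} (h : D.NullExt N δ) :
    ∃ (Z' : C) (s : Z' ⟶ Z), D.defN N s ∧ D.pull s X δ = 0 := by
  obtain ⟨M, hM, m, ε, rfl⟩ := h.exists_push
  obtain ⟨Z', i, s, r⟩ := g.ext.exists_realizes ε
  exact ⟨Z', s, ⟨M, i, ⟨_, r⟩, hM⟩, by rw [pull_push, g.ext.pull_deflation r, map_zero]⟩

theorem nullExt_of_pull_eq_zero (g : D.Adapted N) {Z' : C} {s : Z' ⟶ Z} (hs : D.defN N s)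
    {δ : D.Ext Z X} (h : D.pull s X δ = 0) : D.NullExt N δ := by
  obtain ⟨M, i, ⟨ω, r⟩, hM⟩ := hs
  obtain ⟨a, rfl⟩ := g.ext.exists_push_of_pull_eq_zero r δ h
  exact g.nullExt_push hM a ω

/-- Write `s` as the inclusion into `X ⊕ M` followed by a deflation `s'` in `Def_N`. The pullback to
the summand `M` is null anyway, so `s'^* δ` is null; a further deflation kills it, and exactness
along the composite deflation finishes. -/
theorem nullExt_of_pull (g : D.Adapted N) {Z' : C} {s : Z' ⟶ Z} (hs : D.sN N s)
    {δ : D.Ext Z X} (h : D.NullExt N (D.pull s X δ)) : D.NullExt N δ := by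
  obtain ⟨M, W, i₁, i₂, p₁, p₂, s', hW, hM, hs', rfl⟩ := g.exists_defN_of_sN hs
  have h' : D.NullExt N (D.pull s' X δ) := by
    rw [← pull_id W X (D.pull s' X δ), ← hW.total, g.ext.pull_add, pull_comp, pull_comp]
    refine g.nullExt_add (NullExt.pull ?_ _) (g.nullExt_pull hM _ _)
    rwa [← pull_comp]
  obtain ⟨Z'', s'', hs'', h''⟩ := g.exists_pull_eq_zero h'
  rw [← pull_comp] at h''
  exact g.nullExt_of_pull_eq_zero (g.defN_comp hs'' hs') h''

theorem nullExt_of_push (g : D.Adapted N) {X' : C} {s : X ⟶ X'} (hs : D.sN N s)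
    {δ : D.Ext Z X} (h : D.NullExt N (D.push Z s δ)) : D.NullExt N δ :=
  nullExt_op.mp (g.op.nullExt_of_pull (sN_op.mpr hs) (δ := δ) (nullExt_op.mpr h))

/-- An Ore condition for extensions. With `s = s₀ ≫ p₁`, the obstruction to lifting `i₁_* δ` along
`s₀` is its image in `𝔼(Z, P)` with `P` the cone. It is null, hence dies along a deflation in
`Def_N`, and exactness gives the lift. -/
theorem exists_ext_ore (g : D.Adapted N) {X' : C} {s : X ⟶ X'} (hs : D.sN N s)
    (δ : D.Ext Z X') : ∃ (Z' : C) (c : Z' ⟶ Z) (δ' : D.Ext Z' X), D.defN N c ∧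
      D.push Z' s δ' = D.pull c X' δ := by
  obtain ⟨M, W, i₁, i₂, p₁, p₂, s₀, hW, hM, ⟨P, p, ⟨ω, r⟩, hP⟩, rfl⟩ := g.exists_infN_of_sN hs
  obtain ⟨Q, hQ, c, η, hη⟩ := g.right (D.push Z i₁ δ) p hP
  obtain ⟨Z', d, hd, h₀⟩ := g.exists_pull_eq_zero (g.nullExt_pull hQ c η)
  rw [hη, pull_push] at h₀
  obtain ⟨δ', hδ'⟩ := g.ext.exists_push_preimage r _ h₀
  refine ⟨Z', d, δ', hd, ?_⟩
  rw [push_comp, hδ', pull_push, ← push_comp, hW.inl_fst, push_id]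

theorem exists_ext_ore_op (g : D.Adapted N) {Z' : C} {s : Z' ⟶ Z} (hs : D.sN N s)
    (δ : D.Ext Z' X) : ∃ (X' : C) (a : X ⟶ X') (δ' : D.Ext Z X'), D.infN N a ∧
      D.pull s X' δ' = D.push Z' a δ := by
  obtain ⟨X', a, δ', ha, h⟩ := g.op.exists_ext_ore (sN_op.mpr hs) (Z := Opposite.op X) δ
  exact ⟨X'.unop, a.unop, δ', defN_op.mp ha, h⟩

end Adapted
end ExtriData
end Extri

namespace Extri

/-! ### Calculus of fractions in ideal quotients -/

section

variable {C : Type u} [Category.{v} C] [Preadditive C]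

theorem idealRel_iff {N : ObjectProperty C} {X Y : C} {f f' : X ⟶ Y} :
    idealRel N f f' ↔ Factors N (f - f') := Iff.rfl

/-- Conditions under which the image of `S` in the ideal quotient `C/[N]` has a calculus of
fractions. -/
structure FractionsModulo (N : ObjectProperty C) (S : MorphismProperty C) : Prop where
  zero : ∀ X Y : C, Factors N (0 : X ⟶ Y)
  add : ∀ {X Y : C} {f f' : X ⟶ Y}, Factors N f → Factors N f' → Factors N (f + f')
  id : ∀ X : C, S (𝟙 X)
  comp : ∀ {X Y Z : C} {f : X ⟶ Y} {f' : Y ⟶ Z}, S f → S f' → S (f ≫ f')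
  ore : ∀ {X X' Y : C} {s : X ⟶ X'} (_ : S s) (f : X ⟶ Y),
    ∃ (Y' : C) (t : Y ⟶ Y') (f' : X' ⟶ Y'), S t ∧ Factors N (f ≫ t - s ≫ f')
  cancel : ∀ {X X' Y : C} {s : X ⟶ X'} (_ : S s) {f : X' ⟶ Y}, Factors N (s ≫ f) →
    ∃ (Y' : C) (t : Y ⟶ Y'), S t ∧ Factors N (f ≫ t)
  ore_op : ∀ {X Y Y' : C} {s : Y' ⟶ Y} (_ : S s) (f : X ⟶ Y),
    ∃ (X' : C) (t : X' ⟶ X) (f' : X' ⟶ Y'), S t ∧ Factors N (t ≫ f - f' ≫ s)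
  cancel_op : ∀ {X Y Y' : C} {s : Y ⟶ Y'} (_ : S s) {f : X ⟶ Y}, Factors N (f ≫ s) →
    ∃ (X' : C) (t : X' ⟶ X), S t ∧ Factors N (t ≫ f)

namespace FractionsModulo

variable {N : ObjectProperty C} {S : MorphismProperty C}

theorem congruence (F : FractionsModulo N S) : Congruence (idealRel N) where
  comp_left f _ _ h := by
    rw [idealRel_iff, ← Preadditive.comp_sub]
    exact Factors.precomp h f
  comp_right f h := by
    rw [idealRel_iff, ← Preadditive.sub_comp]
    exact Factors.postcomp h f
  equivalence :=
    { refl := fun f => by rw [idealRel_iff, sub_self]; exact F.zero _ _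
      symm := fun h => by rw [idealRel_iff, ← neg_sub]; exact Factors.neg h
      trans := fun h h' => by
        rw [idealRel_iff, ← sub_add_sub_cancel]
        exact F.add h h' }

theorem map_eq_iff (F : FractionsModulo N S) {X Y : C} {f f' : X ⟶ Y} :
    (toIdealQuotient N).map f = (toIdealQuotient N).map f' ↔ Factors N (f - f') :=
  have := F.congruence
  Quotient.functor_map_eq_iff _ _ _

theorem exists_map_eq {X Y : C} (f : (toIdealQuotient N).obj X ⟶ (toIdealQuotient N).obj Y) :
    ∃ f₀ : X ⟶ Y, (toIdealQuotient N).map f₀ = f := (toIdealQuotient N).map_surjective f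

theorem idealRel_add (F : FractionsModulo N S) ⦃X Y : C⦄ (f₁ f₂ g₁ g₂ : X ⟶ Y)
    (h : idealRel N f₁ f₂) (h' : idealRel N g₁ g₂) : idealRel N (f₁ + g₁) (f₂ + g₂) := by
  rw [idealRel_iff, add_sub_add_comm]
  exact F.add h h'

theorem _root_.Extri.idealRel_smul {k : Type t} [CommRing k] [Linear k C] (a : k) ⦃X Y : C⦄
    (f₁ f₂ : X ⟶ Y) (h : idealRel N f₁ f₂) : idealRel N (a • f₁) (a • f₂) := by
  obtain ⟨M, hM, i, j, hij⟩ := h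
  exact ⟨M, hM, a • i, j, by rw [Linear.smul_comp, hij, smul_sub]⟩

theorem isMultiplicative (F : FractionsModulo N S) {S' : MorphismProperty (IdealQuotient N)}
    (hS : ∀ {X Y : C} (f : X ⟶ Y), S' ((toIdealQuotient N).map f) ↔ S f) :
    S'.IsMultiplicative where
  id_mem := by
    rintro ⟨X⟩
    exact (hS (𝟙 X)).mpr (F.id X)
  comp_mem := by
    rintro ⟨X⟩ ⟨Y⟩ ⟨Z⟩ f f' hf hf'
    obtain ⟨f, rfl⟩ := exists_map_eq f
    obtain ⟨f', rfl⟩ := exists_map_eq f'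
    rw [← Functor.map_comp]
    exact (hS _).mpr (F.comp ((hS _).mp hf) ((hS _).mp hf'))

theorem hasLeftCalculusOfFractions (F : FractionsModulo N S)
    {S' : MorphismProperty (IdealQuotient N)}
    (hS : ∀ {X Y : C} (f : X ⟶ Y), S' ((toIdealQuotient N).map f) ↔ S f) :
    S'.HasLeftCalculusOfFractions where
  toIsMultiplicative := F.isMultiplicative hS
  exists_leftFraction := by
    rintro ⟨X⟩ ⟨Y⟩ φ
    obtain @⟨⟨Z⟩, s, hs, f⟩ := φ
    obtain ⟨f, rfl⟩ := exists_map_eq f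
    obtain ⟨s, rfl⟩ := exists_map_eq s
    obtain ⟨Y', t, f', ht, h⟩ := F.ore ((hS _).mp hs) f
    refine ⟨⟨(toIdealQuotient N).map f', (toIdealQuotient N).map t, (hS _).mpr ht⟩, ?_⟩
    exact F.map_eq_iff.mpr h
  ext := by
    rintro ⟨X⟩ ⟨X'⟩ ⟨Y⟩ f f' s hs h
    obtain ⟨f, rfl⟩ := exists_map_eq f
    obtain ⟨f', rfl⟩ := exists_map_eq f'
    obtain ⟨s, rfl⟩ := exists_map_eq s
    rw [← Functor.map_comp, ← Functor.map_comp, F.map_eq_iff, ← Preadditive.comp_sub] at h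
    obtain ⟨Y', t, ht, h⟩ := F.cancel ((hS _).mp hs) h
    refine ⟨(toIdealQuotient N).obj Y', (toIdealQuotient N).map t, (hS _).mpr ht, ?_⟩
    rwa [← Functor.map_comp, ← Functor.map_comp, F.map_eq_iff, ← Preadditive.sub_comp]

theorem hasRightCalculusOfFractions (F : FractionsModulo N S)
    {S' : MorphismProperty (IdealQuotient N)}
    (hS : ∀ {X Y : C} (f : X ⟶ Y), S' ((toIdealQuotient N).map f) ↔ S f) :
    S'.HasRightCalculusOfFractions where
  toIsMultiplicative := F.isMultiplicative hS
  exists_rightFraction := by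
    rintro ⟨X⟩ ⟨Y⟩ φ
    obtain @⟨⟨Z⟩, f, s, hs⟩ := φ
    obtain ⟨f, rfl⟩ := exists_map_eq f
    obtain ⟨s, rfl⟩ := exists_map_eq s
    obtain ⟨Y', t, f', ht, h⟩ := F.ore_op ((hS _).mp hs) f
    refine ⟨⟨(toIdealQuotient N).map t, (hS _).mpr ht, (toIdealQuotient N).map f'⟩, ?_⟩
    exact F.map_eq_iff.mpr h
  ext := by
    rintro ⟨X⟩ ⟨X'⟩ ⟨Y⟩ f f' s hs h
    obtain ⟨f, rfl⟩ := exists_map_eq f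
    obtain ⟨f', rfl⟩ := exists_map_eq f'
    obtain ⟨s, rfl⟩ := exists_map_eq s
    rw [← Functor.map_comp, ← Functor.map_comp, F.map_eq_iff, ← Preadditive.sub_comp] at h
    obtain ⟨Y', t, ht, h⟩ := F.cancel_op ((hS _).mp hs) h
    refine ⟨(toIdealQuotient N).obj Y', (toIdealQuotient N).map t, (hS _).mpr ht, ?_⟩
    rwa [← Functor.map_comp, ← Functor.map_comp, F.map_eq_iff, ← Preadditive.comp_sub]

end FractionsModulo

end

/-! ### Admissibility of adapted pairs. -/

namespace ExtriData
namespace Adapted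

variable {k : Type t} [CommRing k] {C : Type u} [Category.{v} C] [Preadditive C] [Linear k C]
  {D : ExtriData.{u, v, w} k C} {N : ObjectProperty C} {X Y Z : C}

theorem fractionsModulo (g : D.Adapted N) : FractionsModulo N (D.sN N) where
  zero _ _ := g.factors_zero
  add := g.factors_add
  id X := g.sN_of_isIso (𝟙 X)
  comp h h' := sN.comp _ _ h h'
  ore hs f := by
    obtain ⟨Y', t, f', ht, h⟩ := g.exists_ore hs f
    exact ⟨Y', t, f', .inf _ ht, h⟩
  cancel hs _ h := by
    obtain ⟨Y', t, ht, h⟩ := g.exists_cancel hs h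
    exact ⟨Y', t, .inf _ ht, h⟩
  ore_op hs f := by
    obtain ⟨Y', t, f', ht, h⟩ := g.exists_ore_op hs f
    exact ⟨Y', t, f', .df _ ht, h⟩
  cancel_op hs _ h := by
    obtain ⟨Y', t, ht, h⟩ := g.exists_cancel_op hs h
    exact ⟨Y', t, .df _ ht, h⟩

theorem fractionsModulo' (g : D.Adapted N) : FractionsModulo (nullObjects (D.sN N)) (D.sN N) := by
  rw [g.nullObjects_sN]
  exact g.fractionsModulo

theorem toBar_map_eq_iff (g : D.Adapted N) {f f' : X ⟶ Y} :
    (toBar (D.sN N)).map f = (toBar (D.sN N)).map f' ↔ Factors N (f - f') := by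
  rw [g.fractionsModulo'.map_eq_iff, g.nullObjects_sN]

theorem sN_of_isIso_toBar (g : D.Adapted N) (f : X ⟶ Y) (hf : IsIso ((toBar (D.sN N)).map f)) :
    D.sN N f := by
  obtain ⟨f', hf'⟩ := (toBar (D.sN N)).map_surjective (inv ((toBar (D.sN N)).map f))
  refine g.sN_of_factors_sub_id (f' := f') ?_ ?_ <;>
  · rw [← g.toBar_map_eq_iff, Functor.map_comp, hf']
    simp

/-- Closing up under isomorphisms of the quotient adds nothing: these isomorphisms lift to `S_N`,
and a lifted composite differs from `f` by a map through `N`. -/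
theorem barS_map_iff (g : D.Adapted N) (f : X ⟶ Y) :
    barS (D.sN N) ((toBar (D.sN N)).map f) ↔ D.sN N f := by
  refine ⟨?_, MorphismProperty.map_mem_map _ _ f⟩
  rintro ⟨X', Y', f', hf', ⟨e⟩⟩
  obtain ⟨a, ha⟩ := (toBar (D.sN N)).map_surjective e.inv.left
  obtain ⟨b, hb⟩ := (toBar (D.sN N)).map_surjective e.hom.right
  have ha' := g.sN_of_isIso_toBar a (by rw [ha]; infer_instance)
  have hb' := g.sN_of_isIso_toBar b (by rw [hb]; infer_instance)
  refine g.sN_of_factors_sub (.comp _ _ (.comp _ _ ha' hf') hb') ?_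
  rw [← g.toBar_map_eq_iff]
  have h₁ := e.hom.w
  have h₂ : e.inv.left ≫ e.hom.left = 𝟙 _ := by
    rw [← Arrow.comp_left, e.inv_hom_id]; rfl
  simp only [Functor.map_comp, ha, hb, Category.assoc]
  simp only [Arrow.mk_hom, Arrow.mk_left, Arrow.mk_right] at h₁ h₂ ⊢
  erw [← h₁, ← Category.assoc, h₂, Category.id_comp]

theorem hasLeftCalculusOfFractions (g : D.Adapted N) :
    (barS (D.sN N)).HasLeftCalculusOfFractions :=
  g.fractionsModulo'.hasLeftCalculusOfFractions g.barS_map_iff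

theorem hasRightCalculusOfFractions (g : D.Adapted N) :
    (barS (D.sN N)).HasRightCalculusOfFractions :=
  g.fractionsModulo'.hasRightCalculusOfFractions g.barS_map_iff

/-- The two inner denominators `v` and `u'` combine to the image of one `s` in `S_N`, so stability
only requires moving the denominator of `x ≫ s ≫ x'` to the ends. -/
theorem barM_comp (g : D.Adapted N) (W : MorphismProperty C)
    (hW : ∀ {A B A' B' : C} {x : A ⟶ B} {s : B ⟶ A'} {x' : A' ⟶ B'}, W x → D.sN N s → W x' →
      ∃ (P R : C) (a : A ⟶ P) (z : P ⟶ R) (b : R ⟶ B'), D.sN N a ∧ W z ∧ D.sN N b ∧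
        a ≫ z ≫ b = x ≫ s ≫ x') :
    (barM (D.sN N) W).IsStableUnderComposition where
  comp_mem := by
    rintro ⟨X⟩ ⟨Y⟩ ⟨Z⟩ _ _ ⟨A, B, u, x, v, hu, hx, hv, rfl⟩ ⟨A', B', u', x', v', hu', hx', hv', rfl⟩
    have := g.hasLeftCalculusOfFractions
    obtain ⟨s, hs⟩ := (toBar (D.sN N)).map_surjective (v ≫ u')
    have h : barS (D.sN N) ((toBar (D.sN N)).map s) := hs ▸ MorphismProperty.comp_mem _ _ _ hv hu'
    obtain ⟨P, R, a, z, b, ha, hz, hb, e⟩ := hW hx ((g.barS_map_iff s).mp h) hx'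
    refine ⟨P, R, u ≫ (toBar (D.sN N)).map a, z, (toBar (D.sN N)).map b ≫ v',
      MorphismProperty.comp_mem _ _ _ hu ((g.barS_map_iff a).mpr ha), hz,
      MorphismProperty.comp_mem _ _ _ ((g.barS_map_iff b).mpr hb) hv', ?_⟩
    have e' := congrArg (toBar (D.sN N)).map e
    simp only [Functor.map_comp, hs] at e'
    simp only [Category.assoc]
    rw [← Category.assoc ((toBar (D.sN N)).map z), ← Category.assoc ((toBar (D.sN N)).map a), e']
    simp only [Category.assoc]

theorem isInflation_comp (g : D.Adapted N) {f : X ⟶ Y} {f' : Y ⟶ Z} (h : D.IsInflation f)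
    (h' : D.IsInflation f') : D.IsInflation (f ≫ f') := by
  obtain ⟨A, y, δ, r⟩ := h
  obtain ⟨B, z, ρ, r'⟩ := h'
  obtain ⟨G, h', d, e, δ', h₁, -⟩ := g.ext.et4 r r'
  exact ⟨G, h', δ', h₁⟩

theorem isDeflation_comp (g : D.Adapted N) {f : X ⟶ Y} {f' : Y ⟶ Z} (h : D.IsDeflation f)
    (h' : D.IsDeflation f') : D.IsDeflation (f ≫ f') := by
  obtain ⟨A, y, δ, r⟩ := h
  obtain ⟨B, z, ρ, r'⟩ := h'
  obtain ⟨G, h', d, e, δ', h₁, -⟩ := g.ext.et4_op r r'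
  exact ⟨G, h', δ', h₁⟩

theorem isInflation_directSum_id (g : D.Adapted N) {f : X ⟶ Y} (hf : D.IsInflation f) {V A B : C}
    {i₁ : X ⟶ A} {i₂ : V ⟶ A} {p₁ : A ⟶ X} {p₂ : A ⟶ V} (hA : IsDirectSum i₁ i₂ p₁ p₂)
    {j₁ : Y ⟶ B} {j₂ : V ⟶ B} {q₁ : B ⟶ Y} {q₂ : B ⟶ V} (hB : IsDirectSum j₁ j₂ q₁ q₂) :
    D.IsInflation (p₁ ≫ f ≫ j₁ + p₂ ≫ j₂) := by
  obtain ⟨P, y, δ, r⟩ := hf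
  obtain ⟨O, hO⟩ := g.ext.exists_zero
  have := g.ext.realizes_directSum r (g.ext.realizes_right_zero V hO) hA hB
    (IsDirectSum.right_zero P hO)
  exact ⟨P, _, _, by simpa using this⟩

theorem isDeflation_directSum_id (g : D.Adapted N) {f : X ⟶ Y} (hf : D.IsDeflation f) {V A B : C}
    {i₁ : X ⟶ A} {i₂ : V ⟶ A} {p₁ : A ⟶ X} {p₂ : A ⟶ V} (hA : IsDirectSum i₁ i₂ p₁ p₂)
    {j₁ : Y ⟶ B} {j₂ : V ⟶ B} {q₁ : B ⟶ Y} {q₂ : B ⟶ V} (hB : IsDirectSum j₁ j₂ q₁ q₂) :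
    D.IsDeflation (p₁ ≫ f ≫ j₁ + p₂ ≫ j₂) := by
  obtain ⟨P, y, δ, r⟩ := hf
  obtain ⟨O, hO⟩ := g.ext.exists_zero
  have := g.ext.realizes_directSum r (g.ext.realizes_left_zero V hO)
    (IsDirectSum.right_zero P hO) hA hB
  exact ⟨P, _, _, by simpa using this⟩

theorem isInflation_of_infN {f : X ⟶ Y} (h : D.infN N f) : D.IsInflation f := by
  obtain ⟨Z, y, h, -⟩ := h
  exact ⟨Z, y, h⟩

theorem isDeflation_of_defN {f : X ⟶ Y} (h : D.defN N f) : D.IsDeflation f := by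
  obtain ⟨Z, y, h, -⟩ := h
  exact ⟨Z, y, h⟩

theorem mr (g : D.Adapted N) : MR D (D.sN N) where
  mr1 :=
    have := g.hasLeftCalculusOfFractions
    { toIsStableUnderComposition := inferInstance
      of_postcomp := by
        rintro ⟨X⟩ ⟨Y⟩ ⟨Z⟩ f f' hf' h
        obtain ⟨f, rfl⟩ := (toBar (D.sN N)).map_surjective f
        obtain ⟨f', rfl⟩ := (toBar (D.sN N)).map_surjective f'
        rw [← Functor.map_comp] at h
        exact (g.barS_map_iff f).mpr
          (g.sN_of_postcomp ((g.barS_map_iff f').mp hf') ((g.barS_map_iff _).mp h))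
      of_precomp := by
        rintro ⟨X⟩ ⟨Y⟩ ⟨Z⟩ f f' hf h
        obtain ⟨f, rfl⟩ := (toBar (D.sN N)).map_surjective f
        obtain ⟨f', rfl⟩ := (toBar (D.sN N)).map_surjective f'
        rw [← Functor.map_comp] at h
        exact (g.barS_map_iff f').mpr
          (g.sN_of_precomp ((g.barS_map_iff f).mp hf) ((g.barS_map_iff _).mp h)) }
  mr2_left := g.hasLeftCalculusOfFractions
  mr2_right := g.hasRightCalculusOfFractions
  mr3 r r' a c h ha hc := by
    obtain ⟨b, hb, h₁, h₂⟩ := g.exists_sN_middle ((g.barS_map_iff a).mp ha)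
      ((g.barS_map_iff c).mp hc) r r' h
    refine ⟨(toBar (D.sN N)).map b, (g.barS_map_iff b).mpr hb, ?_, ?_⟩
    · rw [← Functor.map_comp, h₁, Functor.map_comp]
    · rw [← Functor.map_comp, ← h₂, Functor.map_comp]
  mr4_inf := g.barM_comp _ fun {A B A' B' x s x'} hx hs hx' => by
    -- The inflation part of `s` is absorbed into the composite of inflations, and the projection is
    -- moved past `x'`, replaced by `x' ⊕ 1_M`, to the right end.
    obtain ⟨M, V, i₁, i₂, p₁, p₂, s, hV, hM, hs₀, rfl⟩ := g.exists_infN_of_sN hs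
    obtain ⟨W, j₁, j₂, q₁, q₂, hW⟩ := g.ext.exists_sum B' M
    refine ⟨A, W, 𝟙 A, _, q₁, g.sN_of_isIso _, g.isInflation_comp hx (g.isInflation_comp
      (isInflation_of_infN hs₀) (g.isInflation_directSum_id hx' hV hW)), g.sN_fst hW hM, ?_⟩
    simp [hW.inl_fst, hW.inr_fst]
  mr4_def := g.barM_comp _ fun {A B A' B' x s x'} hx hs hx' => by
    obtain ⟨M, V, i₁, i₂, p₁, p₂, s, hV, hM, hs₀, rfl⟩ := g.exists_defN_of_sN hs
    obtain ⟨W, j₁, j₂, q₁, q₂, hW⟩ := g.ext.exists_sum A M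
    refine ⟨W, B', j₁, _, 𝟙 B', g.sN_inl hW hM, g.isDeflation_comp
      (g.isDeflation_directSum_id hx hW hV) (g.isDeflation_comp
      (isDeflation_of_defN hs₀) hx'), g.sN_of_isIso _, ?_⟩
    simp [hW.inl_fst_assoc, hW.inl_snd_assoc]

theorem isAdmissible (g : D.Adapted N) : IsAdmissible D N where
  thick := g.isThick
  m0 :=
    { iso := fun f _ => g.sN_of_isIso f
      comp := sN.comp
      sum := fun {X Y X' Y' _ _} f f' hf hf' => by
        obtain ⟨W, i₁, i₂, p₁, p₂, hW⟩ := g.ext.exists_sum Y X'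
        -- `f ⊕ f'` is `f ⊕ 1` followed by `1 ⊕ f'`.
        convert sN.comp _ _ (g.sN_directSum_id hf (IsDirectSum.biprod X X') hW)
          (g.sN_directSum_id hf' hW.swap (IsDirectSum.biprod Y Y').swap) using 1
        have := g.ext.hasBinaryBiproducts
        rw [biprod.map_eq, add_comm]
        simp [hW.inl_fst_assoc, hW.inl_snd_assoc, hW.inr_fst_assoc, hW.inr_snd_assoc] }
  mr := g.mr
  barS_eq := by
    refine le_antisymm ?_ fun X Y f ⟨hf⟩ => MorphismProperty.map_mem_map _ _ _ hf
    rintro ⟨X⟩ ⟨Y⟩ f hf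
    obtain ⟨f, rfl⟩ := (toBar (D.sN N)).map_surjective f
    exact ⟨(g.barS_map_iff f).mp hf⟩

theorem sN_eq_compClass (g : D.Adapted N) :
    D.sN N = compClass (D.defNsp N) (D.infN N) := by
  ext X Y f
  constructor
  · intro h
    obtain ⟨M, W, i₁, i₂, p₁, p₂, s, hW, hM, hs, hf⟩ := g.exists_infN_of_sN h
    exact ⟨W, s, p₁, hs, ⟨g.defN_fst hW hM, ⟨i₁, hW.inl_fst⟩⟩, hf⟩
  · rintro ⟨W, i, p, hi, hp, rfl⟩
    exact .comp _ _ (.inf _ hi) (.df _ hp.1)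

theorem sN_eq_compClass' (g : D.Adapted N) :
    D.sN N = compClass (D.defN N) (D.infNsp N) := by
  ext X Y f
  constructor
  · intro h
    obtain ⟨M, W, i₁, i₂, p₁, p₂, s, hW, hM, hs, hf⟩ := g.exists_defN_of_sN h
    exact ⟨W, i₁, s, ⟨g.infN_inl hW hM, ⟨p₁, hW.inl_fst⟩⟩, hs, hf⟩
  · rintro ⟨W, i, p, hi, hp, rfl⟩
    exact .comp _ _ (.inf _ hi.1) (.df _ hp)

end Adapted
end ExtriData
end Extri

/-! ### Functors inverting `S_N` by fractions, their kernel, and saturation. -/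

namespace Extri
namespace ExtriData

variable {k : Type t} [CommRing k] {C : Type u} [Category.{v} C] [Preadditive C] [Linear k C]
  {L : Type u₁} [Category.{v₁} L] [Preadditive L]

/-- The functor `Q` inverts `S_N`, and the morphisms between objects in its image are described by
left and right fractions with denominators in `Inf_N` and `Def_N`. -/
structure InvertsByFractions (D : ExtriData.{u, v, w} k C) (N : ObjectProperty C) (Q : C ⥤ L) :
    Prop where
  additive : Q.Additive
  essSurj : ∀ X : L, ∃ X₀ : C, Nonempty (Q.obj X₀ ≅ X)
  inverts : ∀ {X Y : C} (s : X ⟶ Y), D.sN N s → IsIso (Q.map s)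
  fracL : ∀ {X Y : C} (f : Q.obj X ⟶ Q.obj Y), ∃ (Y' : C) (a : X ⟶ Y') (s : Y ⟶ Y'),
    D.infN N s ∧ f ≫ Q.map s = Q.map a
  fracR : ∀ {X Y : C} (f : Q.obj X ⟶ Q.obj Y), ∃ (X' : C) (s : X' ⟶ X) (a : X' ⟶ Y),
    D.defN N s ∧ Q.map s ≫ f = Q.map a
  eqL : ∀ {X Y : C} {f f' : X ⟶ Y}, Q.map f = Q.map f' → ∃ (Y' : C) (s : Y ⟶ Y'),
    D.infN N s ∧ Factors N ((f - f') ≫ s)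
  eqR : ∀ {X Y : C} {f f' : X ⟶ Y}, Q.map f = Q.map f' → ∃ (X' : C) (s : X' ⟶ X),
    D.defN N s ∧ Factors N (s ≫ (f - f'))

namespace InvertsByFractions

variable {D : ExtriData.{u, v, w} k C} {N : ObjectProperty C} {Q : C ⥤ L} {X Y Z : C}

theorem op (q : D.InvertsByFractions N Q) : D.op.InvertsByFractions N.op Q.op where
  additive :=
    have := q.additive
    inferInstance
  essSurj X := by
    obtain ⟨X₀, ⟨e⟩⟩ := q.essSurj X.unop
    exact ⟨Opposite.op X₀, ⟨e.symm.op⟩⟩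
  inverts s hs := by
    have := q.inverts s.unop (sN_op.mp hs)
    exact isIso_op (Q.map s.unop)
  fracL f := by
    obtain ⟨X', s, a, hs, h⟩ := q.fracR f.unop
    exact ⟨Opposite.op X', a.op, s.op, infN_op.mpr hs, Quiver.Hom.unop_inj h⟩
  fracR f := by
    obtain ⟨X', a, s, hs, h⟩ := q.fracL f.unop
    exact ⟨Opposite.op X', s.op, a.op, defN_op.mpr hs, Quiver.Hom.unop_inj h⟩
  eqL h := by
    obtain ⟨X', s, hs, h⟩ := q.eqR (congrArg Quiver.Hom.unop h)
    exact ⟨Opposite.op X', s.op, infN_op.mpr hs, h.op⟩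
  eqR h := by
    obtain ⟨X', s, hs, h⟩ := q.eqL (congrArg Quiver.Hom.unop h)
    exact ⟨Opposite.op X', s.op, defN_op.mpr hs, h.op⟩

theorem isZero_obj (g : D.Adapted N) (q : D.InvertsByFractions N Q) (hX : N X) :
    IsZero (Q.obj X) := by
  have := q.additive
  obtain ⟨O, hO⟩ := g.ext.exists_zero
  have := q.inverts (0 : O ⟶ X) (g.sN_inl (IsDirectSum.left_zero X hO) hX)
  exact (Q.map_isZero hO).of_iso (asIso (Q.map (0 : O ⟶ X))).symm

theorem map_eq_zero (g : D.Adapted N) (q : D.InvertsByFractions N Q) {f : X ⟶ Y}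
    (h : Factors N f) : Q.map f = 0 := by
  obtain ⟨M, hM, i, j, rfl⟩ := h
  rw [Q.map_comp, (q.isZero_obj g hM).eq_of_tgt (Q.map i) 0, zero_comp]

/-- The identity and zero agree after `Q`, so some `t` in `Inf_N` factors through `N`, and therefore
the zero map `X ⟶ X'` lies in `S_N`. Its normal form `X ⟶ X' ⊕ M` has cone `P` in `N`, and the
projection to `X'` vanishes on `X`, hence factors through `P`. So `X'` is in `N`, and then so is the
cocone `X`. -/
theorem mem_of_isZero (g : D.Adapted N) (q : D.InvertsByFractions N Q) (h : IsZero (Q.obj X)) :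
    N X := by
  obtain ⟨X', t, ht, hF⟩ := q.eqL (f := 𝟙 X) (f' := 0) (h.eq_of_src _ _)
  simp only [sub_zero, Category.id_comp] at hF
  have h₀ : D.sN N (0 : X ⟶ X') := g.sN_of_factors_sub (.inf _ ht) (by simpa using hF.neg)
  obtain ⟨M, W, i₁, i₂, p₁, p₂, s, hW, hM, ⟨P, p, ⟨ω, r⟩, hP⟩, hs⟩ := g.exists_infN_of_sN h₀
  obtain ⟨u, hu⟩ := g.ext.exists_desc r p₁ hs
  have hX' : N X' := g.mem_of_factors_id ⟨P, hP, i₁ ≫ p, u, by rw [Category.assoc, hu, hW.inl_fst]⟩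
  exact g.mem_cocone r (g.sum hW hX' hM) hP

/-- The homotopy pushout `V` of `f ≫ f'` and `f` maps back to `Z`, which gives `f' = z ≫ ρ` with `z`
in `Inf_N` and `ρ` a retraction. As `Q` inverts `ρ`, it kills the complement of `Z` in `V`; this
complement is then in `N`, and `ρ` is a projection in `Def_N`. -/
theorem sN_of_infN_of_isIso (g : D.Adapted N) (q : D.InvertsByFractions N Q) {f : X ⟶ Y}
    {f' : Y ⟶ Z} (h : D.infN N (f ≫ f')) (h' : IsIso (Q.map f')) : D.sN N f' := by
  have := q.additive
  obtain ⟨P, p, ⟨ω, r⟩, hP⟩ := h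
  obtain ⟨V, z, p', r'⟩ := g.ext.exists_realizes (D.push P f ω)
  obtain ⟨W, i₁, i₂, p₁, p₂, hW⟩ := g.ext.exists_sum Z Y
  obtain ⟨b, hb₁, hb₂, r''⟩ := g.ext.exists_pushout r f r' hW
  obtain ⟨ρ, hρ⟩ := g.ext.exists_desc r'' (p₁ - p₂ ≫ f') (by
    simp [hW.inl_fst, hW.inr_fst, hW.inl_snd_assoc, hW.inr_snd_assoc])
  have h₁ : b ≫ ρ = 𝟙 Z := by
    simpa [hW.inl_fst_assoc, hW.inl_snd_assoc, hW.inl_fst] using i₁ ≫= hρ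
  have h₂ : z ≫ ρ = f' := by
    simpa [hW.inr_fst_assoc, hW.inr_snd_assoc, hW.inr_fst] using i₂ ≫= hρ
  have hz : D.sN N z := .inf _ ⟨P, p', ⟨_, r'⟩, hP⟩
  have := q.inverts z hz
  have : IsIso (Q.map z ≫ Q.map ρ) := by rwa [← Q.map_comp, h₂]
  have : IsIso (Q.map ρ) := IsIso.of_isIso_comp_left (Q.map z) _
  obtain ⟨K, j, q', hK⟩ := g.split b ρ h₁
  have hKN : N K := q.mem_of_isZero g (hK.map Q).isZero_right_of_isIso
  rw [← h₂]
  exact .comp _ _ hz (g.sN_fst hK hKN)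

/-- `S_N` is saturated. -/
theorem sN_of_isIso_map (g : D.Adapted N) (q : D.InvertsByFractions N Q) {f : X ⟶ Y}
    (h : IsIso (Q.map f)) : D.sN N f := by
  obtain ⟨X', a, s, hs, ha⟩ := q.fracL (inv (Q.map f))
  have ha' : Q.map (f ≫ a) = Q.map s := by rw [Q.map_comp, ← ha, IsIso.hom_inv_id_assoc]
  obtain ⟨X'', t, ht, hF⟩ := q.eqL ha'
  have h₁ : D.sN N (f ≫ a ≫ t) :=
    g.sN_of_factors_sub (.inf _ (g.infN_comp hs ht)) (by simpa using hF)
  obtain ⟨M, W, i₁, i₂, p₁, p₂, u, hW, hM, hu, hup⟩ := g.exists_infN_of_sN h₁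
  -- Adding the `M`-component of `u` to `f` turns `u` itself into a composite `X ⟶ Y ⊕ M ⟶ W`, both
  -- factors being inverted by `Q`. The preceding lemma puts the second factor in `S_N`, and
  -- two-out-of-three the first.
  obtain ⟨V, j₁, j₂, q₁, q₂, hV⟩ := g.ext.exists_sum Y M
  have e : (f ≫ j₁ + (u ≫ p₂) ≫ j₂) ≫ (q₁ ≫ (a ≫ t) ≫ i₁ + q₂ ≫ i₂) = u := by
    have := u ≫= hW.total
    simp only [Preadditive.comp_add, reassoc_of% hup, Category.comp_id] at this
    simpa [hV.inl_fst_assoc, hV.inl_snd_assoc, hV.inr_fst_assoc, hV.inr_snd_assoc] using this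
  have e' : (f ≫ j₁ + (u ≫ p₂) ≫ j₂) ≫ q₁ = f := by simp [hV.inl_fst, hV.inr_fst]
  have hj := q.inverts q₁ (g.sN_fst hV hM)
  have h₂ : IsIso (Q.map (f ≫ j₁ + (u ≫ p₂) ≫ j₂)) := by
    have : IsIso (Q.map (f ≫ j₁ + (u ≫ p₂) ≫ j₂) ≫ Q.map q₁) := by rwa [← Q.map_comp, e']
    exact IsIso.of_isIso_comp_right _ (Q.map q₁)
  have h₃ : IsIso (Q.map (q₁ ≫ (a ≫ t) ≫ i₁ + q₂ ≫ i₂)) := by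
    have := q.inverts u (.inf _ hu)
    have : IsIso (Q.map (f ≫ j₁ + (u ≫ p₂) ≫ j₂) ≫ Q.map (q₁ ≫ (a ≫ t) ≫ i₁ + q₂ ≫ i₂)) := by
      rwa [← Q.map_comp, e]
    exact IsIso.of_isIso_comp_left (Q.map (f ≫ j₁ + (u ≫ p₂) ≫ j₂)) _
  have h₄ := q.sN_of_infN_of_isIso g (f := f ≫ j₁ + (u ≫ p₂) ≫ j₂) (e.symm ▸ hu) h₃
  have h₅ : D.sN N (f ≫ j₁ + (u ≫ p₂) ≫ j₂) :=
    g.sN_of_postcomp h₄ (by rw [e]; exact .inf _ hu)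
  rw [← e']
  exact .comp _ _ h₅ (g.sN_fst hV hM)

end InvertsByFractions
end ExtriData
end Extri

/-! ### The axioms of an extriangulated category for the localization. -/

namespace Extri

theorem IsDirectSum.exists_iso_of_isos {C : Type u} [Category.{v} C] [Preadditive C]
    {X Y W X' Y' W' : C} {i₁ : X ⟶ W} {i₂ : Y ⟶ W} {p₁ : W ⟶ X} {p₂ : W ⟶ Y}
    {i₁' : X' ⟶ W'} {i₂' : Y' ⟶ W'} {p₁' : W' ⟶ X'} {p₂' : W' ⟶ Y'}
    (h : IsDirectSum i₁ i₂ p₁ p₂) (h' : IsDirectSum i₁' i₂' p₁' p₂') (a : X ≅ X') (c : Y ≅ Y') :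
    ∃ e : W ≅ W', e.hom = p₁ ≫ a.hom ≫ i₁' + p₂ ≫ c.hom ≫ i₂' := by
  obtain ⟨e, he, -⟩ := h.exists_iso (i₁' := a.hom ≫ i₁') (i₂' := c.hom ≫ i₂')
    (p₁' := p₁' ≫ a.inv) (p₂' := p₂' ≫ c.inv)
    ⟨by simp [h'.inl_fst_assoc], by simp [h'.inr_snd_assoc], by simp [h'.inl_snd_assoc],
      by simp [h'.inr_fst_assoc], by simp [h'.total]⟩
  exact ⟨e, he⟩

theorem IsDirectSum.hasBinaryBiproduct {C : Type u} [Category.{v} C] [Preadditive C]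
    {X Y W : C} {i₁ : X ⟶ W} {i₂ : Y ⟶ W} {p₁ : W ⟶ X} {p₂ : W ⟶ Y}
    (h : IsDirectSum i₁ i₂ p₁ p₂) : HasBinaryBiproduct X Y :=
  hasBinaryBiproduct_of_total
    { pt := W, fst := p₁, snd := p₂, inl := i₁, inr := i₂, inl_fst := h.inl_fst,
      inl_snd := h.inl_snd, inr_fst := h.inr_fst, inr_snd := h.inr_snd } h.total

theorem square_inv {C : Type u} [Category.{v} C] {A B A' B' : C} {f : A ⟶ A'} {f' : B ⟶ B'}
    {e : A ≅ B} {e' : A' ≅ B'}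
    (h : f ≫ e'.hom = e.hom ≫ f') : f' ≫ e'.inv = e.inv ≫ f := by
  rw [Iso.comp_inv_eq, Category.assoc, h, Iso.inv_hom_id_assoc]

namespace ExtriData

variable {k : Type t} [CommRing k] {C : Type u} [Category.{v} C] [Preadditive C] [Linear k C]
  {L : Type u₁} [Category.{v₁} L] [Preadditive L] [Linear k L]

/-- The data `(L, 𝔼', 𝔰')` is the localization of `(C, 𝔼, 𝔰)` at `S_N`: extensions between objects
in the image of `Q` are described by fractions as well, and the triangles are the sequences
isomorphic to the image of a triangle. -/
structure Localizes (D : ExtriData.{u, v, w} k C) (N : ObjectProperty C)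
    (D' : ExtriData.{u₁, v₁, w₁} k L) (Q : C ⥤ L)
    (μ : ∀ Z X : C, D.Ext Z X →ₗ[k] D'.Ext (Q.obj Z) (Q.obj X)) : Prop
    extends D.InvertsByFractions N Q where
  push_add : ∀ (Z : L) {X X' : L} (a a' : X ⟶ X') (δ : D'.Ext Z X),
    D'.push Z (a + a') δ = D'.push Z a δ + D'.push Z a' δ
  push_smul : ∀ (Z : L) {X X' : L} (r : k) (a : X ⟶ X') (δ : D'.Ext Z X),
    D'.push Z (r • a) δ = r • D'.push Z a δ
  pull_add : ∀ {Z' Z : L} (c c' : Z' ⟶ Z) (X : L) (δ : D'.Ext Z X),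
    D'.pull (c + c') X δ = D'.pull c X δ + D'.pull c' X δ
  pull_smul : ∀ {Z' Z : L} (r : k) (c : Z' ⟶ Z) (X : L) (δ : D'.Ext Z X),
    D'.pull (r • c) X δ = r • D'.pull c X δ
  map_push : ∀ (Z : C) {X X' : C} (a : X ⟶ X') (δ : D.Ext Z X),
    μ Z X' (D.push Z a δ) = D'.push _ (Q.map a) (μ Z X δ)
  map_pull : ∀ {Z' Z : C} (c : Z' ⟶ Z) (X : C) (δ : D.Ext Z X),
    μ Z' X (D.pull c X δ) = D'.pull (Q.map c) _ (μ Z X δ)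
  fracExt : ∀ {Z X : C} (ε : D'.Ext (Q.obj Z) (Q.obj X)), ∃ (Z' : C) (s : Z' ⟶ Z)
    (δ : D.Ext Z' X), D.defN N s ∧ D'.pull (Q.map s) _ ε = μ Z' X δ
  fracExt_op : ∀ {Z X : C} (ε : D'.Ext (Q.obj Z) (Q.obj X)), ∃ (X' : C) (s : X ⟶ X')
    (δ : D.Ext Z X'), D.infN N s ∧ D'.push _ (Q.map s) ε = μ Z X' δ
  eqExt : ∀ {Z X : C} {δ : D.Ext Z X}, μ Z X δ = 0 → D.NullExt N δ
  realizes_iff : ∀ {X Y Z : L} {x : X ⟶ Y} {y : Y ⟶ Z} {ε : D'.Ext Z X},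
    D'.realizes x y ε ↔ ∃ (X₀ Y₀ Z₀ : C) (x₀ : X₀ ⟶ Y₀) (y₀ : Y₀ ⟶ Z₀) (δ : D.Ext Z₀ X₀)
      (a : Q.obj X₀ ≅ X) (b : Q.obj Y₀ ≅ Y) (c : Q.obj Z₀ ≅ Z), D.realizes x₀ y₀ δ ∧
      Q.map x₀ ≫ b.hom = a.hom ≫ x ∧ Q.map y₀ ≫ c.hom = b.hom ≫ y ∧
      D'.push _ a.hom (μ Z₀ X₀ δ) = D'.pull c.hom _ ε

/-- Isomorphic images of an extension, from the other side. -/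
theorem push_inv_eq {D : ExtriData.{u, v, w} k C} {X Z X' Z' : C} {a : X ≅ X'} {c : Z ≅ Z'}
    {δ : D.Ext Z X} {ε : D.Ext Z' X'} (h : D.push Z a.hom δ = D.pull c.hom X' ε) :
    D.push Z' a.inv ε = D.pull c.inv X δ := by
  have := congrArg (fun e => D.pull c.inv X (D.push Z a.inv e)) h
  simpa [← push_comp, ← pull_push, ← pull_comp] using this.symm

namespace Localizes

variable {D : ExtriData.{u, v, w} k C} {N : ObjectProperty C} {D' : ExtriData.{u₁, v₁, w₁} k L}
  {Q : C ⥤ L} {μ : ∀ Z X : C, D.Ext Z X →ₗ[k] D'.Ext (Q.obj Z) (Q.obj X)} {X Y Z X' Y' Z' : C}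
  {x : X ⟶ Y} {y : Y ⟶ Z} {δ : D.Ext Z X} {x' : X' ⟶ Y'} {y' : Y' ⟶ Z'} {δ' : D.Ext Z' X'}

/-- The description by fractions is self-dual, so (ET3)ᵒᵖ and (ET4)ᵒᵖ are obtained from (ET3) and
(ET4) in the opposite category. -/
theorem op (q : D.Localizes N D' Q μ) :
    D.op.Localizes N.op D'.op Q.op (fun Z X => μ X.unop Z.unop) where
  toInvertsByFractions := q.toInvertsByFractions.op
  push_add Z _ _ a a' δ := q.pull_add a.unop a'.unop Z.unop δ
  push_smul Z _ _ r a δ := q.pull_smul r a.unop Z.unop δ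
  pull_add c c' X δ := q.push_add X.unop c.unop c'.unop δ
  pull_smul r c X δ := q.push_smul X.unop r c.unop δ
  map_push Z _ _ a δ := q.map_pull a.unop Z.unop δ
  map_pull c X δ := q.map_push X.unop c.unop δ
  fracExt ε := by
    obtain ⟨X', s, δ, hs, h⟩ := q.fracExt_op ε
    exact ⟨Opposite.op X', s.op, δ, defN_op.mpr hs, h⟩
  fracExt_op ε := by
    obtain ⟨X', s, δ, hs, h⟩ := q.fracExt ε
    exact ⟨Opposite.op X', s.op, δ, infN_op.mpr hs, h⟩
  eqExt h := Adapted.nullExt_op.mpr (q.eqExt h)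
  realizes_iff {X Y Z x y ε} := by
    refine (q.realizes_iff (x := y.unop) (y := x.unop) (ε := ε)).trans ⟨?_, ?_⟩
    · rintro ⟨X₀, Y₀, Z₀, x₀, y₀, δ, a, b, c, r, h₁, h₂, h₃⟩
      refine ⟨Opposite.op Z₀, Opposite.op Y₀, Opposite.op X₀, y₀.op, x₀.op, δ, c.symm.op, b.symm.op,
        a.symm.op, r, Quiver.Hom.unop_inj ?_, Quiver.Hom.unop_inj ?_, (push_inv_eq h₃).symm⟩
      · exact (square_inv h₂).symm
      · exact (square_inv h₁).symm
    · rintro ⟨X₀, Y₀, Z₀, x₀, y₀, δ, a, b, c, r, h₁, h₂, h₃⟩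
      refine ⟨Z₀.unop, Y₀.unop, X₀.unop, y₀.unop, x₀.unop, δ, c.symm.unop, b.symm.unop,
        a.symm.unop, r, (congrArg Quiver.Hom.unop (square_inv h₂)).symm,
        (congrArg Quiver.Hom.unop (square_inv h₁)).symm, (push_inv_eq (D := D'.op) h₃).symm⟩

/-- Morphisms of extensions between images of triangles lift to morphisms of sequences. -/
theorem exists_lift_map (g : D.Adapted N) (q : D.Localizes N D' Q μ) (r : D.realizes x y δ)
    (r' : D.realizes x' y' δ') (a : Q.obj X ⟶ Q.obj X') (c : Q.obj Z ⟶ Q.obj Z')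
    (h : D'.push _ a (μ Z X δ) = D'.pull c _ (μ Z' X' δ')) :
    ∃ b : Q.obj Y ⟶ Q.obj Y', Q.map x ≫ b = a ≫ Q.map x' ∧ b ≫ Q.map y' = Q.map y ≫ c ∧
      (IsIso a → IsIso c → IsIso b) := by
  obtain ⟨X'', a₀, s, hs, ha⟩ := q.fracL a
  obtain ⟨Z₁, t, c₀, ht, hc⟩ := q.fracR c
  -- With `a` written as a left fraction and `c` as a right fraction, the hypothesis says that two
  -- extensions of `C` agree in the localization; their difference is null and disappears after a
  -- further pullback along `t'`.
  have hn : D.NullExt N (D.push Z₁ a₀ (D.pull t X δ) - D.pull c₀ X'' (D.push Z' s δ')) := by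
    refine q.eqExt ?_
    rw [map_sub, sub_eq_zero]
    have := congrArg (fun e => D'.pull (Q.map t) _ (D'.push _ (Q.map s) e)) h
    simpa only [q.map_push, q.map_pull, ← push_comp, ← pull_comp, pull_push, ha, hc] using this
  obtain ⟨Z₂, t', ht', h₀⟩ := g.exists_pull_eq_zero hn
  have hc' : Q.map (t' ≫ t) ≫ c = Q.map (t' ≫ c₀) := by
    rw [Q.map_comp, Category.assoc, hc, Q.map_comp]
  have ht₂ : D.sN N (t' ≫ t) := .df _ (g.defN_comp ht' ht)
  obtain ⟨V, x₂, y₂, r₂⟩ := g.ext.exists_realizes (D.pull (t' ≫ t) X δ)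
  obtain ⟨W, x₃, y₃, r₃⟩ := g.ext.exists_realizes (D.push Z' s δ')
  obtain ⟨γ, hγ, hγ₁, hγ₂⟩ := g.exists_sN_of_pull ht₂ r r₂
  obtain ⟨β, hβ, hβ₁, hβ₂⟩ := g.exists_sN_of_push (.inf _ hs) r' r₃
  have h₀ : D.push Z₂ a₀ (D.pull (t' ≫ t) X δ) = D.pull (t' ≫ c₀) X'' (D.push Z' s δ') := by
    rw [map_sub, sub_eq_zero] at h₀
    simpa only [pull_comp, pull_push] using h₀
  -- A general lift need not be in `S_N` even if `a₀` and `t' ≫ c₀` are. It is chosen in `S_N` in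
  -- that case, so that saturation yields the final clause on isomorphisms.
  obtain ⟨b₀, hb₁, hb₂, hb⟩ : ∃ b₀ : V ⟶ W, x₂ ≫ b₀ = a₀ ≫ x₃ ∧ b₀ ≫ y₃ = y₂ ≫ t' ≫ c₀ ∧
      (D.sN N a₀ → D.sN N (t' ≫ c₀) → D.sN N b₀) := by
    by_cases hb : D.sN N a₀ ∧ D.sN N (t' ≫ c₀)
    · obtain ⟨b₀, hb, hb₁, hb₂⟩ := g.exists_sN_middle hb.1 hb.2 r₂ r₃ h₀
      exact ⟨b₀, hb₁, hb₂, fun _ _ => hb⟩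
    · obtain ⟨b₀, hb₁, hb₂⟩ := g.ext.exists_lift r₂ r₃ a₀ (t' ≫ c₀) h₀
      exact ⟨b₀, hb₁, hb₂, fun h₁ h₂ => (hb ⟨h₁, h₂⟩).elim⟩
  have := q.inverts γ hγ
  have := q.inverts β hβ
  have := q.inverts s (.inf _ hs)
  have := q.inverts _ ht₂
  refine ⟨inv (Q.map γ) ≫ Q.map b₀ ≫ inv (Q.map β), ?_, ?_, fun _ _ => ?_⟩
  · rw [← hγ₁, Q.map_comp, Category.assoc, IsIso.hom_inv_id_assoc, ← Q.map_comp_assoc, hb₁,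
      Q.map_comp_assoc, ← ha, Category.assoc, ← Q.map_comp_assoc, ← hβ₁, Q.map_comp_assoc,
      IsIso.hom_inv_id, Category.comp_id]
  · rw [← hβ₂, Q.map_comp, Category.assoc, Category.assoc, IsIso.inv_hom_id_assoc, ← Q.map_comp,
      hb₂, Q.map_comp, ← hc', ← Q.map_comp_assoc, ← hγ₂, Q.map_comp, Category.assoc,
      IsIso.inv_hom_id_assoc]
  · have h₁ : D.sN N a₀ := q.sN_of_isIso_map g (by rw [← ha]; infer_instance)
    have h₂ : D.sN N (t' ≫ c₀) := q.sN_of_isIso_map g (by rw [← hc']; infer_instance)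
    have := q.inverts b₀ (hb h₁ h₂)
    infer_instance

/-- (ET3) for images of triangles. -/
theorem et3_map (g : D.Adapted N) (q : D.Localizes N D' Q μ) (r : D.realizes x y δ)
    (r' : D.realizes x' y' δ') (a : Q.obj X ⟶ Q.obj X') (b : Q.obj Y ⟶ Q.obj Y')
    (h : Q.map x ≫ b = a ≫ Q.map x') :
    ∃ c : Q.obj Z ⟶ Q.obj Z', Q.map y ≫ c = b ≫ Q.map y' ∧
      D'.push _ a (μ Z X δ) = D'.pull c _ (μ Z' X' δ') := by
  have := q.additive
  obtain ⟨X'', a₀, s, hs, ha⟩ := q.fracL a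
  obtain ⟨W, x₃, y₃, r₃⟩ := g.ext.exists_realizes (D.push Z' s δ')
  obtain ⟨β, hβ, hβ₁, hβ₂⟩ := g.exists_sN_of_push (.inf _ hs) r' r₃
  obtain ⟨W', b₀, t, ht, hb⟩ := q.fracL (b ≫ Q.map β)
  have e₀ : Q.map (x ≫ b₀) = Q.map (a₀ ≫ x₃ ≫ t) := by
    rw [Q.map_comp, ← hb, Category.assoc, reassoc_of% h, ← Q.map_comp_assoc, hβ₁, Q.map_comp,
      Category.assoc, reassoc_of% ha, ← Q.map_comp, ← Q.map_comp]
  obtain ⟨W'', u, hu, M, hM, i, j, hij⟩ := q.eqL e₀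
  -- The lifted square commutes only up to `i ≫ j` through `M`. Extending `i` along `x` and pushing
  -- out along `j` produces the correction `e ≫ j'`, which `Q` kills and which makes the square
  -- commute strictly.
  obtain ⟨M₁, hM₁, n, e, ⟨P, p, ⟨ω, rn⟩, hP⟩, he⟩ := g.exists_extend_infN r hM i
  obtain ⟨V, v, p', rv⟩ := g.ext.exists_realizes (D.push P j ω)
  obtain ⟨j', hj, -⟩ := g.ext.exists_lift rn rv j (𝟙 P) (by simp)
  have hT : D.infN N (t ≫ u ≫ v) := g.infN_comp ht (g.infN_comp hu ⟨P, p', ⟨_, rv⟩, hP⟩)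
  obtain ⟨R, q', ⟨ρ, rT⟩, hR⟩ := hT
  -- The denominator `t ≫ u ≫ v` on the middle term is transferred by the octahedron to a
  -- denominator `d` on the cone.
  obtain ⟨G, h', d, e', δ₄, r₄, rd, hd₁, -, hd₂, -⟩ := g.ext.et4 r₃ rT
  have hxb : x ≫ (b₀ ≫ u ≫ v - e ≫ j') = a₀ ≫ x₃ ≫ t ≫ u ≫ v := by
    have := hij =≫ v
    simp only [Preadditive.sub_comp, Category.assoc] at this
    rw [Preadditive.comp_sub, reassoc_of% he, hj, this]
    abel
  obtain ⟨c₀, hc₁, hc₂⟩ := g.ext.et3 r r₄ a₀ _ hxb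
  have hb₁ : Q.map (b₀ ≫ u ≫ v - e ≫ j') = b ≫ Q.map β ≫ Q.map (t ≫ u ≫ v) := by
    rw [Q.map_sub, q.map_eq_zero g ⟨M₁, hM₁, e, j', rfl⟩, sub_zero, Q.map_comp, ← hb]
    simp only [Q.map_comp, Category.assoc]
  have := q.inverts d (.inf _ ⟨R, e', ⟨_, rd⟩, hR⟩)
  have := q.inverts s (.inf _ hs)
  refine ⟨Q.map c₀ ≫ inv (Q.map d), ?_, ?_⟩
  · rw [← Q.map_comp_assoc, hc₁, Q.map_comp, hb₁]
    simp only [Category.assoc]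
    rw [← Q.map_comp_assoc (t ≫ u ≫ v), hd₁, Q.map_comp, Category.assoc, IsIso.hom_inv_id,
      Category.comp_id, ← Q.map_comp, hβ₂]
  · have h₁ := congrArg (μ _ _) hc₂
    have h₂ := congrArg (μ _ _) hd₂
    simp only [q.map_push, q.map_pull] at h₁ h₂
    have h₃ : D'.push _ (Q.map s) (D'.push _ a (μ Z X δ)) =
        D'.push _ (Q.map s) (D'.pull (Q.map c₀ ≫ inv (Q.map d)) _ (μ Z' X' δ')) := by
      rw [← push_comp, ha, h₁, ← pull_push, ← h₂, ← pull_comp, Category.assoc, IsIso.inv_hom_id,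
        Category.comp_id]
    simpa [← push_comp] using congrArg (D'.push _ (inv (Q.map s))) h₃


theorem exists_lift_isIso (g : D.Adapted N) (q : D.Localizes N D' Q μ) {X Y Z X' Y' Z' : L}
    {x : X ⟶ Y} {y : Y ⟶ Z} {ε : D'.Ext Z X} {x' : X' ⟶ Y'} {y' : Y' ⟶ Z'} {ε' : D'.Ext Z' X'}
    (r : D'.realizes x y ε) (r' : D'.realizes x' y' ε') (a : X ⟶ X') (c : Z ⟶ Z')
    (h : D'.push Z a ε = D'.pull c X' ε') :
    ∃ b : Y ⟶ Y', x ≫ b = a ≫ x' ∧ b ≫ y' = y ≫ c ∧ (IsIso a → IsIso c → IsIso b) := by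
  obtain ⟨X₀, Y₀, Z₀, x₀, y₀, δ, α, β, γ, r₀, h₁, h₂, h₃⟩ := q.realizes_iff.mp r
  obtain ⟨X₀', Y₀', Z₀', x₀', y₀', δ', α', β', γ', r₀', h₁', h₂', h₃'⟩ := q.realizes_iff.mp r'
  obtain ⟨b, hb₁, hb₂, hb⟩ := q.exists_lift_map g r₀ r₀' (α.hom ≫ a ≫ α'.inv)
    (γ.hom ≫ c ≫ γ'.inv) (by
      rw [push_comp, h₃, ← pull_push, push_comp, h, pull_comp, pull_comp, ← push_inv_eq h₃']
      simp only [pull_push])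
  refine ⟨β.inv ≫ b ≫ β'.hom, ?_, ?_, fun _ _ => ?_⟩
  · rw [reassoc_of% square_inv h₁, reassoc_of% hb₁, h₁']
    simp
  · rw [Category.assoc, Category.assoc, ← h₂', reassoc_of% hb₂, ← reassoc_of% square_inv h₂]
    simp
  · have := hb inferInstance inferInstance
    infer_instance

/-- After moving both ends into the image of `Q`, a denominator on the `Z`-side turns `ε` into the
image of an extension of `C`. Realize that one; the denominator is absorbed into the isomorphism
with `Z`. -/
theorem exists_realizes (g : D.Adapted N) (q : D.Localizes N D' Q μ) {Z X : L}
    (ε : D'.Ext Z X) : ∃ (Y : L) (x : X ⟶ Y) (y : Y ⟶ Z), D'.realizes x y ε := by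
  obtain ⟨X₀, ⟨α⟩⟩ := q.essSurj X
  obtain ⟨Z₀, ⟨γ⟩⟩ := q.essSurj Z
  obtain ⟨Z₁, s, δ, hs, h⟩ := q.fracExt (D'.pull γ.hom _ (D'.push _ α.inv ε))
  obtain ⟨Y, x, y, r⟩ := g.ext.exists_realizes δ
  have := q.inverts s (.df _ hs)
  refine ⟨Q.obj Y, α.inv ≫ Q.map x, Q.map y ≫ Q.map s ≫ γ.hom, q.realizes_iff.mpr
    ⟨X₀, Y, Z₁, x, y, δ, α, Iso.refl _, asIso (Q.map s) ≪≫ γ, r, by simp, by simp, ?_⟩⟩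
  rw [← h]
  simp [← push_comp, ← pull_comp, ← pull_push]

theorem realizes_of_iso (q : D.Localizes N D' Q μ) {X Y Y' Z : L} {x : X ⟶ Y} {y : Y ⟶ Z}
    {ε : D'.Ext Z X} (r : D'.realizes x y ε) (b : Y ≅ Y') :
    D'.realizes (x ≫ b.hom) (b.inv ≫ y) ε := by
  obtain ⟨X₀, Y₀, Z₀, x₀, y₀, δ, α, β, γ, r₀, h₁, h₂, h₃⟩ := q.realizes_iff.mp r
  exact q.realizes_iff.mpr ⟨X₀, Y₀, Z₀, x₀, y₀, δ, α, β ≪≫ b, γ, r₀, by simp [reassoc_of% h₁],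
    by simp [h₂], h₃⟩

theorem realizes_zero (g : D.Adapted N) (q : D.Localizes N D' Q μ) (Z X : L)
    [HasBinaryBiproduct X Z] :
    D'.realizes (biprod.inl : X ⟶ X ⊞ Z) (biprod.snd : X ⊞ Z ⟶ Z) 0 := by
  have := q.additive
  obtain ⟨X₀, ⟨α⟩⟩ := q.essSurj X
  obtain ⟨Z₀, ⟨γ⟩⟩ := q.essSurj Z
  obtain ⟨W, i₁, i₂, p₁, p₂, hW⟩ := g.ext.exists_sum X₀ Z₀
  have hQ := hW.map Q
  obtain ⟨e, he⟩ := hQ.exists_iso_of_isos (IsDirectSum.biprod X Z) α γ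
  refine q.realizes_iff.mpr ⟨X₀, W, Z₀, i₁, p₂, 0, α, e, γ, g.ext.realizes_split hW, ?_, ?_, ?_⟩
  · simp [he, hQ.inl_fst_assoc, hQ.inl_snd_assoc]
  · simp [he]
  · simp

theorem realizes_sum (g : D.Adapted N) (q : D.Localizes N D' Q μ) [HasBinaryBiproducts L]
    {X Y Z X' Y' Z' : L}
    {x : X ⟶ Y} {y : Y ⟶ Z} {ε : D'.Ext Z X} {x' : X' ⟶ Y'} {y' : Y' ⟶ Z'} {ε' : D'.Ext Z' X'}
    (r : D'.realizes x y ε) (r' : D'.realizes x' y' ε') :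
    D'.realizes (biprod.map x x') (biprod.map y y')
      (D'.push _ (biprod.inl : X ⟶ X ⊞ X') (D'.pull (biprod.fst : Z ⊞ Z' ⟶ Z) _ ε) +
        D'.push _ (biprod.inr : X' ⟶ X ⊞ X') (D'.pull (biprod.snd : Z ⊞ Z' ⟶ Z') _ ε')) := by
  have := q.additive
  obtain ⟨X₀, Y₀, Z₀, x₀, y₀, δ, α, β, γ, r₀, h₁, h₂, h₃⟩ := q.realizes_iff.mp r
  obtain ⟨X₀', Y₀', Z₀', x₀', y₀', δ', α', β', γ', r₀', h₁', h₂', h₃'⟩ := q.realizes_iff.mp r'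
  obtain ⟨A, iA, jA, pA, qA, hA⟩ := g.ext.exists_sum X₀ X₀'
  obtain ⟨B, iB, jB, pB, qB, hB⟩ := g.ext.exists_sum Y₀ Y₀'
  obtain ⟨E, iE, jE, pE, qE, hE⟩ := g.ext.exists_sum Z₀ Z₀'
  obtain ⟨a, ha⟩ := (hA.map Q).exists_iso_of_isos (IsDirectSum.biprod X X') α α'
  obtain ⟨b, hb⟩ := (hB.map Q).exists_iso_of_isos (IsDirectSum.biprod Y Y') β β'
  obtain ⟨c, hc⟩ := (hE.map Q).exists_iso_of_isos (IsDirectSum.biprod Z Z') γ γ'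
  have a₁ : Q.map iA ≫ a.hom = α.hom ≫ biprod.inl := by
    simp [ha, (hA.map Q).inl_fst_assoc, (hA.map Q).inl_snd_assoc]
  have a₂ : Q.map jA ≫ a.hom = α'.hom ≫ biprod.inr := by
    simp [ha, (hA.map Q).inr_snd_assoc, (hA.map Q).inr_fst_assoc]
  have b₁ : Q.map iB ≫ b.hom = β.hom ≫ biprod.inl := by
    simp [hb, (hB.map Q).inl_fst_assoc, (hB.map Q).inl_snd_assoc]
  have b₂ : Q.map jB ≫ b.hom = β'.hom ≫ biprod.inr := by
    simp [hb, (hB.map Q).inr_snd_assoc, (hB.map Q).inr_fst_assoc]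
  have c₁ : Q.map iE ≫ c.hom = γ.hom ≫ biprod.inl := by
    simp [hc, (hE.map Q).inl_fst_assoc, (hE.map Q).inl_snd_assoc]
  have c₂ : Q.map jE ≫ c.hom = γ'.hom ≫ biprod.inr := by
    simp [hc, (hE.map Q).inr_snd_assoc, (hE.map Q).inr_fst_assoc]
  have c₃ : Q.map pE ≫ γ.hom = c.hom ≫ biprod.fst := by simp [hc]
  have c₄ : Q.map qE ≫ γ'.hom = c.hom ≫ biprod.snd := by simp [hc]
  refine q.realizes_iff.mpr ⟨A, B, E, _, _, _, a, b, c,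
    g.ext.realizes_directSum r₀ r₀' hA hB hE, ?_, ?_, ?_⟩
  · simp [ha, b₁, b₂, reassoc_of% h₁, reassoc_of% h₁']
  · simp [hb, c₁, c₂, reassoc_of% h₂, reassoc_of% h₂']
  · simp only [map_add, q.map_push, q.map_pull, ← push_comp, a₁, a₂, pull_push, ← pull_comp, ← c₃,
      ← c₄]
    simp only [push_comp, pull_comp, ← h₃, ← h₃', ← pull_push]


theorem et3 (g : D.Adapted N) (q : D.Localizes N D' Q μ) {X Y Z X' Y' Z' : L}
    {x : X ⟶ Y} {y : Y ⟶ Z} {ε : D'.Ext Z X} {x' : X' ⟶ Y'} {y' : Y' ⟶ Z'} {ε' : D'.Ext Z' X'}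
    (r : D'.realizes x y ε) (r' : D'.realizes x' y' ε') (a : X ⟶ X') (b : Y ⟶ Y')
    (h : x ≫ b = a ≫ x') : ∃ c : Z ⟶ Z', y ≫ c = b ≫ y' ∧ D'.push Z a ε = D'.pull c X' ε' := by
  obtain ⟨X₀, Y₀, Z₀, x₀, y₀, δ, α, β, γ, r₀, h₁, h₂, h₃⟩ := q.realizes_iff.mp r
  obtain ⟨X₀', Y₀', Z₀', x₀', y₀', δ', α', β', γ', r₀', h₁', h₂', h₃'⟩ := q.realizes_iff.mp r'
  obtain ⟨c, hc₁, hc₂⟩ := q.et3_map g r₀ r₀' (α.hom ≫ a ≫ α'.inv) (β.hom ≫ b ≫ β'.inv) (by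
    rw [reassoc_of% h₁, reassoc_of% h, square_inv h₁']
    simp)
  refine ⟨γ.inv ≫ c ≫ γ'.hom, ?_, ?_⟩
  · rw [reassoc_of% square_inv h₂, reassoc_of% hc₁, h₂']
    simp
  · have h₄ : D'.push Z a ε = D'.push Z α'.hom (D'.pull γ.inv _
        (D'.push _ (α.hom ≫ a ≫ α'.inv) (μ _ _ δ))) := by
      rw [push_comp, h₃]
      simp [pull_push, ← push_comp, ← pull_comp]
    rw [h₄, hc₂, ← pull_comp, ← pull_push, pull_comp, ← Category.assoc, pull_comp, ← h₃', pull_comp]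

theorem et4 (g : D.Adapted N) (q : D.Localizes N D' Q μ) {A B X₁ Y F : L} {f : A ⟶ B}
    {f' : B ⟶ X₁} {ε : D'.Ext X₁ A} {u : B ⟶ Y} {u' : Y ⟶ F} {η : D'.Ext F B}
    (r : D'.realizes f f' ε) (r' : D'.realizes u u' η) :
    ∃ (G : L) (h' : Y ⟶ G) (d : X₁ ⟶ G) (e : G ⟶ F) (ε' : D'.Ext G A),
      D'.realizes (f ≫ u) h' ε' ∧ D'.realizes d e (D'.push F f' η) ∧
      u ≫ h' = f' ≫ d ∧ h' ≫ e = u' ∧ D'.pull d A ε' = ε ∧ D'.push G f ε' = D'.pull e B η := by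
  have := q.additive
  obtain ⟨A₀, B₀, Z₀, x₁, y₁, δ, α, β, γ, r₁, h₁, h₂, h₃⟩ := q.realizes_iff.mp r
  obtain ⟨B₀', Y₀, F₀, x₂, y₂, ρ, β', σ, φ, r₂, h₁', h₂', h₃'⟩ := q.realizes_iff.mp r'
  -- The two models of `B` are only isomorphic in the localization. By saturation this isomorphism
  -- is a fraction with both legs in `S_N`; enlarging `B₂` by a summand in `N` puts both legs in
  -- `Inf_N`.
  obtain ⟨B₂, b, s, hb, hs, e₁⟩ : ∃ (B₂ : C) (b : B₀ ⟶ B₂) (s : B₀' ⟶ B₂),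
      D.infN N b ∧ D.infN N s ∧ β.hom ≫ β'.inv ≫ Q.map s = Q.map b := by
    obtain ⟨B₂, b, s, hs, h⟩ := q.fracL (β.hom ≫ β'.inv)
    have := q.inverts s (.inf _ hs)
    have hb : D.sN N b := q.sN_of_isIso_map g (by rw [← h]; infer_instance)
    obtain ⟨M, W, i₁, i₂, p₁, p₂, b₁, hW, hM, hb₁, rfl⟩ := g.exists_infN_of_sN hb
    have := q.inverts p₁ (g.sN_fst hW hM)
    refine ⟨W, b₁, s ≫ i₁, hb₁, g.infN_comp hs (g.infN_inl hW hM), ?_⟩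
    rw [← cancel_mono (Q.map p₁), ← Q.map_comp, ← h]
    simp only [Category.assoc, Q.map_comp, (hW.map Q).inl_fst, Category.comp_id]
  obtain ⟨Y₂, g₂, k₂, r₃⟩ := g.ext.exists_realizes (D.push F₀ s ρ)
  obtain ⟨v, hv, hv₁, hv₂⟩ := g.exists_sN_of_push (.inf _ hs) r₂ r₃
  obtain ⟨P, p, ⟨ω, rb⟩, hP⟩ := hb
  -- The first octahedron moves the triangle of `f` to the common model `B₂`, changing its cone only
  -- by `d₁`, which `Q` inverts; the second is the octahedron asked for.
  obtain ⟨G₁, k₁, d₁, e₂, δ₁, r₄, rd₁, m₁, -, m₂, -⟩ := g.ext.et4 r₁ rb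
  obtain ⟨G, h', d, e, δ', r₅, rd, m₃, m₄, m₅, m₆⟩ := g.ext.et4 r₄ r₃
  have := q.inverts v hv
  have := q.inverts s (.inf _ hs)
  have := q.inverts d₁ (.inf _ ⟨P, e₂, ⟨_, rd₁⟩, hP⟩)
  have e₂ : Q.map s = β'.hom ≫ β.inv ≫ Q.map b := by rw [← e₁]; simp
  refine ⟨Q.obj G, σ.inv ≫ Q.map v ≫ Q.map h', γ.inv ≫ Q.map d₁ ≫ Q.map d, Q.map e ≫ φ.hom,
    D'.push _ α.hom (μ _ _ δ'), ?_, ?_, ?_, ?_, ?_, ?_⟩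
  · refine q.realizes_iff.mpr ⟨A₀, Y₂, G, _, _, _, α, (asIso (Q.map v)).symm ≪≫ σ, Iso.refl _, r₅,
      ?_, by simp, by simp⟩
    have e₃ : Q.map g₂ ≫ inv (Q.map v) = inv (Q.map s) ≫ Q.map x₂ := by
      rw [IsIso.comp_inv_eq, Category.assoc, IsIso.eq_inv_comp, ← Q.map_comp, ← Q.map_comp, hv₁]
    simp only [Q.map_comp, Iso.trans_hom, Iso.symm_hom, asIso_inv, Category.assoc]
    rw [reassoc_of% e₃, ← e₁]
    simp [h₁', reassoc_of% h₁]
  · refine q.realizes_iff.mpr ⟨G₁, G, F₀, d, e, _, (asIso (Q.map d₁)).symm ≪≫ γ, Iso.refl _, φ, rd,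
      by simp, by simp, ?_⟩
    have e₃ : Q.map s ≫ Q.map k₁ ≫ inv (Q.map d₁) ≫ γ.hom = β'.hom ≫ f' := by
      rw [e₂]
      simp only [Category.assoc]
      rw [← Q.map_comp_assoc, m₁, Q.map_comp_assoc, IsIso.hom_inv_id_assoc, h₂,
        Iso.inv_hom_id_assoc]
    rw [pull_push, ← h₃', ← push_comp D' β'.hom f', ← e₃]
    simp [q.map_push, push_comp]
  · have e₃ := congrArg Q.map m₃
    have e₄ := congrArg Q.map m₁
    have e₅ := congrArg Q.map hv₁
    simp only [Q.map_comp] at e₃ e₄ e₅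
    rw [reassoc_of% square_inv h₁', reassoc_of% e₅, e₃, e₂]
    simp only [Category.assoc, Iso.inv_hom_id_assoc]
    rw [reassoc_of% e₄, reassoc_of% square_inv h₂]
  · simp only [Category.assoc]
    rw [← Q.map_comp_assoc h', m₄, ← Q.map_comp_assoc, hv₂, h₂', Iso.inv_hom_id_assoc]
  · rw [pull_push, pull_comp, ← Q.map_comp, ← q.map_pull, pull_comp, m₅, m₂, ← pull_push, h₃,
      ← pull_comp]
    simp
  · have e₃ := congrArg (μ _ _) m₆
    simp only [q.map_push, q.map_pull] at e₃
    have e₄ : α.hom ≫ f = Q.map (x₁ ≫ b) ≫ inv (Q.map s) ≫ β'.hom := by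
      rw [Q.map_comp, ← e₁]
      simp [h₁]
    rw [← push_comp, e₄, push_comp, e₃, pull_comp, ← h₃', ← pull_push, ← push_comp]
    simp

/-- A localization of an extriangulated category is extriangulated. -/
theorem isExtriangulated (g : D.Adapted N) (q : D.Localizes N D' Q μ) : D'.IsExtriangulated :=
  have := q.additive
  have hb : HasBinaryBiproducts L := ⟨fun X Y => by
    obtain ⟨X₀, ⟨a⟩⟩ := q.essSurj X
    obtain ⟨Y₀, ⟨b⟩⟩ := q.essSurj Y
    obtain ⟨W, i₁, i₂, p₁, p₂, hW⟩ := g.ext.exists_sum X₀ Y₀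
    have hQ := hW.map Q
    refine IsDirectSum.hasBinaryBiproduct (i₁ := a.inv ≫ Q.map i₁) (i₂ := b.inv ≫ Q.map i₂)
      (p₁ := Q.map p₁ ≫ a.hom) (p₂ := Q.map p₂ ≫ b.hom) ⟨?_, ?_, ?_, ?_, ?_⟩
    · simp [hQ.inl_fst_assoc]
    · simp [hQ.inr_snd_assoc]
    · simp [hQ.inl_snd_assoc]
    · simp [hQ.inr_fst_assoc]
    · simp [hQ.total]⟩
  have hz : HasZeroObject L := by
    obtain ⟨O, hO⟩ := g.ext.exists_zero
    exact ⟨⟨_, Q.map_isZero hO⟩⟩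
  { push_add := q.push_add
    push_smul := q.push_smul
    pull_add := q.pull_add
    pull_smul := q.pull_smul
    exists_realizes := q.exists_realizes g
    realizes_iff := fun {X Y Y' Z x y ε} r x' y' => by
      refine ⟨fun r' => ?_, ?_⟩
      · obtain ⟨b, h₁, h₂, hb⟩ := q.exists_lift_isIso g r r' (𝟙 X) (𝟙 Z) (by simp)
        have := hb inferInstance inferInstance
        exact ⟨asIso b, by simpa using h₁, by simpa using h₂⟩
      · rintro ⟨b, rfl, h⟩
        exact (q.realizes_of_iso r b).congr rfl (by rw [← h, Iso.inv_hom_id_assoc]) rfl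
    exists_lift := fun r r' a c h => by
      obtain ⟨b, h₁, h₂, -⟩ := q.exists_lift_isIso g r r' a c h
      exact ⟨b, h₁, h₂⟩
    realizes_zero := fun Z X => q.realizes_zero g Z X
    realizes_sum := q.realizes_sum g
    et3 := q.et3 g
    et3_op := fun r r' b c h => by
      obtain ⟨a, h₁, h₂⟩ := q.op.et3 g.op (x := Quiver.Hom.op _) (y := Quiver.Hom.op _)
        (x' := Quiver.Hom.op _) (y' := Quiver.Hom.op _) r' r c.op b.op
        (congrArg Quiver.Hom.op h.symm)
      exact ⟨a.unop, congrArg Quiver.Hom.unop h₁.symm, h₂.symm⟩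
    et4 := q.et4 g
    et4_op := fun r r' => by
      obtain ⟨G, h', d, e, δ', r₁, r₂, h₁, h₂, h₃, h₄⟩ := q.op.et4 g.op (f := Quiver.Hom.op _)
        (f' := Quiver.Hom.op _) (u := Quiver.Hom.op _) (u' := Quiver.Hom.op _) r' r
      exact ⟨G.unop, h'.unop, e.unop, d.unop, δ', r₁, r₂, congrArg Quiver.Hom.unop h₂,
        congrArg Quiver.Hom.unop h₁, h₃, h₄.symm⟩ }

end Localizes
end ExtriData
end Extri

/-! ### Linear structure on the localization of a category, via an ideal quotient. -/

namespace Extri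
namespace FractionsModulo

variable {C : Type u} [Category.{v} C] [Preadditive C] {N : ObjectProperty C}
  {S : MorphismProperty C}

/-- A functor that inverts the projections away from objects of `N` identifies morphisms whose
difference factors through `N`. -/
theorem map_eq_of_factors {L : Type u₁} [Category.{v₁} L]
    (hN : ∀ X M : C, N M → ∃ (W : C) (i₁ : X ⟶ W) (i₂ : M ⟶ W) (p₁ : W ⟶ X) (p₂ : W ⟶ M),
      IsDirectSum i₁ i₂ p₁ p₂ ∧ S p₁)
    (G : C ⥤ L) (hG : S.IsInvertedBy G) {X Y : C} {f f' : X ⟶ Y} (h : Factors N (f - f')) :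
    G.map f = G.map f' := by
  obtain ⟨M, hM, i, j, hij⟩ := h
  obtain ⟨W, i₁, i₂, p₁, p₂, hW, hp⟩ := hN X M hM
  have := hG p₁ hp
  -- Both maps are sections of `p₁`, which `G` inverts.
  have e : G.map (i₁ + i ≫ i₂) = G.map i₁ := by
    rw [← cancel_mono (G.map p₁), ← G.map_comp, ← G.map_comp]
    simp [hW.inl_fst, hW.inr_fst]
  have e₁ : i₁ ≫ (p₁ ≫ f' + p₂ ≫ j) = f' := by simp [hW.inl_fst_assoc, hW.inl_snd_assoc]
  have e₂ : (i₁ + i ≫ i₂) ≫ (p₁ ≫ f' + p₂ ≫ j) = f := by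
    simp [hW.inl_fst_assoc, hW.inl_snd_assoc, hW.inr_fst_assoc, hW.inr_snd_assoc, hij]
  rw [← e₂, G.map_comp, e, ← G.map_comp, e₁]

/-- The image of `S` in the ideal quotient. -/
def image (N : ObjectProperty C) (S : MorphismProperty C) : MorphismProperty (IdealQuotient N) :=
  fun X Y f => ∃ f₀ : X.as ⟶ Y.as, S f₀ ∧ (toIdealQuotient N).map f₀ = f

theorem image_iff (F : FractionsModulo N S)
    (hS : ∀ {X Y : C} {f f' : X ⟶ Y}, S f → Factors N (f' - f) → S f') {X Y : C} (f : X ⟶ Y) :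
    image N S ((toIdealQuotient N).map f) ↔ S f := by
  refine ⟨?_, fun h => ⟨f, h, rfl⟩⟩
  rintro ⟨f₀, h, e⟩
  exact hS h (F.map_eq_iff.mp e.symm)

/-- The comparison functor from the ideal quotient to the localization. -/
noncomputable def fromIdealQuotient
    (hN : ∀ X M : C, N M → ∃ (W : C) (i₁ : X ⟶ W) (i₂ : M ⟶ W) (p₁ : W ⟶ X) (p₂ : W ⟶ M),
      IsDirectSum i₁ i₂ p₁ p₂ ∧ S p₁) : IdealQuotient N ⥤ S.Localization :=
  CategoryTheory.Quotient.lift _ S.Q fun _ _ _ _ h =>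
    map_eq_of_factors hN S.Q S.Q_inverts (idealRel_iff.mp h)

/-- A functor inverting `S` identifies maps congruent modulo `N`, so it factors through the
quotient: `C` at `S` and the quotient at the image of `S` have the same localization. A calculus of
fractions is available only in the quotient. -/
theorem isLocalization_fromIdealQuotient
    (hN : ∀ X M : C, N M → ∃ (W : C) (i₁ : X ⟶ W) (i₂ : M ⟶ W) (p₁ : W ⟶ X) (p₂ : W ⟶ M),
      IsDirectSum i₁ i₂ p₁ p₂ ∧ S p₁) :
    (fromIdealQuotient hN).IsLocalization (image N S) :=
  have hΦ : toIdealQuotient N ⋙ fromIdealQuotient hN = S.Q :=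
    CategoryTheory.Quotient.lift_spec _ _ _
  have h₀ : (image N S).IsInvertedBy (fromIdealQuotient hN) := by
    rintro _ _ _ ⟨f, hf, rfl⟩
    exact S.Q_inverts _ hf
  Functor.IsLocalization.mk' _ _
    { inverts := h₀
      lift := fun G hG => Localization.Construction.lift (toIdealQuotient N ⋙ G)
        fun _ _ f hf => hG _ (⟨f, hf, rfl⟩)
      fac := fun G hG => CategoryTheory.Quotient.lift_unique' _ _ _ (by
        rw [← Functor.assoc, hΦ]
        exact Localization.Construction.fac _ _)
      uniq := fun F₁ F₂ h => Localization.Construction.uniq _ _ (by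
        rw [← hΦ, Functor.assoc, h, Functor.assoc]) }
    { inverts := h₀
      lift := fun G hG => Localization.Construction.lift (toIdealQuotient N ⋙ G)
        fun _ _ f hf => hG _ (⟨f, hf, rfl⟩)
      fac := fun G hG => CategoryTheory.Quotient.lift_unique' _ _ _ (by
        rw [← Functor.assoc, hΦ]
        exact Localization.Construction.fac _ _)
      uniq := fun F₁ F₂ h => Localization.Construction.uniq _ _ (by
        rw [← hΦ, Functor.assoc, h, Functor.assoc]) }

/-- The localization of a linear category at a class of morphisms with a calculus of fractions
modulo an ideal is linear, and its morphisms are described by fractions. -/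
theorem exists_linear_localization {k : Type t} [CommRing k] [Linear k C]
    (F : FractionsModulo N S)
    (hS : ∀ {X Y : C} {f f' : X ⟶ Y}, S f → Factors N (f' - f) → S f')
    (hN : ∀ X M : C, N M → ∃ (W : C) (i₁ : X ⟶ W) (i₂ : M ⟶ W) (p₁ : W ⟶ X) (p₂ : W ⟶ M),
      IsDirectSum i₁ i₂ p₁ p₂ ∧ S p₁) :
    ∃ (_ : Preadditive S.Localization) (_ : Linear k S.Localization), S.Q.Additive ∧
      S.Q.Linear k ∧
      (∀ {X Y : C} (f : S.Q.obj X ⟶ S.Q.obj Y), ∃ (Y' : C) (a : X ⟶ Y') (s : Y ⟶ Y'), S s ∧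
        f ≫ S.Q.map s = S.Q.map a) ∧
      (∀ {X Y : C} (f : S.Q.obj X ⟶ S.Q.obj Y), ∃ (X' : C) (s : X' ⟶ X) (a : X' ⟶ Y), S s ∧
        S.Q.map s ≫ f = S.Q.map a) ∧
      (∀ {X Y : C} {f f' : X ⟶ Y}, S.Q.map f = S.Q.map f' → ∃ (Y' : C) (s : Y ⟶ Y'), S s ∧
        Factors N ((f - f') ≫ s)) ∧
      (∀ {X Y : C} {f f' : X ⟶ Y}, S.Q.map f = S.Q.map f' → ∃ (X' : C) (s : X' ⟶ X), S s ∧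
        Factors N (s ≫ (f - f'))) := by
  have := F.congruence
  have := isLocalization_fromIdealQuotient hN
  have hT := fun {X Y : C} (f : X ⟶ Y) => F.image_iff hS f
  have := F.hasLeftCalculusOfFractions hT
  have := F.hasRightCalculusOfFractions hT
  let : Preadditive (IdealQuotient N) := CategoryTheory.Quotient.preadditive _ F.idealRel_add
  have : (toIdealQuotient N).Additive := CategoryTheory.Quotient.functor_additive _ F.idealRel_add
  let : Linear k (IdealQuotient N) := CategoryTheory.Quotient.linear k _ idealRel_smul
  have : (toIdealQuotient N).Linear k := CategoryTheory.Quotient.linear_functor k _ idealRel_smul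
  let : Preadditive S.Localization :=
    Localization.preadditive (fromIdealQuotient hN) (image N S)
  have : (fromIdealQuotient hN).Additive :=
    Localization.functor_additive (fromIdealQuotient hN) (image N S)
  let : Linear k S.Localization :=
    Localization.linear k (fromIdealQuotient hN) (image N S)
  have : (fromIdealQuotient hN).Linear k :=
    Localization.functor_linear k (fromIdealQuotient hN) (image N S)
  refine ⟨inferInstance, inferInstance,
    inferInstanceAs (toIdealQuotient N ⋙ fromIdealQuotient hN).Additive,
    inferInstanceAs ((toIdealQuotient N ⋙ fromIdealQuotient hN).Linear k), ?_, ?_, ?_, ?_⟩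
  · intro X Y f
    obtain ⟨@⟨⟨Z⟩, a, s, hs⟩, hf⟩ := Localization.exists_leftFraction (fromIdealQuotient hN)
      (image N S) (X := (toIdealQuotient N).obj X)
      (Y := (toIdealQuotient N).obj Y) f
    obtain ⟨a, rfl⟩ := exists_map_eq (Y := Z) a
    obtain ⟨s, rfl⟩ := exists_map_eq (Y := Z) s
    refine ⟨Z, a, s, (hT s).mp hs, ?_⟩
    have := MorphismProperty.LeftFraction.map_comp_map_s
      (φ := ⟨(toIdealQuotient N).map a, (toIdealQuotient N).map s, hs⟩)
      (L := fromIdealQuotient hN) (Localization.inverts _ _)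
    rw [← hf] at this
    exact this
  · intro X Y f
    obtain ⟨@⟨⟨Z⟩, s, hs, a⟩, hf⟩ := Localization.exists_rightFraction (fromIdealQuotient hN)
      (image N S) (X := (toIdealQuotient N).obj X)
      (Y := (toIdealQuotient N).obj Y) f
    obtain ⟨a, rfl⟩ := exists_map_eq (X := Z) a
    obtain ⟨s, rfl⟩ := exists_map_eq (X := Z) s
    refine ⟨Z, s, a, (hT s).mp hs, ?_⟩
    have := MorphismProperty.RightFraction.map_s_comp_map
      (φ := ⟨(toIdealQuotient N).map s, hs, (toIdealQuotient N).map a⟩)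
      (L := fromIdealQuotient hN) (Localization.inverts _ _)
    rw [← hf] at this
    exact this
  · intro X Y f f' h
    obtain ⟨⟨Z⟩, s, hs, hf⟩ := (MorphismProperty.map_eq_iff_postcomp (fromIdealQuotient hN)
      (image N S) ((toIdealQuotient N).map f)
      ((toIdealQuotient N).map f')).mp h
    obtain ⟨s, rfl⟩ := exists_map_eq (Y := Z) s
    refine ⟨Z, s, (hT s).mp hs, ?_⟩
    rw [Preadditive.sub_comp, ← F.map_eq_iff, Functor.map_comp, Functor.map_comp]
    exact hf
  · intro X Y f f' h
    obtain ⟨⟨Z⟩, s, hs, hf⟩ := (MorphismProperty.map_eq_iff_precomp (fromIdealQuotient hN)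
      (image N S) ((toIdealQuotient N).map f)
      ((toIdealQuotient N).map f')).mp h
    obtain ⟨s, rfl⟩ := exists_map_eq (X := Z) s
    refine ⟨Z, s, (hT s).mp hs, ?_⟩
    rw [Preadditive.comp_sub, ← F.map_eq_iff, Functor.map_comp, Functor.map_comp]
    exact hf

end FractionsModulo
end Extri

/-! ### The collage: extensions as morphisms, with a calculus of fractions. -/

namespace Extri

variable {k : Type t} [CommRing k] {C : Type u} [Category.{v} C] [Preadditive C] [Linear k C]
  {D : ExtriData.{u, v, w} k C}

/-- The additive category generated by two copies of `C`, in which the morphisms from the first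
copy to the second one are the extensions. Its objects are the sums of an object of the first copy
and an object of the second one. -/
@[ext]
structure Collage (h : D.IsExtriangulated) : Type u where
  /-- the summand in the first copy -/
  src : C
  /-- the summand in the second copy -/
  tgt : C

namespace Collage

/-- Morphisms of `Collage h` are triangular matrices. -/
@[ext]
structure Hom {h : D.IsExtriangulated} (A B : Collage h) : Type (max v w) where
  /-- the component in the first copy -/
  src : A.src ⟶ B.src
  /-- the component in the second copy -/
  tgt : A.tgt ⟶ B.tgt
  /-- the extension -/
  cls : D.Ext A.src B.tgt

variable {h : D.IsExtriangulated}

/-- Composition is multiplication of triangular matrices; associativity rests on the commutation of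
pushforward and pullback. -/
instance : Category (Collage h) where
  Hom := Hom
  id A := ⟨𝟙 _, 𝟙 _, 0⟩
  comp f g := ⟨f.src ≫ g.src, f.tgt ≫ g.tgt,
    D.pull f.src _ g.cls + D.push _ g.tgt f.cls⟩
  id_comp f := by ext <;> simp
  comp_id f := by ext <;> simp
  assoc f g f' := by
    ext
    · simp
    · simp
    · simp only [map_add, ExtriData.push_comp, ExtriData.pull_comp, ExtriData.pull_push, add_assoc]

variable {A B B' : Collage h}

@[ext]
theorem hom_ext {f g : A ⟶ B} (h₁ : f.src = g.src) (h₂ : f.tgt = g.tgt) (h₃ : f.cls = g.cls) :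
    f = g := Hom.ext h₁ h₂ h₃

@[simp] theorem id_src : Hom.src (𝟙 A) = 𝟙 A.src := rfl
@[simp] theorem id_tgt : Hom.tgt (𝟙 A) = 𝟙 A.tgt := rfl
@[simp] theorem id_cls : Hom.cls (𝟙 A) = 0 := rfl
@[simp] theorem comp_src (f : A ⟶ B) (g : B ⟶ B') : (f ≫ g).src = f.src ≫ g.src := rfl
@[simp] theorem comp_tgt (f : A ⟶ B) (g : B ⟶ B') : (f ≫ g).tgt = f.tgt ≫ g.tgt := rfl
@[simp] theorem comp_cls (f : A ⟶ B) (g : B ⟶ B') :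
    (f ≫ g).cls = D.pull f.src _ g.cls + D.push _ g.tgt f.cls := rfl

/-- The components of a morphism. -/
def homEquiv (A B : Collage h) :
    (A ⟶ B) ≃ (A.src ⟶ B.src) × (A.tgt ⟶ B.tgt) × D.Ext A.src B.tgt where
  toFun f := (f.src, f.tgt, f.cls)
  invFun f := ⟨f.1, f.2.1, f.2.2⟩

instance : AddCommGroup (A ⟶ B) := (homEquiv A B).addCommGroup

@[simp] theorem add_src (f g : A ⟶ B) : (f + g).src = f.src + g.src := rfl
@[simp] theorem add_tgt (f g : A ⟶ B) : (f + g).tgt = f.tgt + g.tgt := rfl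
@[simp] theorem add_cls (f g : A ⟶ B) : (f + g).cls = f.cls + g.cls := rfl
@[simp] theorem sub_src (f g : A ⟶ B) : (f - g).src = f.src - g.src := rfl
@[simp] theorem sub_tgt (f g : A ⟶ B) : (f - g).tgt = f.tgt - g.tgt := rfl
@[simp] theorem sub_cls (f g : A ⟶ B) : (f - g).cls = f.cls - g.cls := rfl
@[simp] theorem zero_src : Hom.src (0 : A ⟶ B) = 0 := rfl
@[simp] theorem zero_tgt : Hom.tgt (0 : A ⟶ B) = 0 := rfl
@[simp] theorem zero_cls : Hom.cls (0 : A ⟶ B) = 0 := rfl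

instance : Preadditive (Collage h) where
  add_comp _ _ _ f f' g := by
    ext
    · simp
    · simp
    · simp only [comp_cls, add_src, add_cls, h.pull_add, map_add]
      abel
  comp_add _ _ _ f g g' := by
    ext
    · simp
    · simp
    · simp only [comp_cls, add_tgt, add_cls, h.push_add, map_add]
      abel

instance : Module k (A ⟶ B) := (homEquiv A B).module k

@[simp] theorem smul_src (r : k) (f : A ⟶ B) : (r • f).src = r • f.src := rfl
@[simp] theorem smul_tgt (r : k) (f : A ⟶ B) : (r • f).tgt = r • f.tgt := rfl
@[simp] theorem smul_cls (r : k) (f : A ⟶ B) : (r • f).cls = r • f.cls := rfl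

instance : Linear k (Collage h) where
  smul_comp _ _ _ r f g := by
    ext
    · simp
    · simp
    · simp [h.pull_smul]
  comp_smul _ _ _ f r g := by
    ext
    · simp
    · simp
    · simp [h.push_smul]

/-- The embedding of the first copy. -/
@[simps]
def inSrc (h : D.IsExtriangulated) (O : C) : C ⥤ Collage h where
  obj Z := ⟨Z, O⟩
  map f := ⟨f, 𝟙 O, 0⟩
  map_id _ := rfl
  map_comp f g := by ext <;> simp

/-- The embedding of the second copy. -/
@[simps]
def inTgt (h : D.IsExtriangulated) (O : C) : C ⥤ Collage h where
  obj X := ⟨O, X⟩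
  map f := ⟨𝟙 O, f, 0⟩
  map_id _ := rfl
  map_comp f g := by ext <;> simp

/-- An extension, as a morphism from the first copy to the second one. -/
@[simps]
def ofExt (h : D.IsExtriangulated) (O : C) {Z X : C} (δ : D.Ext Z X) :
    (inSrc h O).obj Z ⟶ (inTgt h O).obj X :=
  ⟨0, 0, δ⟩

theorem ofExt_pull (O : C) {Z Z' X : C} (c : Z' ⟶ Z) (δ : D.Ext Z X) :
    ofExt h O (D.pull c X δ) = (inSrc h O).map c ≫ ofExt h O δ := by
  ext
  · exact comp_zero.symm
  · exact comp_zero.symm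
  · exact ((congrArg _ (map_zero _)).trans (add_zero _)).symm

theorem ofExt_push (O : C) {Z X X' : C} (a : X ⟶ X') (δ : D.Ext Z X) :
    ofExt h O (D.push Z a δ) = ofExt h O δ ≫ (inTgt h O).map a := by
  ext
  · exact zero_comp.symm
  · exact zero_comp.symm
  · exact ((congrArg (· + _) (map_zero _)).trans (zero_add _)).symm

/-- The entry `𝟙 O` is additive in `f` only because `O` is a zero object. -/
theorem inSrc_additive {O : C} (hO : IsZero O) : (inSrc h O).Additive where
  map_add := by
    intros
    ext
    · rfl
    · exact hO.eq_of_src _ _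
    · exact (add_zero _).symm

theorem inTgt_additive {O : C} (hO : IsZero O) : (inTgt h O).Additive where
  map_add := by
    intros
    ext
    · exact hO.eq_of_src _ _
    · rfl
    · exact (add_zero _).symm

theorem inSrc_linear {O : C} (hO : IsZero O) : (inSrc h O).Linear k where
  map_smul := by
    intros
    ext
    · rfl
    · exact hO.eq_of_src _ _
    · exact (smul_zero (A := D.Ext _ _) (_ : k)).symm

theorem inTgt_linear {O : C} (hO : IsZero O) : (inTgt h O).Linear k where
  map_smul := by
    intros
    ext
    · exact hO.eq_of_src _ _
    · rfl
    · exact (smul_zero (A := D.Ext _ _) (_ : k)).symm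

theorem isIso (f : A ⟶ B) (h₁ : IsIso f.src) (h₂ : IsIso f.tgt) : IsIso f := by
  refine ⟨⟨inv f.src, inv f.tgt, -D.pull (inv f.src) _ (D.push _ (inv f.tgt) f.cls)⟩, ?_, ?_⟩
  · ext
    · simp
    · simp
    · simp [← ExtriData.pull_comp]
  · ext
    · simp
    · simp
    · simp [← ExtriData.push_comp, ← ExtriData.pull_push]

/-- The objects both of whose summands lie in `N`. -/
def property (h : D.IsExtriangulated) (N : ObjectProperty C) : ObjectProperty (Collage h) :=
  fun A => N A.src ∧ N A.tgt

/-- The morphisms both of whose diagonal components lie in `S`. -/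
def morphisms (h : D.IsExtriangulated) (S : MorphismProperty C) : MorphismProperty (Collage h) :=
  fun _ _ f => S f.src ∧ S f.tgt

variable {N : ObjectProperty C}

open ExtriData

/-- A composite through a pair of objects of `N` has as its extension entry a pullback from `N` plus
a pushforward from `N`, both null. Conversely, a null extension is pushed forward from some `K` in
`N`, and enlarging the second summand by `K` accommodates it. -/
theorem factors_iff (g : D.Adapted N) {f : A ⟶ B} :
    Factors (property h N) f ↔ Factors N f.src ∧ Factors N f.tgt ∧ D.NullExt N f.cls := by
  constructor
  · rintro ⟨M, ⟨hM, hM'⟩, i, j, rfl⟩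
    exact ⟨⟨_, hM, _, _, rfl⟩, ⟨_, hM', _, _, rfl⟩,
      g.nullExt_add (g.nullExt_pull hM _ _) (g.nullExt_push hM' _ _)⟩
  · rintro ⟨⟨M, hM, i, j, hij⟩, ⟨M', hM', i', j', hij'⟩, hf⟩
    obtain ⟨K, hK, m, ε, hε⟩ := hf.exists_push
    obtain ⟨W, i₁, i₂, p₁, p₂, hW⟩ := h.exists_sum M' K
    refine ⟨⟨M, W⟩, ⟨hM, g.sum hW hM' hK⟩, ⟨i, i' ≫ i₁, D.push _ i₂ ε⟩,
      ⟨j, p₁ ≫ j' + p₂ ≫ m, 0⟩, ?_⟩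
    ext
    · exact hij
    · simpa [hW.inl_fst_assoc, hW.inl_snd_assoc] using hij'
    · simpa [← push_comp, hW.inr_fst_assoc, hW.inr_snd_assoc] using hε

theorem fractionsModulo (g : D.Adapted N) :
    FractionsModulo (property h N) (morphisms h (D.sN N)) where
  zero A B := (factors_iff g).mpr ⟨g.factors_zero, g.factors_zero, g.nullExt_zero⟩
  add hf hf' := by
    rw [factors_iff g] at hf hf' ⊢
    exact ⟨g.factors_add hf.1 hf'.1, g.factors_add hf.2.1 hf'.2.1, g.nullExt_add hf.2.2 hf'.2.2⟩
  id A := ⟨g.sN_of_isIso (𝟙 _), g.sN_of_isIso (𝟙 _)⟩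
  comp hs hs' := ⟨.comp _ _ hs.1 hs'.1, .comp _ _ hs.2 hs'.2⟩
  ore {A A' B s} hs f := by
    obtain ⟨Y, t, a, ht, hF⟩ := g.exists_ore hs.1 f.src
    obtain ⟨Y', t', a', ht', hF'⟩ := g.exists_ore hs.2 f.tgt
    -- The diagonal Ore squares leave a discrepancy between extension entries. The Ore condition for
    -- extensions writes it, after pushing along `b`, as a pullback along `s.src`; this `η` becomes
    -- the extension entry of the new map.
    obtain ⟨Y'', b, η, hb, hη⟩ :=
      g.exists_ext_ore_op hs.1 (D.push _ t' f.cls - D.push _ a' s.cls)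
    refine ⟨⟨Y, Y''⟩, ⟨t, t' ≫ b, 0⟩, ⟨a, a' ≫ b, η⟩, ⟨.inf _ ht, .inf _ (g.infN_comp ht' hb)⟩,
      (factors_iff g).mpr ⟨hF, ?_, ?_⟩⟩
    · simpa using hF'.postcomp b
    · convert g.nullExt_zero using 1
      simp [hη, push_comp]
  cancel {A A' B s} hs f hf := by
    obtain ⟨h₁, h₂, h₃⟩ := (factors_iff g).mp hf
    obtain ⟨Y, t, ht, hF⟩ := g.exists_cancel hs.1 h₁
    obtain ⟨Y', t', ht', hF'⟩ := g.exists_cancel hs.2 h₂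
    refine ⟨⟨Y, Y'⟩, ⟨t, t', 0⟩, ⟨.inf _ ht, .inf _ ht'⟩, (factors_iff g).mpr ⟨hF, hF', ?_⟩⟩
    -- Pulled back along `s.src`, the entry is that of `s ≫ f` minus a pushforward of `s.cls` along
    -- `f.tgt ≫ t'`; both terms are null.
    refine g.nullExt_of_pull hs.1 ?_
    obtain ⟨M, hM, i, j, hij⟩ := hF'
    have h₄ := g.nullExt_add (h₃.push t') (g.nullExt_push hM j (D.push _ i s.cls)).neg
    convert h₄ using 1
    simp [← push_comp, hij, pull_push]
  ore_op {A B B' s} hs f := by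
    obtain ⟨Y, t, a, ht, hF⟩ := g.exists_ore_op hs.1 f.src
    obtain ⟨Y', t', a', ht', hF'⟩ := g.exists_ore_op hs.2 f.tgt
    obtain ⟨Y'', b, η, hb, hη⟩ := g.exists_ext_ore hs.2 (D.pull t _ f.cls - D.pull a _ s.cls)
    refine ⟨⟨Y'', Y'⟩, ⟨b ≫ t, t', 0⟩, ⟨b ≫ a, a', η⟩, ⟨.df _ (g.defN_comp hb ht), .df _ ht'⟩,
      (factors_iff g).mpr ⟨?_, hF', ?_⟩⟩
    · simpa using hF.precomp b
    · convert g.nullExt_zero using 1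
      simp [hη, pull_comp]
  cancel_op {A B B' s} hs f hf := by
    obtain ⟨h₁, h₂, h₃⟩ := (factors_iff g).mp hf
    obtain ⟨Y, t, ht, hF⟩ := g.exists_cancel_op hs.1 h₁
    obtain ⟨Y', t', ht', hF'⟩ := g.exists_cancel_op hs.2 h₂
    refine ⟨⟨Y, Y'⟩, ⟨t, t', 0⟩, ⟨.df _ ht, .df _ ht'⟩, (factors_iff g).mpr ⟨hF, hF', ?_⟩⟩
    refine g.nullExt_of_push hs.2 ?_
    obtain ⟨M, hM, i, j, hij⟩ := hF
    have h₄ := g.nullExt_add (h₃.pull t) (g.nullExt_pull hM i (D.pull j _ s.cls)).neg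
    convert h₄ using 1
    simp [← pull_comp, hij, pull_push]

theorem morphisms_of_factors_sub (g : D.Adapted N) {f f' : A ⟶ B}
    (hf : morphisms h (D.sN N) f) (hF : Factors (property h N) (f' - f)) :
    morphisms h (D.sN N) f' :=
  have hF := (factors_iff g).mp hF
  ⟨g.sN_of_factors_sub hf.1 hF.1, g.sN_of_factors_sub hf.2 hF.2.1⟩

theorem exists_sum (g : D.Adapted N) (A B : Collage h) (hB : property h N B) :
    ∃ (W : Collage h) (i₁ : A ⟶ W) (i₂ : B ⟶ W) (p₁ : W ⟶ A) (p₂ : W ⟶ B),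
      IsDirectSum i₁ i₂ p₁ p₂ ∧ morphisms h (D.sN N) p₁ := by
  obtain ⟨W, i₁, i₂, p₁, p₂, hW⟩ := h.exists_sum A.src B.src
  obtain ⟨V, j₁, j₂, q₁, q₂, hV⟩ := h.exists_sum A.tgt B.tgt
  refine ⟨⟨W, V⟩, ⟨i₁, j₁, 0⟩, ⟨i₂, j₂, 0⟩, ⟨p₁, q₁, 0⟩, ⟨p₂, q₂, 0⟩, ⟨?_, ?_, ?_, ?_, ?_⟩,
    g.sN_fst hW hB.1, g.sN_fst hV hB.2⟩
  · ext
    · exact hW.inl_fst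
    · exact hV.inl_fst
    · simp
  · ext
    · exact hW.inr_snd
    · exact hV.inr_snd
    · simp
  · ext
    · exact hW.inl_snd
    · exact hV.inl_snd
    · simp
  · ext
    · exact hW.inr_fst
    · exact hV.inr_fst
    · simp
  · ext
    · exact hW.total
    · exact hV.total
    · simp

end Collage
end Extri

/-! ### Extensions of the localization as morphisms of the localized collage. -/

namespace Extri

open ExtriData

/-- A functor out of a localization is additive if its restriction is. -/
theorem additive_of_comp {C : Type u} [Category.{v} C] [Preadditive C] {L : Type u₁}
    [Category.{v₁} L] [Preadditive L] {E : Type u₂} [Category.{v₂} E] [Preadditive E]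
    {Q : C ⥤ L} (hQ : Q.Additive) (hess : ∀ X : L, ∃ X₀ : C, Nonempty (Q.obj X₀ ≅ X))
    (hfrac : ∀ {X Y : C} (f : Q.obj X ⟶ Q.obj Y), ∃ (Y' : C) (a : X ⟶ Y') (s : Y ⟶ Y'),
      IsIso (Q.map s) ∧ f ≫ Q.map s = Q.map a)
    (F : L ⥤ E) (hF : (Q ⋙ F).Additive) : F.Additive := by
  have key : ∀ {X Y : C} (f f' : Q.obj X ⟶ Q.obj Y), F.map (f + f') = F.map f + F.map f' := by
    intro X Y f f'
    obtain ⟨Y', a, s, hs, ha⟩ := hfrac f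
    -- `s ≫ s'` is a common denominator for `f` and `f'`.
    obtain ⟨Y'', b, s', hs', hb⟩ := hfrac (f' ≫ Q.map s)
    have ha' : f ≫ Q.map s ≫ Q.map s' = Q.map (a ≫ s') := by rw [reassoc_of% ha, Q.map_comp]
    have hb' : f' ≫ Q.map s ≫ Q.map s' = Q.map b := by rw [← hb, Category.assoc]
    rw [← cancel_mono (F.map (Q.map s ≫ Q.map s')), Preadditive.add_comp, ← F.map_comp,
      ← F.map_comp, ← F.map_comp, Preadditive.add_comp, ha', hb', ← Q.map_add]
    exact (Q ⋙ F).map_add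
  refine ⟨fun {X Y} f f' => ?_⟩
  obtain ⟨X₀, ⟨α⟩⟩ := hess X
  obtain ⟨Y₀, ⟨β⟩⟩ := hess Y
  have := key (α.hom ≫ f ≫ β.inv) (α.hom ≫ f' ≫ β.inv)
  rw [← Preadditive.comp_add, ← Preadditive.add_comp] at this
  simp only [F.map_comp] at this
  rw [← Preadditive.comp_add, ← Preadditive.add_comp] at this
  exact (cancel_mono (F.map β.inv)).mp ((cancel_epi (F.map α.hom)).mp this)

/-- A functor out of a localization is linear if its restriction is. -/
theorem linear_of_comp {k : Type t} [CommRing k] {C : Type u} [Category.{v} C] [Preadditive C]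
    [Linear k C] {L : Type u₁} [Category.{v₁} L] [Preadditive L] [Linear k L] {E : Type u₂}
    [Category.{v₂} E] [Preadditive E] [Linear k E] {Q : C ⥤ L} (hQ : Q.Linear k)
    (hess : ∀ X : L, ∃ X₀ : C, Nonempty (Q.obj X₀ ≅ X))
    (hfrac : ∀ {X Y : C} (f : Q.obj X ⟶ Q.obj Y), ∃ (Y' : C) (a : X ⟶ Y') (s : Y ⟶ Y'),
      IsIso (Q.map s) ∧ f ≫ Q.map s = Q.map a)
    (F : L ⥤ E) (hF : (Q ⋙ F).Linear k) : F.Linear k := by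
  have key : ∀ {X Y : C} (r : k) (f : Q.obj X ⟶ Q.obj Y), F.map (r • f) = r • F.map f := by
    intro X Y r f
    obtain ⟨Y', a, s, hs, ha⟩ := hfrac f
    rw [← cancel_mono (F.map (Q.map s)), Linear.smul_comp, ← F.map_comp, ← F.map_comp,
      Linear.smul_comp, ha, ← Q.map_smul]
    exact (Q ⋙ F).map_smul r a
  refine ⟨fun {X Y} f r => ?_⟩
  obtain ⟨X₀, ⟨α⟩⟩ := hess X
  obtain ⟨Y₀, ⟨β⟩⟩ := hess Y
  have := key r (α.hom ≫ f ≫ β.inv)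
  rw [← Linear.comp_smul, ← Linear.smul_comp] at this
  simp only [F.map_comp] at this
  rw [← Linear.comp_smul, ← Linear.smul_comp] at this
  exact (cancel_mono (F.map β.inv)).mp ((cancel_epi (F.map α.hom)).mp this)

theorem exists_iso_Q_obj {C : Type u} [Category.{v} C] {S : MorphismProperty C}
    (X : S.Localization) : ∃ X₀ : C, Nonempty (S.Q.obj X₀ ≅ X) :=
  ⟨_, ⟨eqToIso ((Localization.Construction.objEquiv S).apply_symm_apply X)⟩⟩

variable {k : Type t} [CommRing k] {C : Type u} [Category.{v} C] [Preadditive C] [Linear k C]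
  {D : ExtriData.{u, v, w} k C} {N : ObjectProperty C}
  {L : Type u₁} [Category.{v₁} L] [Preadditive L] [Linear k L]
  {L₂ : Type u₂} [Category.{v₂} L₂] [Preadditive L₂] [Linear k L₂]

/-- Denominators of fractions can be improved to lie in `Inf_N` and `Def_N`. -/
theorem ExtriData.Adapted.invertsByFractions (g : D.Adapted N) {Q : C ⥤ L} (hQ : Q.Additive)
    (hess : ∀ X : L, ∃ X₀ : C, Nonempty (Q.obj X₀ ≅ X)) (hinv : (D.sN N).IsInvertedBy Q)
    (hfracL : ∀ {X Y : C} (f : Q.obj X ⟶ Q.obj Y), ∃ (Y' : C) (a : X ⟶ Y') (s : Y ⟶ Y'),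
      D.sN N s ∧ f ≫ Q.map s = Q.map a)
    (hfracR : ∀ {X Y : C} (f : Q.obj X ⟶ Q.obj Y), ∃ (X' : C) (s : X' ⟶ X) (a : X' ⟶ Y),
      D.sN N s ∧ Q.map s ≫ f = Q.map a)
    (heqL : ∀ {X Y : C} {f f' : X ⟶ Y}, Q.map f = Q.map f' → ∃ (Y' : C) (s : Y ⟶ Y'),
      D.sN N s ∧ Factors N ((f - f') ≫ s))
    (heqR : ∀ {X Y : C} {f f' : X ⟶ Y}, Q.map f = Q.map f' → ∃ (X' : C) (s : X' ⟶ X),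
      D.sN N s ∧ Factors N (s ≫ (f - f'))) : D.InvertsByFractions N Q where
  additive := hQ
  essSurj := hess
  inverts s hs := hinv s hs
  fracL f := by
    obtain ⟨Y', a, s, hs, h⟩ := hfracL f
    obtain ⟨M, W, i₁, i₂, p₁, p₂, s', hW, hM, hs', rfl⟩ := g.exists_infN_of_sN hs
    refine ⟨W, a ≫ i₁, s', hs', ?_⟩
    have := hinv p₁ (g.sN_fst hW hM)
    rw [← cancel_mono (Q.map p₁), Category.assoc, ← Q.map_comp, h, ← Q.map_comp, Category.assoc,
      hW.inl_fst, Category.comp_id]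
  fracR f := by
    obtain ⟨Y', s, a, hs, h⟩ := hfracR f
    obtain ⟨M, W, i₁, i₂, p₁, p₂, s', hW, hM, hs', rfl⟩ := g.exists_defN_of_sN hs
    refine ⟨W, s', p₁ ≫ a, hs', ?_⟩
    have := hinv i₁ (g.sN_inl hW hM)
    rw [← cancel_epi (Q.map i₁), ← Q.map_comp_assoc, h, ← Q.map_comp, reassoc_of% hW.inl_fst]
  eqL {X Y f f'} h := by
    obtain ⟨Y', s, hs, h⟩ := heqL h
    obtain ⟨M, W, i₁, i₂, p₁, p₂, s', hW, hM, hs', rfl⟩ := g.exists_infN_of_sN hs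
    refine ⟨W, s', hs', ?_⟩
    have := g.factors_add (h.postcomp i₁) ((Factors.mk hM p₂ i₂).precomp ((f - f') ≫ s'))
    simpa only [Category.assoc, ← Preadditive.comp_add, hW.total, Category.comp_id] using this
  eqR {X Y f f'} h := by
    obtain ⟨Y', s, hs, h⟩ := heqR h
    obtain ⟨M, W, i₁, i₂, p₁, p₂, s', hW, hM, hs', rfl⟩ := g.exists_defN_of_sN hs
    refine ⟨W, s', hs', ?_⟩
    have := g.factors_add (h.precomp p₁) ((Factors.mk hM p₂ i₂).postcomp (s' ≫ (f - f')))
    simpa only [← Category.assoc, ← Preadditive.add_comp, hW.total, Category.id_comp] using this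

namespace Collage

variable {h : D.IsExtriangulated} {O : C} {Q : C ⥤ L} (R : Collage h ⥤ L₂) {F₀ F₁ : L ⥤ L₂}
  (e₀ : Q ⋙ F₀ ≅ inSrc h O ⋙ R) (e₁ : Q ⋙ F₁ ≅ inTgt h O ⋙ R)

/-- The image of an extension under a functor out of `Collage h`. -/
def mapExt [R.Additive] [R.Linear k] (Z X : C) :
    D.Ext Z X →ₗ[k] (F₀.obj (Q.obj Z) ⟶ F₁.obj (Q.obj X)) where
  toFun δ := e₀.hom.app Z ≫ R.map (ofExt h O δ) ≫ e₁.inv.app X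
  map_add' δ δ' := by
    have : ofExt h O (δ + δ') = ofExt h O δ + ofExt h O δ' := by
      ext
      · exact (add_zero _).symm
      · exact (add_zero _).symm
      · rfl
    rw [this, R.map_add, Preadditive.add_comp, Preadditive.comp_add]
  map_smul' r δ := by
    have : ofExt h O (r • δ) = r • ofExt h O δ := by
      ext
      · exact (smul_zero _).symm
      · exact (smul_zero _).symm
      · rfl
    rw [this, R.map_smul, Linear.smul_comp, Linear.comp_smul, RingHom.id_apply]

theorem mapExt_apply [R.Additive] [R.Linear k] {Z X : C} (δ : D.Ext Z X) :
    mapExt R e₀ e₁ Z X δ = e₀.hom.app Z ≫ R.map (ofExt h O δ) ≫ e₁.inv.app X := rfl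

/-- The extriangulated data on `L` whose extensions are morphisms of `L₂`, and whose triangles are
the sequences isomorphic to the image of a triangle. -/
def locData [R.Additive] [R.Linear k] : ExtriData.{u₁, v₁, v₂} k L where
  E := F₀.op ⋙ linearCoyoneda k L₂ ⋙ (Functor.whiskeringLeft _ _ _).obj F₁
  realizes {X Y Z} x y ε := ∃ (X₀ Y₀ Z₀ : C) (x₀ : X₀ ⟶ Y₀) (y₀ : Y₀ ⟶ Z₀) (δ : D.Ext Z₀ X₀)
    (a : Q.obj X₀ ≅ X) (b : Q.obj Y₀ ≅ Y) (c : Q.obj Z₀ ≅ Z), D.realizes x₀ y₀ δ ∧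
    Q.map x₀ ≫ b.hom = a.hom ≫ x ∧ Q.map y₀ ≫ c.hom = b.hom ≫ y ∧
    mapExt R e₀ e₁ Z₀ X₀ δ ≫ F₁.map a.hom = F₀.map c.hom ≫ (show F₀.obj Z ⟶ F₁.obj X from ε)

theorem ext_eq_zero_of_tgt (h : D.IsExtriangulated) {O Z : C} (hO : IsZero O) (δ : D.Ext Z O) :
    δ = 0 := by
  rw [← D.push_id Z O δ, hO.eq_of_src (𝟙 O) 0, h.push_zero]

theorem ext_eq_zero_of_src (h : D.IsExtriangulated) {O X : C} (hO : IsZero O) (δ : D.Ext O X) :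
    δ = 0 := by
  rw [← D.pull_id O X δ, hO.eq_of_src (𝟙 O) 0, h.pull_zero]

theorem mapExt_push [R.Additive] [R.Linear k] {Z X X' : C} (a : X ⟶ X') (δ : D.Ext Z X) :
    mapExt R e₀ e₁ Z X' (D.push Z a δ) = mapExt R e₀ e₁ Z X δ ≫ F₁.map (Q.map a) := by
  have := e₁.inv.naturality a
  dsimp at this
  rw [mapExt_apply, mapExt_apply, ofExt_push, R.map_comp, Category.assoc, Category.assoc,
    Category.assoc, ← this]

theorem mapExt_pull [R.Additive] [R.Linear k] {Z Z' X : C} (c : Z' ⟶ Z) (δ : D.Ext Z X) :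
    mapExt R e₀ e₁ Z' X (D.pull c X δ) = F₀.map (Q.map c) ≫ mapExt R e₀ e₁ Z X δ := by
  have := e₀.hom.naturality c
  dsimp at this
  rw [mapExt_apply, mapExt_apply, ofExt_pull, R.map_comp, reassoc_of% this, Category.assoc]

/-- In a right fraction of the localized collage the target summand of the apex `A` is irrelevant:
restricting along `A.src ⟶ A` leaves a denominator in `C` and an extension as numerator. The normal
form of `S_N` then improves the denominator to one in `Def_N`. -/
theorem exists_pull_eq [R.Additive] [R.Linear k] (g : D.Adapted N) (hO : IsZero O)
    (q : D.InvertsByFractions N Q)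
    (hfracR : ∀ {X Y : Collage h} (f : R.obj X ⟶ R.obj Y), ∃ (X' : Collage h) (s : X' ⟶ X)
      (a : X' ⟶ Y), morphisms h (D.sN N) s ∧ R.map s ≫ f = R.map a)
    {Z X : C} (ε : F₀.obj (Q.obj Z) ⟶ F₁.obj (Q.obj X)) :
    ∃ (Z' : C) (s : Z' ⟶ Z) (δ : D.Ext Z' X), D.defN N s ∧
      F₀.map (Q.map s) ≫ ε = mapExt R e₀ e₁ Z' X δ := by
  obtain ⟨A, s, a, hs, e⟩ := hfracR (e₀.inv.app Z ≫ ε ≫ e₁.hom.app X)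
  let i : (inSrc h O).obj A.src ⟶ A := ⟨𝟙 _, 0, 0⟩
  let s₀ : A.src ⟶ Z := s.src
  let α : D.Ext A.src X := a.cls
  have hs₀ : i ≫ s = (inSrc h O).map s₀ :=
    hom_ext (Category.id_comp _) (hO.eq_of_src _ _)
      ((ext_eq_zero_of_tgt h hO _).trans (ext_eq_zero_of_tgt h hO _).symm)
  have hα : i ≫ a = ofExt h O α :=
    hom_ext (hO.eq_of_tgt _ _) (hO.eq_of_src _ _)
      (show D.pull (𝟙 A.src) X α + D.push A.src (show A.tgt ⟶ X from a.tgt) 0 = α by simp)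
  have e' : F₀.map (Q.map s₀) ≫ ε = mapExt R e₀ e₁ A.src X α := by
    have := e₀.hom.naturality s₀
    dsimp at this
    rw [mapExt_apply, ← hα, R.map_comp, ← e, ← R.map_comp_assoc, hs₀, Category.assoc,
      ← reassoc_of% this]
    simp
  obtain ⟨M, W, i₁, i₂, p₁, p₂, s', hW, hM, hs', e''⟩ := g.exists_defN_of_sN (f := s₀) hs.1
  refine ⟨W, s', D.pull p₁ _ α, hs', ?_⟩
  have := q.inverts i₁ (g.sN_inl hW hM)
  rw [mapExt_pull, ← e', ← e'', ← cancel_epi (F₀.map (Q.map i₁))]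
  simp only [Q.map_comp, F₀.map_comp, ← Category.assoc]
  simp only [← F₀.map_comp, ← Q.map_comp, hW.inl_fst, Category.id_comp]

theorem exists_push_eq [R.Additive] [R.Linear k] (g : D.Adapted N) (hO : IsZero O)
    (q : D.InvertsByFractions N Q)
    (hfracL : ∀ {X Y : Collage h} (f : R.obj X ⟶ R.obj Y), ∃ (Y' : Collage h) (a : X ⟶ Y')
      (s : Y ⟶ Y'), morphisms h (D.sN N) s ∧ f ≫ R.map s = R.map a)
    {Z X : C} (ε : F₀.obj (Q.obj Z) ⟶ F₁.obj (Q.obj X)) :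
    ∃ (X' : C) (s : X ⟶ X') (δ : D.Ext Z X'), D.infN N s ∧
      ε ≫ F₁.map (Q.map s) = mapExt R e₀ e₁ Z X' δ := by
  obtain ⟨A, a, s, hs, e⟩ := hfracL (e₀.inv.app Z ≫ ε ≫ e₁.hom.app X)
  let p : A ⟶ (inTgt h O).obj A.tgt := ⟨0, 𝟙 _, 0⟩
  let s₀ : X ⟶ A.tgt := s.tgt
  let α : D.Ext Z A.tgt := a.cls
  have hs₀ : s ≫ p = (inTgt h O).map s₀ :=
    hom_ext (hO.eq_of_src _ _) (Category.comp_id _)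
      ((ext_eq_zero_of_src h hO _).trans (ext_eq_zero_of_src h hO _).symm)
  have hα : a ≫ p = ofExt h O α :=
    hom_ext (hO.eq_of_tgt _ _) (hO.eq_of_src _ _)
      (show D.pull (show Z ⟶ A.src from a.src) A.tgt 0 + D.push Z (𝟙 A.tgt) α = α by simp)
  have e' : ε ≫ F₁.map (Q.map s₀) = mapExt R e₀ e₁ Z A.tgt α := by
    have := e₁.inv.naturality s₀
    dsimp at this
    rw [mapExt_apply, ← hα, R.map_comp, ← e, Category.assoc, Category.assoc, Category.assoc,
      Category.assoc, ← R.map_comp_assoc, hs₀, this]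
    simp
  obtain ⟨M, W, i₁, i₂, p₁, p₂, s', hW, hM, hs', e''⟩ := g.exists_infN_of_sN (f := s₀) hs.2
  refine ⟨W, s', D.push _ i₁ α, hs', ?_⟩
  have := q.inverts p₁ (g.sN_fst hW hM)
  rw [mapExt_push, ← e', ← e'', ← cancel_mono (F₁.map (Q.map p₁))]
  simp only [Q.map_comp, F₁.map_comp, Category.assoc]
  simp only [← F₁.map_comp, ← Q.map_comp, hW.inl_fst, Category.comp_id]

theorem localizes [R.Additive] [R.Linear k] (g : D.Adapted N) (hO : IsZero O)
    (q : D.InvertsByFractions N Q)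
    (hF₀ : F₀.Additive) (hF₀' : F₀.Linear k) (hF₁ : F₁.Additive) (hF₁' : F₁.Linear k)
    (hfracL : ∀ {X Y : Collage h} (f : R.obj X ⟶ R.obj Y), ∃ (Y' : Collage h) (a : X ⟶ Y')
      (s : Y ⟶ Y'), morphisms h (D.sN N) s ∧ f ≫ R.map s = R.map a)
    (hfracR : ∀ {X Y : Collage h} (f : R.obj X ⟶ R.obj Y), ∃ (X' : Collage h) (s : X' ⟶ X)
      (a : X' ⟶ Y), morphisms h (D.sN N) s ∧ R.map s ≫ f = R.map a)
    (heqL : ∀ {X Y : Collage h} {f f' : X ⟶ Y}, R.map f = R.map f' → ∃ (Y' : Collage h)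
      (s : Y ⟶ Y'), morphisms h (D.sN N) s ∧ Factors (property h N) ((f - f') ≫ s)) :
    D.Localizes N (locData R e₀ e₁) Q (mapExt R e₀ e₁) where
  toInvertsByFractions := q
  push_add Z X X' a a' δ :=
    (congrArg (_ ≫ ·) F₁.map_add).trans (Preadditive.comp_add _ _ _ _ _ _)
  push_smul Z X X' r a δ :=
    (congrArg (_ ≫ ·) (F₁.map_smul r a)).trans (Linear.comp_smul _ _ _ _ _ _)
  pull_add c c' X δ :=
    (congrArg (· ≫ _) F₀.map_add).trans (Preadditive.add_comp _ _ _ _ _ _)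
  pull_smul r c X δ :=
    (congrArg (· ≫ _) (F₀.map_smul r c)).trans (Linear.smul_comp _ _ _ _ _ _)
  map_push Z X X' a δ := mapExt_push R e₀ e₁ a δ
  map_pull c X δ := mapExt_pull R e₀ e₁ c δ
  fracExt ε := exists_pull_eq R e₀ e₁ g hO q hfracR ε
  fracExt_op ε := exists_push_eq R e₀ e₁ g hO q hfracL ε
  eqExt {Z X δ} hδ := by
    have e : R.map (ofExt h O δ) = R.map 0 := by
      rw [R.map_zero, ← cancel_mono (e₁.inv.app X), ← cancel_epi (e₀.hom.app Z), ← mapExt_apply]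
      refine hδ.trans ?_
      rw [zero_comp, comp_zero]
      rfl
    -- If `δ` dies in the localized collage, a pushforward of `δ` along a map in `S_N` is null, and
    -- such pushforwards reflect nullity.
    obtain ⟨A, s, hs, hF⟩ := heqL e
    have e' : ((ofExt h O δ - 0) ≫ s).cls = D.push Z s.tgt δ := by
      rw [sub_zero]
      exact (congrArg (· + _) (h.pull_zero s.cls)).trans (zero_add _)
    exact g.nullExt_of_push hs.2 (e' ▸ ((factors_iff g).mp hF).2.2)
  realizes_iff := Iff.rfl

end Collage
end Extri

/-! ### Exact functors out of the localization. -/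

namespace Extri

open ExtriData

variable {k : Type t} [CommRing k] {C : Type u} [Category.{v} C] [Preadditive C] [Linear k C]
  {D : ExtriData.{u, v, w} k C} {N : ObjectProperty C}
  {L : Type u₁} [Category.{v₁} L] [Preadditive L] [Linear k L]

/-- A localization is an exact functor. -/
def ExtriData.Localizes.exactFunctor {D' : ExtriData.{u₁, v₁, w₁} k L} {Q : C ⥤ L}
    {μ : ∀ Z X : C, D.Ext Z X →ₗ[k] D'.Ext (Q.obj Z) (Q.obj X)} (q : D.Localizes N D' Q μ)
    (hQ : Q.Linear k) : ExactFunctor D D' where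
  toFunctor := Q
  additive := q.additive
  linear := hQ
  φ := μ
  φ_push := q.map_push
  φ_pull := q.map_pull
  map_realizes {X Y Z x y δ} r := q.realizes_iff.mpr ⟨X, Y, Z, x, y, δ, Iso.refl _, Iso.refl _,
    Iso.refl _, r, by simp, by simp, by simp⟩

/-- Agreement on extensions is stated through `eqToHom`, which avoids a heterogeneous equality over
the equality of functors. -/
theorem ExactFunctor.ext_of_eq {D' : ExtriData.{u₁, v₁, w₁} k L} {F F' : ExactFunctor D D'}
    (h : F.toFunctor = F'.toFunctor) (hφ : ∀ (Z X : C) (δ : D.Ext Z X),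
      D'.push _ ((eqToHom h).app X) (F.φ Z X δ) = D'.pull ((eqToHom h).app Z) _ (F'.φ Z X δ)) :
    F = F' := by
  obtain ⟨F, _, _, φ, _, _, _⟩ := F
  obtain ⟨F', _, _, φ', _, _, _⟩ := F'
  dsimp only at h hφ
  subst h
  have : φ = φ' := by
    funext Z X
    ext δ
    simpa using hφ Z X δ
  subst this
  rfl

/-- Exact functors out of a localization are determined by their restrictions. -/
theorem ExtriData.Localizes.exactFunctor_ext {D' : ExtriData.{u₁, v₁, w₁} k L} {Q : C ⥤ L}
    {μ : ∀ Z X : C, D.Ext Z X →ₗ[k] D'.Ext (Q.obj Z) (Q.obj X)} (q : D.Localizes N D' Q μ)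
    (hQ : Q.Linear k) {C'' : Type u₂} [Category.{v₂} C''] [Preadditive C''] [Linear k C'']
    {D'' : ExtriData.{u₂, v₂, w₂} k C''} {F F' : ExactFunctor D' D''}
    (h : F.toFunctor = F'.toFunctor)
    (hF : (q.exactFunctor hQ).comp F = (q.exactFunctor hQ).comp F') : F = F' := by
  obtain ⟨F, _, _, φ, h₁, h₂, _⟩ := F
  obtain ⟨F', _, _, φ', h₁', h₂', _⟩ := F'
  dsimp only at h
  subst h
  have hμ : ∀ (Z X : C) (δ : D.Ext Z X), φ _ _ (μ Z X δ) = φ' _ _ (μ Z X δ) := by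
    intro Z X δ
    have := (ExactFunctor.mk.inj hF).2
    exact LinearMap.congr_fun (congrFun (congrFun (eq_of_heq this) Z) X) δ
  have : φ = φ' := by
    funext Z X
    ext ε
    obtain ⟨X₀, ⟨α⟩⟩ := q.essSurj X
    obtain ⟨Z₀, ⟨γ⟩⟩ := q.essSurj Z
    obtain ⟨Z₁, s, δ, hs, e⟩ := q.fracExt (D'.pull γ.hom _ (D'.push _ α.inv ε))
    have := q.inverts s (.df _ hs)
    -- Every extension of the localization is carried by isomorphisms to the image of one of `C`, so
    -- naturality and the values on such images determine `φ`.
    have e' : ε = D'.push _ α.hom (D'.pull (γ.inv ≫ inv (Q.map s)) _ (μ Z₁ X₀ δ)) := by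
      rw [← e]
      simp [← push_comp, ← pull_comp, pull_push]
    rw [e', h₁, h₂, hμ, ← h₂', ← h₁']
  subst this
  rfl

/-- The extension entry of a composite of three collage morphisms of which only the middle one
carries an extension. -/
theorem ExtriData.pull_add_push (D : ExtriData.{u, v, w} k C) {X X' X'' Z Z' Z'' : C} (s : Z' ⟶ Z)
    (f : Z ⟶ Z'') (m : X ⟶ X') (g : X'' ⟶ X') (δ : D.Ext Z X) :
    D.pull s X' (D.pull f X' 0 + D.push Z m δ) + D.push Z' g 0 = D.push Z' m (D.pull s X δ) := by
  rw [map_zero, map_zero, zero_add, add_zero, pull_push]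

theorem push_eq_pull_of_section {X X' X'' Z Z' Z'' : C} {s : Z ⟶ Z'} {s' : Z' ⟶ Z}
    (hs : s ≫ s' = 𝟙 _) {m : X ⟶ X'} {a : X' ⟶ X''} {c : Z' ⟶ Z''} {δ : D.Ext Z X}
    {ε : D.Ext Z'' X''} (h : D.push _ a (D.push _ m (D.pull s' _ δ)) = D.pull c _ ε) :
    D.push Z (m ≫ a) δ = D.pull (s ≫ c) X'' ε := by
  rw [pull_comp, ← h, pull_push, pull_push, ← pull_comp, hs, pull_id, push_comp]

theorem conj_eq {T : Type*} [Category* T] {A₀ A₁ A₂ A₃ B₀ B₁ B₂ B₃ : T} (t₀ : A₀ ≅ A₃)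
    {t₁ : B₀ ⟶ B₃} {a : A₀ ⟶ A₁} {r : A₁ ⟶ A₂} {i : A₂ ⟶ A₃} {i' : A₃ ⟶ A₂} (hi : i ≫ i' = 𝟙 _)
    {b : B₀ ⟶ B₁} {b' : B₁ ⟶ B₀} (hb : b' ≫ b = 𝟙 _) {r' : B₁ ⟶ B₂} {j : B₂ ⟶ B₃} {m : A₁ ⟶ B₁}
    {n : A₂ ⟶ B₂} (h : m ≫ r' = r ≫ n) (h₀ : t₀.hom = a ≫ r ≫ i) (h₁ : t₁ = b ≫ r' ≫ j) :
    t₀.inv ≫ (a ≫ m ≫ b') ≫ t₁ = i' ≫ n ≫ j := by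
  rw [Iso.inv_comp_eq, h₀, h₁]
  simp [reassoc_of% hi, reassoc_of% hb, reassoc_of% h]

namespace Collage

variable {h : D.IsExtriangulated} {C'' : Type u₂} [Category.{v₂} C''] [Preadditive C'']
  [Linear k C''] {D'' : ExtriData.{u₂, v₂, w₂} k C''} (h'' : D''.IsExtriangulated)

/-- The functor between collages induced by an exact functor. -/
@[simps]
def map (h : D.IsExtriangulated) (G : ExactFunctor D D'') : Collage h ⥤ Collage h'' where
  obj A := ⟨G.toFunctor.obj A.src, G.toFunctor.obj A.tgt⟩
  map f := ⟨G.toFunctor.map f.src, G.toFunctor.map f.tgt, G.φ _ _ f.cls⟩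
  map_id A := hom_ext (G.toFunctor.map_id _) (G.toFunctor.map_id _) (map_zero _)
  map_comp f f' := hom_ext (G.toFunctor.map_comp _ _) (G.toFunctor.map_comp _ _) (by
    rw [comp_cls, comp_cls, map_add, G.φ_push, G.φ_pull])

theorem map_additive (G : ExactFunctor D D'') : (map h'' h G).Additive where
  map_add := by
    have := G.additive
    intros
    exact hom_ext G.toFunctor.map_add G.toFunctor.map_add (map_add _ _ _)

theorem map_linear (G : ExactFunctor D D'') : (map h'' h G).Linear k where
  map_smul f r := by
    have := G.linear
    exact hom_ext (G.toFunctor.map_smul _ _) (G.toFunctor.map_smul _ _) (map_smul _ _ _)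

theorem map_inSrc (G : ExactFunctor D D'') {O Z Z' : C} (f : Z ⟶ Z') :
    (map h'' h G).map ((inSrc h O).map f) =
      (inSrc h'' (G.toFunctor.obj O)).map (G.toFunctor.map f) :=
  hom_ext rfl (G.toFunctor.map_id _) (map_zero _)

theorem map_inTgt (G : ExactFunctor D D'') {O X X' : C} (f : X ⟶ X') :
    (map h'' h G).map ((inTgt h O).map f) =
      (inTgt h'' (G.toFunctor.obj O)).map (G.toFunctor.map f) :=
  hom_ext (G.toFunctor.map_id _) rfl (map_zero _)

variable {L₂ : Type*} [Category* L₂] [Preadditive L₂] [Linear k L₂]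
  {O : C} {Q : C ⥤ L} {R : Collage h ⥤ L₂} {F₀ F₁ : L ⥤ L₂}
  {e₀ : Q ⋙ F₀ ≅ inSrc h O ⋙ R} {e₁ : Q ⋙ F₁ ≅ inTgt h O ⋙ R}
  (G : ExactFunctor D D'') {G' : L ⥤ C''} (κ : Q ⋙ G' ≅ G.toFunctor)
  {K' : L₂ ⥤ Collage h''} (ρ : R ⋙ K' ≅ map h'' h G)
  (θ₀ : F₀ ⋙ K' ≅ G' ⋙ inSrc h'' (G.toFunctor.obj O))
  (θ₁ : F₁ ⋙ K' ≅ G' ⋙ inTgt h'' (G.toFunctor.obj O))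

/-- The action on extensions of a functor induced on a localization. -/
def descExt [K'.Additive] [K'.Linear k] (Z X : L) :
    (F₀.obj Z ⟶ F₁.obj X) →ₗ[k] D''.Ext (G'.obj Z) (G'.obj X) where
  toFun ε := (θ₀.inv.app Z ≫ K'.map ε ≫ θ₁.hom.app X).cls
  map_add' ε ε' := by
    rw [K'.map_add, Preadditive.add_comp, Preadditive.comp_add]
    rfl
  map_smul' r ε := by
    rw [K'.map_smul, Linear.smul_comp, Linear.comp_smul]
    rfl

variable [K'.Additive] [K'.Linear k]

theorem descExt_push {Z X X' : L} (a : X ⟶ X') (ε : F₀.obj Z ⟶ F₁.obj X) :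
    descExt h'' G θ₀ θ₁ Z X' (ε ≫ F₁.map a) =
      D''.push _ (G'.map a) (descExt h'' G θ₀ θ₁ Z X ε) := by
  have e : θ₀.inv.app Z ≫ K'.map (ε ≫ F₁.map a) ≫ θ₁.hom.app X' =
      (θ₀.inv.app Z ≫ K'.map ε ≫ θ₁.hom.app X) ≫ (inTgt h'' _).map (G'.map a) := by
    have := θ₁.hom.naturality a
    dsimp only [Functor.comp_map] at this
    simp only [K'.map_comp, Category.assoc, this]
  refine (congrArg Hom.cls e).trans ?_
  exact (congrArg (· + _) (map_zero _)).trans (zero_add _)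

theorem descExt_pull {Z Z' X : L} (c : Z' ⟶ Z) (ε : F₀.obj Z ⟶ F₁.obj X) :
    descExt h'' G θ₀ θ₁ Z' X (F₀.map c ≫ ε) =
      D''.pull (G'.map c) _ (descExt h'' G θ₀ θ₁ Z X ε) := by
  have e : θ₀.inv.app Z' ≫ K'.map (F₀.map c ≫ ε) ≫ θ₁.hom.app X =
      (inSrc h'' _).map (G'.map c) ≫ (θ₀.inv.app Z ≫ K'.map ε ≫ θ₁.hom.app X) := by
    have := θ₀.inv.naturality c
    dsimp only [Functor.comp_map] at this
    simp only [K'.map_comp, Category.assoc, reassoc_of% this]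
  refine (congrArg Hom.cls e).trans ?_
  exact (congrArg (_ + ·) (map_zero _)).trans (add_zero _)

/-- On extensions coming from `C` the induced action is that of `G`, transported along `κ`.
Preservation of triangles and the factorization `Q.comp G'' = G` both rest on this. -/
theorem descExt_mapExt [R.Additive] [R.Linear k]
    (hθ₀ : ∀ Z : C, θ₀.hom.app (Q.obj Z) = K'.map (e₀.hom.app Z) ≫
      ρ.hom.app ((inSrc h O).obj Z) ≫ (inSrc h'' (G.toFunctor.obj O)).map (κ.inv.app Z))
    (hθ₁ : ∀ X : C, θ₁.hom.app (Q.obj X) = K'.map (e₁.hom.app X) ≫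
      ρ.hom.app ((inTgt h O).obj X) ≫ (inTgt h'' (G.toFunctor.obj O)).map (κ.inv.app X))
    {Z X : C} (δ : D.Ext Z X) :
    descExt h'' G θ₀ θ₁ _ _ (mapExt R e₀ e₁ Z X δ) =
      D''.push _ (κ.inv.app X) (D''.pull (κ.hom.app Z) _ (G.φ Z X δ)) := by
  have hi : (inSrc h'' (G.toFunctor.obj O)).map (κ.inv.app Z) ≫
      (inSrc h'' (G.toFunctor.obj O)).map (κ.hom.app Z) = 𝟙 _ :=
    ((inSrc h'' (G.toFunctor.obj O)).map_comp _ _).symm.trans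
      ((congrArg _ (κ.inv_hom_id_app Z)).trans ((inSrc h'' (G.toFunctor.obj O)).map_id _))
  have hb : K'.map (e₁.inv.app X) ≫ K'.map (e₁.hom.app X) = 𝟙 _ :=
    (K'.map_comp _ _).symm.trans ((congrArg _ (e₁.inv_hom_id_app X)).trans (K'.map_id _))
  have e : θ₀.inv.app (Q.obj Z) ≫ K'.map (mapExt R e₀ e₁ Z X δ) ≫ θ₁.hom.app (Q.obj X) =
      (inSrc h'' (G.toFunctor.obj O)).map (κ.hom.app Z) ≫ (map h'' h G).map (ofExt h O δ) ≫
        (inTgt h'' (G.toFunctor.obj O)).map (κ.inv.app X) := by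
    rw [mapExt_apply, K'.map_comp, K'.map_comp]
    exact conj_eq (θ₀.app (Q.obj Z)) hi hb (ρ.hom.naturality (ofExt h O δ)) (hθ₀ Z) (hθ₁ X)
  refine (congrArg Hom.cls e).trans ?_
  exact D''.pull_add_push _ _ _ _ _

/-- The exact functor induced on a localization. -/
def desc [R.Additive] [R.Linear k] (hG' : G'.Additive) (hG'' : G'.Linear k)
    (hθ₀ : ∀ Z : C, θ₀.hom.app (Q.obj Z) = K'.map (e₀.hom.app Z) ≫
      ρ.hom.app ((inSrc h O).obj Z) ≫ (inSrc h'' (G.toFunctor.obj O)).map (κ.inv.app Z))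
    (hθ₁ : ∀ X : C, θ₁.hom.app (Q.obj X) = K'.map (e₁.hom.app X) ≫
      ρ.hom.app ((inTgt h O).obj X) ≫ (inTgt h'' (G.toFunctor.obj O)).map (κ.inv.app X)) :
    ExactFunctor (locData R e₀ e₁) D'' where
  toFunctor := G'
  additive := hG'
  linear := hG''
  φ := descExt h'' G θ₀ θ₁
  φ_push _ _ _ a ε := descExt_push h'' G θ₀ θ₁ a ε
  φ_pull c _ ε := descExt_pull h'' G θ₀ θ₁ c ε
  map_realizes := by
    rintro X Y Z x y ε ⟨X₀, Y₀, Z₀, x₀, y₀, δ, a, b, c, r, h₁, h₂, h₃⟩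
    refine h''.realizes_of_iso (G.map_realizes r) ((κ.app X₀).symm ≪≫ G'.mapIso a)
      ((κ.app Y₀).symm ≪≫ G'.mapIso b) ((κ.app Z₀).symm ≪≫ G'.mapIso c) ?_ ?_ ?_
    · have := κ.inv.naturality x₀
      dsimp at this ⊢
      rw [reassoc_of% this, Category.assoc, ← G'.map_comp, ← G'.map_comp, h₁]
    · have := κ.inv.naturality y₀
      dsimp at this ⊢
      rw [reassoc_of% this, Category.assoc, ← G'.map_comp, ← G'.map_comp, h₂]
    · have h₄ := congrArg (descExt h'' G θ₀ θ₁ _ _) h₃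
      rw [descExt_push, descExt_pull, descExt_mapExt h'' G κ ρ θ₀ θ₁ hθ₀ hθ₁] at h₄
      exact push_eq_pull_of_section (κ.inv_hom_id_app Z₀) h₄

end Collage
end Extri

/-! ### Extension-closed subcategories, and exact functors vanishing on `N`. -/

namespace Extri

open ExtriData

variable {k : Type t} [CommRing k] {C : Type u} [Category.{v} C] [Preadditive C] [Linear k C]
  {D : ExtriData.{u, v, w} k C} {N : ObjectProperty C}

theorem ExtriData.IsExtensionClosed.hasBinaryBiproducts_full (hN : D.IsExtensionClosed N)
    (h : D.IsExtriangulated) : HasBinaryBiproducts N.FullSubcategory := by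
  refine ⟨fun X Y => ?_⟩
  obtain ⟨W, i₁, i₂, p₁, p₂, hW⟩ := h.exists_sum X.obj Y.obj
  have hNW : N W := hN.ext i₁ p₂ ⟨0, h.realizes_split hW⟩ X.property Y.property
  let W' : N.FullSubcategory := ⟨W, hNW⟩
  have hW' : IsDirectSum (ObjectProperty.homMk i₁ : X ⟶ W') (ObjectProperty.homMk i₂ : Y ⟶ W')
      (ObjectProperty.homMk p₁) (ObjectProperty.homMk p₂) :=
    ⟨ObjectProperty.hom_ext _ hW.inl_fst, ObjectProperty.hom_ext _ hW.inr_snd,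
      ObjectProperty.hom_ext _ hW.inl_snd, ObjectProperty.hom_ext _ hW.inr_fst,
      ObjectProperty.hom_ext _ hW.total⟩
  exact hW'.hasBinaryBiproduct

/-- Extension-closed subcategories of extriangulated categories are extriangulated. -/
theorem ExtriData.IsExtensionClosed.isExtriangulated_full (hN : D.IsExtensionClosed N)
    (h : D.IsExtriangulated) : (D.full N).IsExtriangulated where
  hasZeroObject := by
    obtain ⟨O, hO, hNO⟩ := hN.containsZero.exists_zero
    refine ⟨⟨⟨O, hNO⟩, (IsZero.iff_id_eq_zero _).mpr ?_⟩⟩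
    exact ObjectProperty.hom_ext _ (hO.eq_of_src _ _)
  hasBinaryBiproducts := hN.hasBinaryBiproducts_full h
  push_add Z _ _ a a' δ := h.push_add Z.obj a.hom a'.hom δ
  push_smul Z _ _ r a δ := h.push_smul Z.obj r a.hom δ
  pull_add c c' X δ := h.pull_add c.hom c'.hom X.obj δ
  pull_smul r c X δ := h.pull_smul r c.hom X.obj δ
  exists_realizes {Z X} δ := by
    obtain ⟨Y, x, y, r⟩ := h.exists_realizes (Z := Z.obj) (X := X.obj) δ
    exact ⟨⟨Y, hN.ext x y ⟨_, r⟩ X.property Z.property⟩, ObjectProperty.homMk x,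
      ObjectProperty.homMk y, r⟩
  realizes_iff {X Y Y' Z x y δ} r x' y' := by
    refine (h.realizes_iff (δ := δ) r x'.hom y'.hom).trans ⟨?_, ?_⟩
    · rintro ⟨e, h₁, h₂⟩
      exact ⟨N.isoMk e, ObjectProperty.hom_ext _ h₁, ObjectProperty.hom_ext _ h₂⟩
    · rintro ⟨e, h₁, h₂⟩
      exact ⟨N.ι.mapIso e, congrArg (·.hom) h₁, congrArg (·.hom) h₂⟩
  exists_lift {X Y Z X' Y' Z' x y δ x' y' δ'} r r' a c e := by
    obtain ⟨b, h₁, h₂⟩ := h.exists_lift (δ := δ) (δ' := δ') r r' a.hom c.hom e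
    exact ⟨ObjectProperty.homMk b, ObjectProperty.hom_ext _ h₁, ObjectProperty.hom_ext _ h₂⟩
  realizes_zero Z X :=
    have := hN.hasBinaryBiproducts_full h
    h.realizes_split ((IsDirectSum.biprod X Z).map N.ι)
  realizes_sum {X Y Z X' Y' Z' x y δ x' y' δ'} r r' := by
    have := hN.hasBinaryBiproducts_full h
    rw [biprod.map_eq, biprod.map_eq]
    have key := h.realizes_directSum (X := X.obj) (Z := Z.obj) (X' := X'.obj) (Z' := Z'.obj)
      (x := x.hom) (y := y.hom) (δ := δ) (x' := x'.hom) (y' := y'.hom) (δ' := δ') r r'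
      ((IsDirectSum.biprod X X').map N.ι)
      ((IsDirectSum.biprod Y Y').map N.ι) ((IsDirectSum.biprod Z Z').map N.ι)
    exact key
  et3 {X Y Z X' Y' Z' x y δ x' y' δ'} r r' a b e := by
    obtain ⟨c, h₁, h₂⟩ := h.et3 (δ := δ) (δ' := δ') r r' a.hom b.hom (congrArg (·.hom) e)
    exact ⟨ObjectProperty.homMk c, ObjectProperty.hom_ext _ h₁, h₂⟩
  et3_op {X Y Z X' Y' Z' x y δ x' y' δ'} r r' b c e := by
    obtain ⟨a, h₁, h₂⟩ := h.et3_op (δ := δ) (δ' := δ') r r' b.hom c.hom (congrArg (·.hom) e)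
    exact ⟨ObjectProperty.homMk a, ObjectProperty.hom_ext _ h₁, h₂⟩
  et4 {A B X₁ Y F f f' δ g g' ρ} r r' := by
    obtain ⟨G, h', d, e, δ', r₁, r₂, h₁, h₂, h₃, h₄⟩ := h.et4 (δ := δ) (ρ := ρ) r r'
    exact ⟨⟨G, hN.ext d e ⟨_, r₂⟩ X₁.property F.property⟩, ObjectProperty.homMk h',
      ObjectProperty.homMk d, ObjectProperty.homMk e, δ', r₁, r₂, ObjectProperty.hom_ext _ h₁,
      ObjectProperty.hom_ext _ h₂, h₃, h₄⟩
  et4_op {A B X₁ Y F f' f δ g' g ρ} r r' := by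
    obtain ⟨G, h', d, e, δ', r₁, r₂, h₁, h₂, h₃, h₄⟩ := h.et4_op (δ := δ) (ρ := ρ) r r'
    exact ⟨⟨G, hN.ext d e ⟨_, r₂⟩ X₁.property F.property⟩, ObjectProperty.homMk h',
      ObjectProperty.homMk d, ObjectProperty.homMk e, δ', r₁, r₂, ObjectProperty.hom_ext _ h₁,
      ObjectProperty.hom_ext _ h₂, h₃, h₄⟩

/-- Exact functors that vanish on `N` invert the class `S_N`. -/
theorem ExactFunctor.sN_isInvertedBy {C'' : Type u₂} [Category.{v₂} C'']
    [Preadditive C''] [Linear k C''] {D'' : ExtriData.{u₂, v₂, w₂} k C''}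
    (h'' : D''.IsExtriangulated) (G : ExactFunctor D D'')
    (hG : ∀ X, N X → IsZero (G.toFunctor.obj X)) : (D.sN N).IsInvertedBy G.toFunctor := by
  intro X Y f hf
  induction hf with
  | inf f hf =>
    obtain ⟨Z, y, ⟨δ, r⟩, hZ⟩ := hf
    have r' := G.map_realizes r
    -- An extension with a zero end vanishes, so the image triangle is isomorphic to the trivial one
    -- and its inflation is invertible.
    rw [Collage.ext_eq_zero_of_src h'' (hG Z hZ) (G.φ _ _ δ)] at r'
    obtain ⟨e, he, -⟩ := h''.exists_iso_of_realizes (h''.realizes_right_zero _ (hG Z hZ)) r'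
    rw [← he, Category.id_comp]
    infer_instance
  | df f hf =>
    obtain ⟨Z, y, ⟨δ, r⟩, hZ⟩ := hf
    have r' := G.map_realizes r
    rw [Collage.ext_eq_zero_of_tgt h'' (hG Z hZ) (G.φ _ _ δ)] at r'
    obtain ⟨e, -, he⟩ := h''.exists_iso_of_realizes r' (h''.realizes_left_zero _ (hG Z hZ))
    rw [← he, Category.comp_id]
    infer_instance
  | comp f f' _ _ hf hf' =>
    rw [G.toFunctor.map_comp]
    infer_instance

end Extri

/-! ### The universal property and the exact sequence. -/

namespace Extri

open ExtriData

variable {k : Type t} [CommRing k] {C : Type u} [Category.{v} C] [Preadditive C] [Linear k C]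
  {D : ExtriData.{u, v, w} k C} {N : ObjectProperty C}

theorem push_push_of_section {X X' Z : C} {s : X ⟶ X'} {s' : X' ⟶ X} (hs : s ≫ s' = 𝟙 _)
    (δ : D.Ext Z X) : D.push Z s' (D.push Z s δ) = δ := by
  rw [← push_comp, hs, push_id]

theorem natural_of_three {T : Type*} [Category* T] {A₁ A₂ A₃ A₄ B₁ B₂ B₃ B₄ : T} {k₁ : A₁ ⟶ B₁}
    {k₂ : A₂ ⟶ B₂} {k₃ : A₃ ⟶ B₃} {k₄ : A₄ ⟶ B₄} {a : A₁ ⟶ A₂} {a' : B₁ ⟶ B₂} {b : A₂ ⟶ A₃}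
    {b' : B₂ ⟶ B₃} {c : A₃ ⟶ A₄} {c' : B₃ ⟶ B₄} (h₁ : k₁ ≫ a' = a ≫ k₂) (h₂ : k₂ ≫ b' = b ≫ k₃)
    (h₃ : k₃ ≫ c' = c ≫ k₄) : k₁ ≫ a' ≫ b' ≫ c' = (a ≫ b ≫ c) ≫ k₄ := by
  simp [reassoc_of% h₁, reassoc_of% h₂, h₃]

namespace Collage

variable {h : D.IsExtriangulated} {C'' : Type u₂} [Category.{v₂} C''] [Preadditive C'']
  [Linear k C''] {D'' : ExtriData.{u₂, v₂, w₂} k C''} (h'' : D''.IsExtriangulated)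

/-- Exact functors extend along the localization that is constructed from the collage. -/
theorem exists_extension {S : MorphismProperty C} [Preadditive S.Localization]
    [Linear k S.Localization] {S₂ : MorphismProperty (Collage h)} [Preadditive S₂.Localization]
    [Linear k S₂.Localization] {O : C} {F₀ F₁ : S.Localization ⥤ S₂.Localization}
    {e₀ : S.Q ⋙ F₀ ≅ inSrc h O ⋙ S₂.Q} {e₁ : S.Q ⋙ F₁ ≅ inTgt h O ⋙ S₂.Q}
    [S₂.Q.Additive] [S₂.Q.Linear k]
    (q : D.Localizes N (locData S₂.Q e₀ e₁) S.Q (mapExt S₂.Q e₀ e₁)) (hQ : S.Q.Linear k)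
    (G : ExactFunctor D D'') {G' : S.Localization ⥤ C''} (κ : S.Q ⋙ G' = G.toFunctor)
    (hG : G'.Additive) (hG' : G'.Linear k) {K' : S₂.Localization ⥤ Collage h''}
    (ρ : S₂.Q ⋙ K' = map h'' h G) (hK : K'.Additive) (hK' : K'.Linear k) :
    ∃ G'' : ExactFunctor (locData S₂.Q e₀ e₁) D'', (q.exactFunctor hQ).comp G'' = G := by
  let κ' := eqToIso κ
  let ρ' := eqToIso ρ
  let τ₀ : S.Q ⋙ F₀ ⋙ K' ≅ S.Q ⋙ G' ⋙ inSrc h'' (G.toFunctor.obj O) :=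
    NatIso.ofComponents (fun Z => K'.mapIso (e₀.app Z) ≪≫ ρ'.app ((inSrc h O).obj Z) ≪≫
      (inSrc h'' (G.toFunctor.obj O)).mapIso (κ'.app Z).symm) fun {Z Z'} f => by
      have h₁ := congrArg K'.map (e₀.hom.naturality f)
      have h₂ := ρ'.hom.naturality ((inSrc h O).map f)
      have h₃ := congrArg (inSrc h'' (G.toFunctor.obj O)).map (κ'.inv.naturality f)
      rw [map_inSrc] at h₂
      rw [K'.map_comp, K'.map_comp] at h₁
      rw [(inSrc h'' _).map_comp, (inSrc h'' _).map_comp] at h₃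
      exact natural_of_three h₁ h₂ h₃
  let τ₁ : S.Q ⋙ F₁ ⋙ K' ≅ S.Q ⋙ G' ⋙ inTgt h'' (G.toFunctor.obj O) :=
    NatIso.ofComponents (fun Z => K'.mapIso (e₁.app Z) ≪≫ ρ'.app ((inTgt h O).obj Z) ≪≫
      (inTgt h'' (G.toFunctor.obj O)).mapIso (κ'.app Z).symm) fun {Z Z'} f => by
      have h₁ := congrArg K'.map (e₁.hom.naturality f)
      have h₂ := ρ'.hom.naturality ((inTgt h O).map f)
      have h₃ := congrArg (inTgt h'' (G.toFunctor.obj O)).map (κ'.inv.naturality f)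
      rw [map_inTgt] at h₂
      rw [K'.map_comp, K'.map_comp] at h₁
      rw [(inTgt h'' _).map_comp, (inTgt h'' _).map_comp] at h₃
      exact natural_of_three h₁ h₂ h₃
  -- The comparison isomorphisms are natural over `C`, and extend uniquely to the localization.
  let θ₀ := Localization.liftNatIso S.Q S _ _ (F₀ ⋙ K') (G' ⋙ inSrc h'' (G.toFunctor.obj O)) τ₀
  let θ₁ := Localization.liftNatIso S.Q S _ _ (F₁ ⋙ K') (G' ⋙ inTgt h'' (G.toFunctor.obj O)) τ₁
  have hθ₀ : ∀ Z : C, θ₀.hom.app (S.Q.obj Z) = K'.map (e₀.hom.app Z) ≫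
      ρ'.hom.app ((inSrc h O).obj Z) ≫ (inSrc h'' (G.toFunctor.obj O)).map (κ'.inv.app Z) :=
    fun Z => (Localization.liftNatTrans_app S.Q S _ _ _ _ τ₀.hom Z).trans
      ((Category.id_comp _).trans (Category.comp_id _))
  have hθ₁ : ∀ X : C, θ₁.hom.app (S.Q.obj X) = K'.map (e₁.hom.app X) ≫
      ρ'.hom.app ((inTgt h O).obj X) ≫ (inTgt h'' (G.toFunctor.obj O)).map (κ'.inv.app X) :=
    fun X => (Localization.liftNatTrans_app S.Q S _ _ _ _ τ₁.hom X).trans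
      ((Category.id_comp _).trans (Category.comp_id _))
  refine ⟨desc h'' G κ' ρ' θ₀ θ₁ hG hG' hθ₀ hθ₁, ExactFunctor.ext_of_eq κ fun Z X δ => ?_⟩
  have key := congrArg (D''.push (G'.obj (S.Q.obj Z)) (κ'.hom.app X))
    (descExt_mapExt h'' G κ' ρ' θ₀ θ₁ hθ₀ hθ₁ δ)
  exact key.trans (push_push_of_section (κ'.inv_hom_id_app X) _)

end Collage

/-- The localization at `S_N` of a category that is adapted to `N`. -/
theorem ExtriData.Adapted.exists_exactSequence (g : D.Adapted N) :
    ∃ (_ : Preadditive (D.sN N).Localization) (_ : Linear k (D.sN N).Localization)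
      (D' : ExtriData.{u, max u v, max u v w} k (D.sN N).Localization) (Q : ExactFunctor D D'),
      D.InvertsByFractions N (D.sN N).Q ∧ Q.toFunctor = (D.sN N).Q ∧
      IsExactSequence.{u, v, w, u, max u v, max u v w, u₂, v₂, w₂} D N D' Q := by
  have h := g.ext
  obtain ⟨O, hO⟩ := h.exists_zero
  let S := D.sN N
  let S₂ := Collage.morphisms h S
  obtain ⟨_, _, hQ, hQ', hL, hR, hE, hE'⟩ := g.fractionsModulo.exists_linear_localization (k := k)
    (fun hf hF => g.sN_of_factors_sub hf hF) (fun X M hM => by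
      obtain ⟨W, i₁, i₂, p₁, p₂, hW⟩ := h.exists_sum X M
      exact ⟨W, i₁, i₂, p₁, p₂, hW, g.sN_fst hW hM⟩)
  obtain ⟨_, _, hP, hP', hL₂, hR₂, hE₂, -⟩ :=
    (Collage.fractionsModulo (h := h) g).exists_linear_localization (k := k)
      (fun hf hF => Collage.morphisms_of_factors_sub g hf hF) (Collage.exists_sum g)
  have q : D.InvertsByFractions N S.Q :=
    g.invertsByFractions hQ exists_iso_Q_obj S.Q_inverts hL hR hE hE'
  have hL' : ∀ {X Y : C} (f : S.Q.obj X ⟶ S.Q.obj Y), ∃ (Y' : C) (a : X ⟶ Y') (s : Y ⟶ Y'),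
      IsIso (S.Q.map s) ∧ f ≫ S.Q.map s = S.Q.map a := fun f => by
    obtain ⟨Y', a, s, hs, e⟩ := hL f
    exact ⟨Y', a, s, S.Q_inverts s hs, e⟩
  have hL₂' : ∀ {X Y : Collage h} (f : S₂.Q.obj X ⟶ S₂.Q.obj Y), ∃ (Y' : Collage h) (a : X ⟶ Y')
      (s : Y ⟶ Y'), IsIso (S₂.Q.map s) ∧ f ≫ S₂.Q.map s = S₂.Q.map a := fun f => by
    obtain ⟨Y', a, s, hs, e⟩ := hL₂ f
    exact ⟨Y', a, s, S₂.Q_inverts s hs, e⟩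
  have h₀ : S.IsInvertedBy (Collage.inSrc h O ⋙ S₂.Q) := fun _ _ s hs =>
    S₂.Q_inverts _ ⟨hs, g.sN_of_isIso (𝟙 O)⟩
  have h₁ : S.IsInvertedBy (Collage.inTgt h O ⋙ S₂.Q) := fun _ _ s hs =>
    S₂.Q_inverts _ ⟨g.sN_of_isIso (𝟙 O), hs⟩
  -- The two copies of `C` in the collage induce two functors on the localization; the localized `𝔼`
  -- is the group of morphisms from the image of `F₀` to that of `F₁`.
  let F₀ := Localization.Construction.lift _ h₀
  let F₁ := Localization.Construction.lift _ h₁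
  have f₀ : S.Q ⋙ F₀ = Collage.inSrc h O ⋙ S₂.Q := Localization.Construction.fac _ _
  have f₁ : S.Q ⋙ F₁ = Collage.inTgt h O ⋙ S₂.Q := Localization.Construction.fac _ _
  have := Collage.inSrc_additive (h := h) hO
  have := Collage.inTgt_additive (h := h) hO
  have := Collage.inSrc_linear (h := h) hO
  have := Collage.inTgt_linear (h := h) hO
  have l := Collage.localizes S₂.Q (eqToIso f₀) (eqToIso f₁) g hO q
    (additive_of_comp hQ exists_iso_Q_obj hL' F₀ (by rw [f₀]; infer_instance))
    (linear_of_comp hQ' exists_iso_Q_obj hL' F₀ (by rw [f₀]; infer_instance))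
    (additive_of_comp hQ exists_iso_Q_obj hL' F₁ (by rw [f₁]; infer_instance))
    (linear_of_comp hQ' exists_iso_Q_obj hL' F₁ (by rw [f₁]; infer_instance)) hL₂ hR₂ hE₂
  refine ⟨_, _, Collage.locData S₂.Q (eqToIso f₀) (eqToIso f₁), l.exactFunctor hQ', q, rfl,
    { extriangulated_mid := h
      extriangulated_right := l.isExtriangulated g
      extensionClosed := g.closed
      extriangulated_left := g.closed.isExtriangulated_full h
      image := fun X => ⟨fun hX => ⟨⟨X, hX⟩, ⟨Iso.refl _⟩⟩,
        fun ⟨M, ⟨e⟩⟩ => g.closed.isoClosed.of_iso e M.property⟩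
      kernel := fun X => ⟨fun hX => q.isZero_obj g hX, fun hX => q.mem_of_isZero g hX⟩
      universal := ?_ }⟩
  intro C'' _ _ _ D'' h'' G hG
  have hG₀ : S.IsInvertedBy G.toFunctor := G.sN_isInvertedBy h'' fun X hX => hG ⟨X, hX⟩
  -- A triangular matrix is invertible as soon as its diagonal is, so `G` extends to the localized
  -- collage, which gives its action on extensions.
  have hG₁ : S₂.IsInvertedBy (Collage.map h'' h G) := fun _ _ f hf =>
    Collage.isIso _ (hG₀ _ hf.1) (hG₀ _ hf.2)
  let G' := Localization.Construction.lift _ hG₀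
  let K' := Localization.Construction.lift _ hG₁
  have κ : S.Q ⋙ G' = G.toFunctor := Localization.Construction.fac _ _
  have ρ : S₂.Q ⋙ K' = Collage.map h'' h G := Localization.Construction.fac _ _
  obtain ⟨G'', e⟩ := Collage.exists_extension h'' l hQ' G κ
    (additive_of_comp hQ exists_iso_Q_obj hL' G' (by rw [κ]; exact G.additive))
    (linear_of_comp hQ' exists_iso_Q_obj hL' G' (by rw [κ]; exact G.linear)) ρ
    (additive_of_comp hP exists_iso_Q_obj hL₂' K' (by rw [ρ]; exact Collage.map_additive h'' G))
    (linear_of_comp hP' exists_iso_Q_obj hL₂' K' (by rw [ρ]; exact Collage.map_linear h'' G))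
  refine ⟨G'', e, fun F hF => l.exactFunctor_ext hQ' ?_ (hF.trans e.symm)⟩
  -- The Gabriel–Zisman construction has the strict universal property, so the underlying functors
  -- are equal and not merely isomorphic.
  exact Localization.Construction.uniq _ _ (congrArg ExactFunctor.toFunctor (hF.trans e.symm))

end Extri

theorem theoremA {k : Type t} [CommRing k]
    {A : Type u} [Category.{v} A] [Preadditive A] [Linear k A]
    (D : ExtriData.{u, v, w} k A) (hD : D.IsExtriangulated)
    (hA : WeaklyIdempotentComplete A)
    (N : ObjectProperty A) (hN : D.IsExtensionClosed N) (hsum : ClosedUnderSummands N) :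
    -- `𝔼_N` is a closed subbifunctor of `𝔼`
    (D.subN N).IsClosed ∧
    -- (0) `N` carries the same extriangulated structure as a subcategory of `A` and of `A_N`
    (∀ Z X : A, N Z → N X → (D.subN N).carrier Z X = ⊤) ∧
    -- (1) the condition `(♠)`
    (D.substructure N).Spade N ∧
    -- (2) admissibility, and the exact sequence `N ⟶ A_N ⟶ A_N/N = A[S_N⁻¹]`
    IsAdmissible (D.substructure N) N ∧
    (∃ (_ : Preadditive ((D.substructure N).sN N).Localization)
      (_ : Linear k ((D.substructure N).sN N).Localization)
      (D' : ExtriData.{u, max u v, max u v w} k ((D.substructure N).sN N).Localization)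
      (Q : ExactFunctor (D.substructure N) D'),
      Q.toFunctor = ((D.substructure N).sN N).Q ∧
      IsExactSequence.{u, v, w, u, max u v, max u v w, u₂, v₂, w₂}
        (D.substructure N) N D' Q) ∧
    -- (3) the factorizations of `S_N`
    (D.substructure N).sN N =
      compClass ((D.substructure N).defNsp N) ((D.substructure N).infN N) ∧
    (D.substructure N).sN N =
      compClass ((D.substructure N).defN N) ((D.substructure N).infNsp N) ∧
    -- (3) `S_N` is saturated
    (∀ {X Y : A} (f : X ⟶ Y),
      (D.substructure N).sN N f ↔ IsIso (((D.substructure N).sN N).Q.map f)) := by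
  have hS : (D.substructure N).Adapted N := ExtriData.adapted_substructure hD hA hN hsum
  obtain ⟨i₁, i₂, D', Q, q, hQ, hE⟩ := hS.exists_exactSequence
  exact ⟨ExtriData.subN_isClosed hD hN,
    fun _ _ hZ hX => ExtriData.subN_carrier_eq_top hD hN hZ hX, hS.spade,
    hS.isAdmissible, ⟨i₁, i₂, D', Q, hQ, hE⟩, hS.sN_eq_compClass, hS.sN_eq_compClass',
    fun f => ⟨fun hf => MorphismProperty.Q_inverts _ f hf, fun hf => q.sN_of_isIso_map hS hf⟩⟩
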